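/- A circle graph is the intersection graph of finitely many chords of a circle: each vertex is assigned a chord with two distinct endpoints, and two distinct vertices are adjacent if and only if their chords intersect. The graph state of a finite simple graph $G=(V,E)$ is $|G\rangle=\big(\prod_{uv\in E}\mathrm{CZ}_{uv}\big)|+\rangle^{\otimes V}$. The CZ-distance of $|G\rangle$ is the minimum number of $\mathrm{CZ}$ gates in a circuit consisting of $\mathrm{H}$, $\mathrm{S}$ and $\mathrm{CZ}$ gates on the qubits $V$ that prepares $|G\rangle$ from $|0\rangle^{\otimes V}$ up to a global phase. For graphs $G,H$ on the same vertex set, $\mathrm{cz}(G,H)$ is the minimum $k$ for which there is a sequence of graphs $G=G_0,G_0',G_1,G_1',\dots,G_k,G_k'=H$ on this vertex set such that $G_i'$ is obtained from $G_i$ by a (possibly empty) sequence of local complementations for each $0\le i\le k$, and $G_i$ is obtained from $G_{i-1}'$ by adding or removing a single edge for each $1\le i\le k$; here a local complementation at a vertex $v$ complements the subgraph induced on the neighbours of $v$. Let $\mathrm{cz}(G)$ be $\mathrm{cz}(G,H)$ for the edgeless graph $H$ on the vertex set of $G$. **Theorem.** Let $G$ be an $n$-vertex circle graph with clique number at most $\omega$,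 where $\omega$ is a natural number. Then the CZ-distance of $|G\rangle$ is at most $4n\log_2\omega+7n$, and likewise $\mathrm{cz}(G)\le 4n\log_2\omega+7n$. (For the graph with $n=0$, where $\omega=0$ is possible, the bound is read as $0$.) -/

import Mathlib

namespace CZDistance

/-- A graph is a *circle graph* if it is the intersection graph of chords of a circle: every vertex
`v` is assigned a chord of the unit circle in `ℂ`, with two distinct endpoints `p v` and `q v`, and
two distinct vertices are adjacent if and only if their chords intersect. -/
def IsCircleGraph {V : Type*} (G : SimpleGraph V) : Prop :=
  ∃ p q : V → Circle, (∀ v, p v ≠ q v) ∧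
    ∀ u v, u ≠ v →
      (G.Adj u v ↔ (segment ℝ (p u : ℂ) (q u : ℂ) ∩ segment ℝ (p v : ℂ) (q v : ℂ)).Nonempty)

/-! ### CZ-distance of graphs -/

/-- The local complementation `G * v`: the adjacency between any two distinct neighbours of `v` is
complemented, and all other adjacencies are kept. -/
def localComplement {V : Type*} (G : SimpleGraph V) (v : V) : SimpleGraph V where
  Adj x y := x ≠ y ∧ Xor (G.Adj x y) (G.Adj v x ∧ G.Adj v y)
  symm := ⟨fun x y h => ⟨h.1.symm, by
    have h2 := h.2
    rwa [G.adj_comm x y, and_comm (a := G.Adj v x)] at h2⟩⟩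
  loopless := ⟨fun _ h => h.1 rfl⟩

/-- `H` can be obtained from `G` by a (possibly empty) sequence of local complementations. -/
def LocallyEquivalent {V : Type*} (G H : SimpleGraph V) : Prop :=
  Relation.ReflTransGen (fun A B => ∃ v, B = localComplement A v) G H

/-- There is a sequence of graphs `G = A 0, B 0, A 1, B 1, …, A k, B k = H` such that `B i` is
locally equivalent to `A i` for `0 ≤ i ≤ k`, and `A (i + 1)` arises from `B i` by adding or removing
a single edge for `0 ≤ i < k`. (`SimpleGraph.edge u v` is the graph whose only edge is `uv`.) -/
def CZSequence {V : Type*} (G H : SimpleGraph V) (k : ℕ) : Prop :=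
  ∃ A B : ℕ → SimpleGraph V, A 0 = G ∧ B k = H ∧
    (∀ i ≤ k, LocallyEquivalent (A i) (B i)) ∧
    ∀ i < k, ∃ u v, u ≠ v ∧ A (i + 1) = symmDiff (B i) (SimpleGraph.edge u v)

/-- The CZ-distance between two graphs on the same vertex set. On a finite vertex set the minimum
is attained, see `exists_czSequence`. -/
noncomputable def czDist {V : Type*} (G H : SimpleGraph V) : ℕ :=
  sInf {k | CZSequence G H k}

/-- The CZ-distance of a graph: its CZ-distance from the edgeless graph. -/
noncomputable def cz {V : Type*} (G : SimpleGraph V) : ℕ :=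
  czDist G ⊥

theorem CZSequence.snoc {V : Type*} {G H : SimpleGraph V} {k : ℕ} (h : CZSequence G H k)
    {u v : V} (huv : u ≠ v) :
    CZSequence G (symmDiff H (SimpleGraph.edge u v)) (k + 1) := by
  obtain ⟨A, B, hA, hB, h1, h2⟩ := h
  refine ⟨fun i => if i ≤ k then A i else symmDiff H (SimpleGraph.edge u v),
    fun i => if i ≤ k then B i else symmDiff H (SimpleGraph.edge u v), by simp [hA], by simp,
    ?_, ?_⟩
  · intro i _
    by_cases hik : i ≤ k
    · simpa [hik] using h1 i hik
    · simp only [hik, if_false]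
      exact Relation.ReflTransGen.refl
  · intro i hi
    have hik : i ≤ k := by omega
    by_cases hlt : i + 1 ≤ k
    · simpa [hik, hlt] using h2 i (by omega)
    · have : i = k := by omega
      subst this
      exact ⟨u, v, huv, by simp [hB]⟩

/-- On a finite vertex set, the minimum that defines the CZ-distance is over a nonempty set. -/
theorem exists_czSequence {V : Type*} [Finite V] (G H : SimpleGraph V) :
    ∃ k, CZSequence G H k := by
  classical
  have key : ∀ E : Finset (Sym2 V), (∀ e ∈ E, ¬ e.IsDiag) →
      ∃ k, CZSequence G (symmDiff G (SimpleGraph.fromEdgeSet (E : Set (Sym2 V)))) k := by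
    intro E
    induction E using Finset.induction_on with
    | empty =>
      intro _
      exact ⟨0, fun _ => G, fun _ => G, rfl, by simp, fun _ _ => Relation.ReflTransGen.refl,
        by simp⟩
    | insert e E he ih =>
      intro hd
      obtain ⟨k, hk⟩ := ih fun e h => hd e (Finset.mem_insert_of_mem h)
      have hed := hd e (Finset.mem_insert_self _ _)
      induction e using Sym2.inductionOn with
      | hf u v =>
      have huv : u ≠ v := by simpa using hed
      refine ⟨k + 1, ?_⟩
      have := hk.snoc huv
      rw [symmDiff_assoc] at this
      have hdisj : Disjoint (SimpleGraph.fromEdgeSet (E : Set (Sym2 V)))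
          (SimpleGraph.edge u v) := by
        rw [SimpleGraph.edge, SimpleGraph.fromEdgeSet_disjoint]
        rw [Set.disjoint_left]
        intro x hx hx'
        simp only [SimpleGraph.edgeSet_fromEdgeSet, Set.mem_sdiff, Set.mem_singleton_iff] at hx'
        exact he (hx'.1 ▸ hx)
      rw [hdisj.symmDiff_eq_sup, SimpleGraph.edge, ← SimpleGraph.fromEdgeSet_union] at this
      rwa [Finset.coe_insert, Set.insert_eq, Set.union_comm]
  have := Fintype.ofFinite V
  obtain ⟨k, hk⟩ := key (symmDiff G H).edgeFinset (by
    intro e he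
    exact SimpleGraph.not_isDiag_of_mem_edgeFinset he)
  refine ⟨k, ?_⟩
  rwa [SimpleGraph.coe_edgeFinset, SimpleGraph.fromEdgeSet_edgeSet, symmDiff_symmDiff_cancel_left]
    at hk

/-! ### CZ-distance of graph states -/

/-- (Unnormalised) state vectors of qubits indexed by `V`, as amplitudes in the computational
basis; `false` is `|0⟩` and `true` is `|1⟩`. -/
abbrev State (V : Type*) := (V → Bool) → ℂ

/-- The gates: Hadamard and phase gates on one qubit, CZ gates on two distinct qubits. -/
inductive Gate (V : Type*)
  | H (v : V)
  | S (v : V)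
  | CZ (u v : V) (huv : u ≠ v)

open Classical in
/-- The action of a gate on a state. -/
noncomputable def Gate.apply {V : Type*} : Gate V → State V → State V
  | .H v, ψ => fun x => (1 / (√2 : ℝ) : ℂ) *
      (ψ (Function.update x v false) +
        (if x v = true then -1 else 1) * ψ (Function.update x v true))
  | .S v, ψ => fun x => (if x v = true then Complex.I else 1) * ψ x
  | .CZ u v _, ψ => fun x => (if x u = true ∧ x v = true then -1 else 1) * ψ x

/-- Applies a list of gates, the head of the list first. -/
noncomputable def run {V : Type*} (C : List (Gate V)) (ψ : State V) : State V :=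
  C.foldl (fun φ g => g.apply φ) ψ

/-- The number of CZ gates in a circuit. -/
def czCount {V : Type*} : List (Gate V) → ℕ
  | [] => 0
  | .CZ _ _ _ :: C => czCount C + 1
  | _ :: C => czCount C

open Classical in
/-- The state `|0⟩ ⊗ ⋯ ⊗ |0⟩`. -/
noncomputable def zeroState (V : Type*) : State V :=
  fun x => if x = fun _ => false then 1 else 0

open Classical in
/-- The graph state `|G⟩ = (∏_{uv ∈ E(G)} CZ_{uv}) |+⟩ ⊗ ⋯ ⊗ |+⟩`, where `CZ_{uv}` is diagonal with
entry `-1` at the basis vectors in which both `u` and `v` are `1`, and entry `1` elsewhere. -/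
noncomputable def graphState {V : Type*} [Fintype V] (G : SimpleGraph V) : State V :=
  fun x => (∏ e ∈ G.edgeFinset, if ∀ v ∈ e, x v = true then (-1 : ℂ) else 1) *
    (1 / (√2 : ℝ) : ℂ) ^ Fintype.card V

/-- The circuit `C` prepares `|G⟩` from `|0⟩ ⊗ ⋯ ⊗ |0⟩`, up to a global phase. -/
def Prepares {V : Type*} [Fintype V] (C : List (Gate V)) (G : SimpleGraph V) : Prop :=
  ∃ c : ℂ, ‖c‖ = 1 ∧ run C (zeroState V) = c • graphState G

/-- The CZ-distance of the graph state `|G⟩`: the minimum number of CZ gates in a circuit of H, S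
and CZ gates that prepares it. The minimum is attained, see `exists_prepares`. -/
noncomputable def stateCZ {V : Type*} [Fintype V] (G : SimpleGraph V) : ℕ :=
  sInf {k | ∃ C : List (Gate V), Prepares C G ∧ czCount C = k}

open Classical in
theorem run_hadamards {V : Type*} (l : List V) (hl : l.Nodup) :
    run (l.map Gate.H) (zeroState V) =
      fun x => (1 / (√2 : ℝ) : ℂ) ^ l.length * if ∀ v, v ∉ l → x v = false then 1 else 0 := by
  induction l using List.reverseRecOn with
  | nil =>
    funext x
    simp [run, zeroState, funext_iff]
  | append_singleton l a ih =>
    rw [List.nodup_append] at hl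
    obtain ⟨hl1, -, hl2⟩ := hl
    have ha : a ∉ l := fun h => hl2 a h a (by simp) rfl
    have h1 : run ((l ++ [a]).map Gate.H) (zeroState V) =
        (Gate.H a).apply (run (l.map Gate.H) (zeroState V)) := by
      simp [run, List.foldl_append]
    rw [h1, ih hl1]
    funext x
    have ht : ¬ ∀ v, v ∉ l → Function.update x a true v = false := fun h => by
      simpa using h a ha
    have hf : (∀ v, v ∉ l → Function.update x a false v = false) ↔
        ∀ v, v ∉ l ++ [a] → x v = false := by
      refine forall_congr' fun v => ?_
      by_cases hv : v = a
      · subst hv; simp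
      · simp [hv]
    simp only [Gate.apply, if_neg ht, hf, List.length_append, List.length_singleton, pow_succ]
    ring

/-- The minimum that defines the CZ-distance of a graph state is over a nonempty set. -/
theorem exists_prepares {V : Type*} [Fintype V] (G : SimpleGraph V) :
    ∃ C : List (Gate V), Prepares C G := by
  classical
  have key : ∀ E : Finset (Sym2 V), (∀ e ∈ E, ¬ e.IsDiag) →
      ∃ C : List (Gate V), run C (zeroState V) = fun x =>
        (∏ e ∈ E, if ∀ v ∈ e, x v = true then (-1 : ℂ) else 1) *
          (1 / (√2 : ℝ) : ℂ) ^ Fintype.card V := by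
    intro E
    induction E using Finset.induction_on with
    | empty =>
      intro _
      refine ⟨(Finset.univ : Finset V).toList.map Gate.H, ?_⟩
      rw [run_hadamards _ (Finset.nodup_toList _)]
      funext x
      simp
    | insert e E he ih =>
      intro hd
      obtain ⟨C, hC⟩ := ih fun e h => hd e (Finset.mem_insert_of_mem h)
      have hed := hd e (Finset.mem_insert_self _ _)
      induction e using Sym2.inductionOn with
      | hf u v =>
      have huv : u ≠ v := by simpa using hed
      refine ⟨C ++ [Gate.CZ u v huv], ?_⟩
      have h1 : run (C ++ [Gate.CZ u v huv]) (zeroState V) =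
          (Gate.CZ u v huv).apply (run C (zeroState V)) := by
        simp [run, List.foldl_append]
      rw [h1, hC]
      funext x
      rw [Finset.prod_insert he]
      simp [Gate.apply]
  obtain ⟨C, hC⟩ := key G.edgeFinset fun e he => SimpleGraph.not_isDiag_of_mem_edgeFinset he
  refine ⟨C, 1, by simp, ?_⟩
  rw [hC, one_smul]
  rfl

end CZDistance

/-! The graph is reduced to the edgeless graph by local complementations, which are free, and edge
toggles, which cost 1 (`CZReach`). Both moves are involutions, and on graph states they are a
circuit of H and S gates and a single CZ gate, so one such reduction bounds both quantities
(`CZReach.cz_le`, `CZReach.stateCZ_le`).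

A circle graph is the interlacement graph of a word in which each vertex occurs twice
(`IsCircleGraph.exists_chordModel`, `wordGraph`). Swapping two neighbouring letters costs at most 1
(`czReach_swap`), reversing the stretch between the two copies of `v` is a local complementation
(`czReach_reverse`), and a pair `vv` of an absent letter can be put anywhere for free. One vertex is
isolated at cost at most `n - 1` and its pair serves as a movable container: letters enter or leave
it on either side at cost 1 each. Four consecutive segments sorted in alternating directions can
thus be merged into one sorted segment at cost 2 per letter (`exists_merge_four`).

The word is sorted block by block, in blocks of length `4 ^ j` for `j = 1, 2, …`. After sorting, two
chords that join the same two distinct blocks can be treated as twins, taken in the right order, so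
all but one of each class are deleted at cost 1 each; chords inside a block are isolated
(`czReach_filter_blockWord`). The surviving set `S` consists of distinct chords of a polygon whose
vertices are the blocks, and pairwise crossing ones give a clique of `G`. The Capoyleas–Pach bound
(`CrossBounded.card_le_two_mul`) yields `S.card * 4 ^ j ≤ 4 * ω * n` (`Stage.card_mul_le`).

The next merge costs `4 * S.card`, with `S.card ≤ min n (ω * n / 4 ^ (j - 1))`: about `log₄ ω`
full-price levels, then a geometric series. Isolation (`n`), the first sort (`3n/2`) and all
deletions (`n`) add at most `7n/2`; the other `7n/2` comes from estimating the series
(`exists_add_div_four_pow_le`). -/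

namespace CZDistance

/-! ### Local complementation, edge toggles, and the isolation of vertices -/

section Reachability

variable {V : Type*}

/-- `H` can be obtained from `G` by local complementations and at most `k` edge toggles. -/
inductive CZReach : ℕ → SimpleGraph V → SimpleGraph V → Prop
  | refl (k : ℕ) (G : SimpleGraph V) : CZReach k G G
  | lc {k : ℕ} {G H : SimpleGraph V} (v : V) : CZReach k G H → CZReach k G (localComplement H v)
  | toggle {k : ℕ} {G H : SimpleGraph V} (u v : V) (huv : u ≠ v) : CZReach k G H →
      CZReach (k + 1) G (symmDiff H (SimpleGraph.edge u v))

theorem CZReach.mono {k l : ℕ} {G H : SimpleGraph V} (h : CZReach k G H) (hkl : k ≤ l) :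
    CZReach l G H := by
  induction h generalizing l with
  | refl k G => exact .refl _ _
  | lc v _ ih => exact .lc v (ih hkl)
  | toggle u v huv _ ih =>
    obtain ⟨l, rfl⟩ : ∃ l', l = l' + 1 := ⟨l - 1, by omega⟩
    exact .toggle u v huv (ih (by omega))

theorem CZReach.trans {k l : ℕ} {G H K : SimpleGraph V} (h : CZReach k G H)
    (h' : CZReach l H K) : CZReach (k + l) G K := by
  induction h' with
  | refl l G => exact h.mono (by omega)
  | lc v _ ih => exact .lc v (ih h)
  | toggle u v huv _ ih => exact .toggle u v huv (ih h)

theorem localComplement_adj {G : SimpleGraph V} {v x y : V} :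
    (localComplement G v).Adj x y ↔ x ≠ y ∧ Xor (G.Adj x y) (G.Adj v x ∧ G.Adj v y) :=
  Iff.rfl

theorem localComplement_adj_center {G : SimpleGraph V} {v x : V} :
    (localComplement G v).Adj v x ↔ G.Adj v x := by
  rw [localComplement_adj]
  constructor
  · rintro ⟨_, h | h⟩
    · exact h.1
    · exact absurd h.1.1 (G.loopless.irrefl _)
  · intro h
    exact ⟨h.ne, Or.inl ⟨h, fun h' => G.loopless.irrefl _ h'.1⟩⟩

theorem localComplement_localComplement (G : SimpleGraph V) (v : V) :
    localComplement (localComplement G v) v = G := by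
  ext x y
  rw [localComplement_adj, localComplement_adj_center, localComplement_adj_center,
    localComplement_adj]
  by_cases hxy : x = y
  · subst hxy; simp
  · simp only [ne_eq, hxy, not_false_eq_true, true_and]
    unfold Xor
    tauto

/-- Each move is its own inverse. Words are simplified from `G` towards the edgeless graph, whereas
a circuit has to start from the edgeless graph state. -/
theorem CZReach.symm {k : ℕ} {G H : SimpleGraph V} (h : CZReach k G H) : CZReach k H G := by
  induction h with
  | refl k G => exact .refl _ _
  | @lc k G H v _ ih =>
    have : CZReach 0 (localComplement H v) H := by
      have := CZReach.lc v (.refl 0 (localComplement H v))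
      rwa [localComplement_localComplement] at this
    simpa using this.trans ih
  | @toggle k G H u v huv _ ih =>
    have : CZReach 1 (symmDiff H (SimpleGraph.edge u v)) H := by
      have := CZReach.toggle u v huv (.refl 0 (symmDiff H (SimpleGraph.edge u v)))
      rwa [symmDiff_symmDiff_cancel_right] at this
    exact (this.trans ih).mono (by omega)

theorem CZSequence.lc {k : ℕ} {G H : SimpleGraph V} (h : CZSequence G H k) (v : V) :
    CZSequence G (localComplement H v) k := by
  obtain ⟨A, B, hA, hB, h1, h2⟩ := h
  refine ⟨A, Function.update B k (localComplement H v), hA, by simp, ?_, ?_⟩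
  · intro i hi
    by_cases hik : i = k
    · subst hik
      rw [Function.update_self]
      exact (h1 i le_rfl).tail ⟨v, by rw [hB]⟩
    · rw [Function.update_of_ne hik]
      exact h1 i hi
  · intro i hi
    rw [Function.update_of_ne hi.ne]
    exact h2 i hi

theorem CZReach.exists_czSequence {k : ℕ} {G H : SimpleGraph V} (h : CZReach k G H) :
    ∃ l ≤ k, CZSequence G H l := by
  induction h with
  | refl k G =>
    exact ⟨0, k.zero_le, fun _ => G, fun _ => G, rfl, rfl, fun _ _ => Relation.ReflTransGen.refl,
      by simp⟩
  | lc v _ ih =>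
    obtain ⟨l, hl, h⟩ := ih
    exact ⟨l, hl, h.lc v⟩
  | toggle u v huv _ ih =>
    obtain ⟨l, hl, h⟩ := ih
    exact ⟨l + 1, by omega, h.snoc huv⟩

theorem CZReach.cz_le {k : ℕ} {G : SimpleGraph V} (h : CZReach k G ⊥) : cz G ≤ k := by
  obtain ⟨l, hl, h⟩ := h.exists_czSequence
  exact (Nat.sInf_le h).trans hl

/-- The graph in which the vertex `v` is isolated and all edges avoiding `v` are kept. -/
def isolate (G : SimpleGraph V) (v : V) : SimpleGraph V where
  Adj x y := G.Adj x y ∧ x ≠ v ∧ y ≠ v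
  symm := ⟨fun _ _ h => ⟨h.1.symm, h.2.2, h.2.1⟩⟩
  loopless := ⟨fun _ h => G.loopless.irrefl _ h.1⟩

theorem isolate_adj {G : SimpleGraph V} {v x y : V} :
    (isolate G v).Adj x y ↔ G.Adj x y ∧ x ≠ v ∧ y ≠ v :=
  Iff.rfl

theorem symmDiff_edge_adj {G : SimpleGraph V} {u v x y : V} (huv : u ≠ v) :
    (symmDiff G (SimpleGraph.edge u v)).Adj x y ↔
      Xor (G.Adj x y) ((x = u ∧ y = v) ∨ (x = v ∧ y = u)) := by
  have h : (SimpleGraph.edge u v).Adj x y ↔ (x = u ∧ y = v) ∨ (x = v ∧ y = u) := by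
    rw [SimpleGraph.edge_adj]
    constructor
    · exact fun h => h.1
    · rintro (⟨rfl, rfl⟩ | ⟨rfl, rfl⟩)
      · exact ⟨Or.inl ⟨rfl, rfl⟩, huv⟩
      · exact ⟨Or.inr ⟨rfl, rfl⟩, huv.symm⟩
  rw [← h]
  rfl

/-- Isolating a vertex costs at most one edge toggle per neighbour. -/
theorem czReach_isolate [Fintype V] (G : SimpleGraph V) (v : V) :
    CZReach (Fintype.card V - 1) G (isolate G v) := by
  classical
  have key : ∀ s : Finset V, v ∉ s → ∃ H, CZReach s.card G H ∧
      ∀ x y, H.Adj x y ↔ G.Adj x y ∧ ¬ (x = v ∧ y ∈ s) ∧ ¬ (y = v ∧ x ∈ s) := by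
    intro s
    induction s using Finset.induction_on with
    | empty => exact fun _ => ⟨G, .refl _ _, by simp⟩
    | insert a s ha ih =>
      intro hv
      obtain ⟨H, hH, hadj⟩ := ih fun h => hv (Finset.mem_insert_of_mem h)
      have hva : v ≠ a := fun h => hv (h ▸ Finset.mem_insert_self _ _)
      have hvs : v ∉ s := fun h => hv (Finset.mem_insert_of_mem h)
      rw [Finset.card_insert_of_notMem ha]
      by_cases hG : G.Adj v a
      · refine ⟨_, .toggle v a hva hH, fun x y => ?_⟩
        rw [symmDiff_edge_adj hva, hadj]
        simp only [Finset.mem_insert]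
        by_cases h1 : x = v ∧ y = a
        · obtain ⟨rfl, rfl⟩ := h1
          simp [Xor, hG, ha, hvs, hva]
        by_cases h2 : x = a ∧ y = v
        · obtain ⟨rfl, rfl⟩ := h2
          simp [Xor, hG.symm, ha, hvs, hva.symm]
        have e1 : (x = v ∧ (y = a ∨ y ∈ s)) ↔ (x = v ∧ y ∈ s) := by tauto
        have e2 : (y = v ∧ (x = a ∨ x ∈ s)) ↔ (y = v ∧ x ∈ s) := by tauto
        rw [e1, e2]
        simp [Xor, h1, h2]
      · refine ⟨H, hH.mono (by omega), fun x y => ?_⟩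
        rw [hadj]
        simp only [Finset.mem_insert]
        refine and_congr_right fun hxy => ?_
        have h1 : ¬ (x = v ∧ y = a) := by
          rintro ⟨rfl, rfl⟩; exact hG hxy
        have h2 : ¬ (y = v ∧ x = a) := by
          rintro ⟨rfl, rfl⟩; exact hG hxy.symm
        have e1 : (x = v ∧ (y = a ∨ y ∈ s)) ↔ (x = v ∧ y ∈ s) := by tauto
        have e2 : (y = v ∧ (x = a ∨ x ∈ s)) ↔ (y = v ∧ x ∈ s) := by tauto
        rw [e1, e2]
  obtain ⟨H, hH, hadj⟩ := key (Finset.univ.erase v) (by simp)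
  rw [Finset.card_erase_of_mem (Finset.mem_univ _), Finset.card_univ] at hH
  convert! hH
  ext x y
  rw [isolate_adj, hadj]
  simp only [Finset.mem_erase, Finset.mem_univ, and_true]
  have h1 : G.Adj x y → x ≠ y := fun h => h.ne
  constructor
  · rintro ⟨h, hx, hy⟩; tauto
  · rintro ⟨h, h2, h3⟩
    refine ⟨h, fun hx => h2 ⟨hx, fun hy => h1 h (hx.trans hy.symm)⟩,
      fun hy => h3 ⟨hy, fun hx => h1 h (hx.trans hy.symm)⟩⟩

theorem localComplement_isolate {G : SimpleGraph V} {b c : V} (hbc : c ≠ b) :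
    localComplement (isolate G b) c = isolate (localComplement G c) b := by
  ext x y
  simp only [localComplement_adj, isolate_adj]
  by_cases hx : x = b
  · subst hx; simp [Xor]
  by_cases hy : y = b
  · subst hy; simp [Xor]
  simp [hx, hy, hbc]

/-- Complementing at `a` removes every edge from its adjacent twin `b` except `ab`. Once `ab` is
toggled away, a second complementation at `a` restores the rest of the graph. -/
theorem localComplement_isolate_self {G : SimpleGraph V} {a b : V} (hab : a ≠ b)
    (h : ∀ c, c ≠ a → c ≠ b → (G.Adj a c ↔ G.Adj b c)) (hadj : G.Adj a b) :
    CZReach 1 G (isolate G b) := by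
  have key : symmDiff (localComplement G a) (SimpleGraph.edge a b) =
      localComplement (isolate G b) a := by
    ext x y
    rw [symmDiff_edge_adj hab, localComplement_isolate hab, isolate_adj, localComplement_adj]
    by_cases hxy : x = y
    · subst hxy
      have : ¬ ((x = a ∧ x = b) ∨ (x = b ∧ x = a)) := by
        rintro (⟨rfl, h'⟩ | ⟨rfl, h'⟩)
        · exact hab h'
        · exact hab h'.symm
      simp [Xor, this]
    by_cases hx : x = b
    · subst hx
      by_cases hy : y = a
      · subst hy
        simp [Xor, hadj, hadj.symm, hab, hab.symm]
      · have := h y hy (Ne.symm hxy)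
        simp [Xor, hy, this, hxy, hab.symm, hadj]
    by_cases hy : y = b
    · subst hy
      by_cases hx' : x = a
      · subst hx'
        simp [Xor, hadj, hab]
      · have := h x hx' hxy
        simp [Xor, hx', this, hxy, hab.symm, hadj, G.adj_comm x y]
    simp [Xor, hx, hy]
  have h1 := CZReach.lc a (.toggle a b hab (.lc a (.refl 0 G)))
  rwa [key, localComplement_localComplement] at h1

/-- One of two twin vertices can be isolated with a single edge toggle. -/
theorem czReach_isolate_of_twins {G : SimpleGraph V} {a b : V} (hab : a ≠ b)
    (h : ∀ c, c ≠ a → c ≠ b → (G.Adj a c ↔ G.Adj b c)) : CZReach 1 G (isolate G b) := by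
  by_cases hadj : G.Adj a b
  · exact localComplement_isolate_self hab h hadj
  by_cases hc : ∃ c, G.Adj b c
  · obtain ⟨c, hc⟩ := hc
    have hcb : c ≠ b := hc.ne'
    have hca : c ≠ a := fun h => hadj (h ▸ hc).symm
    have hac := (h c hca hcb).2 hc
    -- Non-adjacent twins become adjacent twins after complementing at a common neighbour `c`, and
    -- that complementation commutes with isolating `b`.
    have h1 : CZReach 1 (localComplement G c) (isolate (localComplement G c) b) := by
      refine localComplement_isolate_self hab ?_ ?_
      · intro d hda hdb
        have := h d hda hdb
        rw [localComplement_adj, localComplement_adj]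
        simp only [this, hc.symm, hac.symm, hda.symm, hdb.symm, ne_eq, not_false_eq_true, true_and]
      · rw [localComplement_adj]
        exact ⟨hab, Or.inr ⟨⟨hac.symm, hc.symm⟩, hadj⟩⟩
    rw [← localComplement_isolate hcb] at h1
    have h2 := (CZReach.lc c (.refl 0 G)).trans h1
    have h3 := CZReach.lc c h2
    rw [localComplement_localComplement] at h3
    exact h3.mono (by omega)
  · have : isolate G b = G := by
      ext x y
      rw [isolate_adj]
      constructor
      · exact fun h => h.1
      · refine fun hxy => ⟨hxy, ?_, ?_⟩
        · rintro rfl; exact hc ⟨_, hxy⟩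
        · rintro rfl; exact hc ⟨_, hxy.symm⟩
    rw [this]
    exact .refl _ _

end Reachability

/-! ### Realising the graph moves by gates on graph states -/

section Circuits

variable {V : Type*}

theorem run_append (C D : List (Gate V)) (ψ : State V) : run (C ++ D) ψ = run D (run C ψ) := by
  simp [run, List.foldl_append]

theorem run_cons (g : Gate V) (C : List (Gate V)) (ψ : State V) :
    run (g :: C) ψ = run C (g.apply ψ) := rfl

theorem run_nil (ψ : State V) : run [] ψ = ψ := rfl

theorem czCount_append (C D : List (Gate V)) : czCount (C ++ D) = czCount C + czCount D := by
  induction C with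
  | nil => simp [czCount]
  | cons g C ih =>
    cases g <;> simp only [List.cons_append, czCount, ih]
    omega

open Classical in
/-- The sign that a CZ gate on the pair `e` contributes at the basis vector `x`. -/
noncomputable def pairSign (x : V → Bool) (e : Sym2 V) : ℂ :=
  if ∀ v ∈ e, x v = true then -1 else 1

theorem pairSign_mk (x : V → Bool) (u v : V) :
    pairSign x s(u, v) = if x u = true ∧ x v = true then -1 else 1 := by
  simp [pairSign]

theorem pairSign_mul_self (x : V → Bool) (e : Sym2 V) : pairSign x e * pairSign x e = 1 := by
  unfold pairSign
  split_ifs <;> simp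

open Classical in
theorem graphState_apply [Fintype V] (G : SimpleGraph V) (x : V → Bool) :
    graphState G x = (∏ e : Sym2 V, if e ∈ G.edgeSet then pairSign x e else 1) *
      (1 / (√2 : ℝ) : ℂ) ^ Fintype.card V := by
  unfold graphState
  congr 1
  refine Eq.trans ?_ (Finset.prod_filter (fun e => e ∈ G.edgeSet) (pairSign x))
  refine Finset.prod_congr ?_ fun e _ => by unfold pairSign; congr
  ext e
  simp [SimpleGraph.mem_edgeFinset]

open Classical in
theorem graphState_symmDiff_edge [Fintype V] (G : SimpleGraph V) {u v : V} (huv : u ≠ v) :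
    graphState (symmDiff G (SimpleGraph.edge u v)) = (Gate.CZ u v huv).apply (graphState G) := by
  funext x
  simp only [Gate.apply]
  rw [graphState_apply, graphState_apply, ← mul_assoc]
  congr 1
  have h1 : (∏ e : Sym2 V, if e = s(u, v) then pairSign x e else 1) =
      if x u = true ∧ x v = true then -1 else 1 := by
    rw [Finset.prod_ite_eq' Finset.univ s(u, v)]
    simp [pairSign_mk]
  rw [← h1, ← Finset.prod_mul_distrib]
  refine Finset.prod_congr rfl fun e _ => ?_
  have h2 : e ∈ (symmDiff G (SimpleGraph.edge u v)).edgeSet ↔ Xor (e ∈ G.edgeSet) (e = s(u, v)) := by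
    induction e using Sym2.inductionOn with
    | hf a b =>
      rw [SimpleGraph.mem_edgeSet, symmDiff_edge_adj huv, SimpleGraph.mem_edgeSet, Sym2.eq_iff]
  rw [if_congr h2 rfl rfl]
  by_cases ha : e ∈ G.edgeSet <;> by_cases hb : e = s(u, v) <;>
    simp [Xor, ha, hb, pairSign_mul_self]

open Classical in
theorem graphState_update_true [Fintype V] (G : SimpleGraph V) (v : V) (x : V → Bool) :
    graphState G (Function.update x v true) = graphState G (Function.update x v false) *
      (-1) ^ (Finset.univ.filter fun u => G.Adj v u ∧ x u = true).card := by
  rw [graphState_apply, graphState_apply, mul_right_comm]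
  congr 1
  set D := Finset.univ.filter fun u => G.Adj v u ∧ x u = true with hD
  have hinj : Set.InjOn (fun u => s(v, u)) (D : Set V) := by
    intro a _ b _ hab
    rcases Sym2.eq_iff.1 hab with ⟨-, h⟩ | ⟨h1, h2⟩
    · exact h
    · exact h2.trans h1
  have h1 : (∏ e : Sym2 V, if e ∈ D.image (fun u => s(v, u)) then (-1 : ℂ) else 1) =
      (-1) ^ D.card := by
    rw [← Finset.card_image_of_injOn hinj, Finset.prod_ite_mem, Finset.univ_inter,
      Finset.prod_const]
  rw [← h1, ← Finset.prod_mul_distrib]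
  refine Finset.prod_congr rfl fun e _ => ?_
  induction e using Sym2.inductionOn with
  | hf a b =>
    have hmem : s(a, b) ∈ D.image (fun u => s(v, u)) ↔
        (a = v ∧ G.Adj v b ∧ x b = true) ∨ (b = v ∧ G.Adj v a ∧ x a = true) := by
      simp only [Finset.mem_image, hD, Finset.mem_filter, Finset.mem_univ, true_and, Sym2.eq_iff]
      constructor
      · rintro ⟨u, ⟨h1, h2⟩, ⟨rfl, rfl⟩ | ⟨rfl, rfl⟩⟩
        · exact Or.inl ⟨rfl, h1, h2⟩
        · exact Or.inr ⟨rfl, h1, h2⟩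
      · rintro (⟨rfl, h1, h2⟩ | ⟨rfl, h1, h2⟩)
        · exact ⟨b, ⟨h1, h2⟩, Or.inl ⟨rfl, rfl⟩⟩
        · exact ⟨a, ⟨h1, h2⟩, Or.inr ⟨rfl, rfl⟩⟩
    simp only [hmem, SimpleGraph.mem_edgeSet, pairSign_mk]
    by_cases hab : G.Adj a b
    · have hne := hab.ne
      by_cases ha : a = v
      · subst ha
        simp [hab, hne.symm]
      · by_cases hb : b = v
        · subst hb
          simp [hab.symm, hab, hne]
        · simp [ha, hb]
    · have : ¬ ((a = v ∧ G.Adj v b ∧ x b = true) ∨ (b = v ∧ G.Adj v a ∧ x a = true)) := by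
        rintro (⟨rfl, h, -⟩ | ⟨rfl, h, -⟩)
        · exact hab h
        · exact hab h.symm
      simp [hab, this]

open Classical in
-- The sign changes once for each pair of neighbours of `v` that are both 1 in `x`.
theorem graphState_localComplement [Fintype V] (G : SimpleGraph V) (v : V) (x : V → Bool) :
    graphState (localComplement G v) x = graphState G x *
      (-1) ^ ((Finset.univ.filter fun u => G.Adj v u ∧ x u = true).card.choose 2) := by
  rw [graphState_apply, graphState_apply, mul_right_comm]
  congr 1
  set D := Finset.univ.filter fun u => G.Adj v u ∧ x u = true with hD
  have h1 : (∏ e : Sym2 V, if e ∈ D.offDiag.image (fun p => s(p.1, p.2)) then (-1 : ℂ) else 1) =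
      (-1) ^ (D.card.choose 2) := by
    rw [← Sym2.card_image_offDiag, Finset.prod_ite_mem, Finset.univ_inter, Finset.prod_const]
    rfl
  rw [← h1, ← Finset.prod_mul_distrib]
  refine Finset.prod_congr rfl fun e _ => ?_
  induction e using Sym2.inductionOn with
  | hf a b =>
    have hmem : s(a, b) ∈ D.offDiag.image (fun p => s(p.1, p.2)) ↔
        a ≠ b ∧ (G.Adj v a ∧ G.Adj v b) ∧ x a = true ∧ x b = true := by
      simp only [Finset.mem_image, Finset.mem_offDiag, hD, Finset.mem_filter, Finset.mem_univ,
        true_and, Sym2.eq_iff, Prod.exists]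
      constructor
      · rintro ⟨p, q, ⟨h1, h2, h3⟩, ⟨rfl, rfl⟩ | ⟨rfl, rfl⟩⟩
        · exact ⟨h3, ⟨h1.1, h2.1⟩, h1.2, h2.2⟩
        · exact ⟨h3.symm, ⟨h2.1, h1.1⟩, h2.2, h1.2⟩
      · rintro ⟨h1, h2, h3, h4⟩
        exact ⟨a, b, ⟨⟨h2.1, h3⟩, ⟨h2.2, h4⟩, h1⟩, Or.inl ⟨rfl, rfl⟩⟩
    simp only [hmem, SimpleGraph.mem_edgeSet, localComplement_adj, pairSign_mk]
    by_cases hne : a = b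
    · subst hne
      simp
    · by_cases hab : G.Adj a b <;> by_cases hv : G.Adj v a ∧ G.Adj v b <;>
        by_cases hx : x a = true ∧ x b = true <;> simp [Xor, hne, hab, hv, hx]

open Classical in
theorem run_phases (l : List V) (ψ : State V) (x : V → Bool) :
    run (l.flatMap fun u => [Gate.S u, Gate.S u, Gate.S u]) ψ x =
      (-Complex.I) ^ (l.countP fun u => x u) * ψ x := by
  induction l generalizing ψ with
  | nil => simp [run]
  | cons u l ih =>
    rw [List.flatMap_cons, run_append, ih, run_cons, run_cons, run_cons, run_nil, List.countP_cons]
    by_cases hx : x u = true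
    · simp only [Gate.apply, hx, if_true, pow_add, pow_one]
      linear_combination ((-Complex.I) ^ (l.countP fun u => x u) * Complex.I * ψ x) *
        Complex.I_sq
    · simp [Gate.apply, hx]

/-- Here `d` is the number of neighbours in state 1. The identity says that the local gates at `v`
and at its neighbours together give exactly the sign of a local complementation, with no global
phase left over. -/
theorem phase_identity (d : ℕ) (s : ℂ) (hs : s = (-1) ^ d) :
    (-Complex.I) ^ d * ((1 + Complex.I) + (1 - Complex.I) * s) = 2 * (-1) ^ (d.choose 2) := by
  induction d generalizing s with
  | zero => subst hs; simp; ring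
  | succ d ih =>
    have h := ih _ rfl
    have hs' : s = -(-1) ^ d := by rw [hs, pow_succ]; ring
    have hc : (d + 1).choose 2 = d + d.choose 2 := by
      rw [Nat.choose_succ_succ', Nat.choose_one_right]
    rw [hs', hc, pow_add (-1 : ℂ), pow_succ (-Complex.I)]
    rcases neg_one_pow_eq_or ℂ d with h1 | h1
    · rw [h1] at h ⊢
      linear_combination h - 2 * (-Complex.I) ^ d * Complex.I_sq
    · rw [h1] at h ⊢
      linear_combination -h

/-- The circuit of local gates that implements the local complementation at `v`. -/
noncomputable def complementCircuit [Fintype V] (G : SimpleGraph V) (v : V) : List (Gate V) :=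
  open Classical in
  [Gate.H v, Gate.S v, Gate.H v] ++
    (Finset.univ.filter fun u => G.Adj v u).toList.flatMap fun u => [Gate.S u, Gate.S u, Gate.S u]

theorem czCount_complementCircuit [Fintype V] (G : SimpleGraph V) (v : V) :
    czCount (complementCircuit G v) = 0 := by
  have h : ∀ l : List V, czCount (l.flatMap fun u => [Gate.S u, Gate.S u, Gate.S u]) = 0 := by
    intro l
    induction l with
    | nil => rfl
    | cons u l ih => rw [List.flatMap_cons, czCount_append, ih]; rfl
  unfold complementCircuit
  rw [czCount_append, h]
  rfl

open Classical in
-- The product HSH equals `((1 + i) I + (1 - i) X) / 2`, and the hypotheses say that flipping the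
-- bit at `v` multiplies the amplitude by the sign `s`.
theorem run_hadamard_phase_hadamard (v : V) (ψ : State V) (x : V → Bool) (s : ℂ)
    (hs : s * s = 1)
    (h : ψ (Function.update x v true) = ψ (Function.update x v false) * s) :
    run [Gate.H v, Gate.S v, Gate.H v] ψ x =
      1 / 2 * ((1 + Complex.I) + (1 - Complex.I) * s) * ψ x := by
  have hc : (1 / (√2 : ℝ) : ℂ) * (1 / (√2 : ℝ) : ℂ) = 1 / 2 := by
    rw [div_mul_div_comm, ← Complex.ofReal_mul, Real.mul_self_sqrt (by norm_num)]
    norm_num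
  rw [run_cons, run_cons, run_cons, run_nil]
  simp only [Gate.apply, Function.update_self, Function.update_idem, if_true, Bool.false_eq_true,
    if_false, h]
  cases hx : x v with
  | false =>
    have : Function.update x v false = x := by rw [← hx, Function.update_eq_self]
    rw [this]
    simp only [Bool.false_eq_true, if_false]
    linear_combination ((1 + Complex.I) + (1 - Complex.I) * s) * ψ x * hc
  | true =>
    have h2 : ψ (Function.update x v false) = ψ x * s := by
      have : Function.update x v true = x := by rw [← hx, Function.update_eq_self]
      rw [this] at h
      rw [h, mul_assoc, hs, mul_one]
    rw [h2]
    simp only [if_true]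
    linear_combination ((1 - Complex.I) * s + (1 + Complex.I) * (s * s)) * ψ x * hc +
      1 / 2 * (1 + Complex.I) * ψ x * hs

theorem run_complementCircuit [Fintype V] (G : SimpleGraph V) (v : V) :
    run (complementCircuit G v) (graphState G) = graphState (localComplement G v) := by
  classical
  funext x
  have hcount : (Finset.univ.filter fun u => G.Adj v u).toList.countP (fun u => x u) =
      (Finset.univ.filter fun u => G.Adj v u ∧ x u = true).card := by
    have h := (Finset.nodup_toList (Finset.univ.filter fun u => G.Adj v u)).card_eq_countP
      (P := fun u => x u = true)
    rw [Finset.toList_toFinset, Finset.filter_filter] at h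
    rw [h]
    simp
  unfold complementCircuit
  rw [run_append, run_phases, graphState_localComplement,
    run_hadamard_phase_hadamard v _ x _ ?_ (graphState_update_true G v x)]
  · have h := phase_identity (Finset.univ.filter fun u => G.Adj v u ∧ x u = true).card _ rfl
    rw [show (Finset.univ.filter fun u => G.Adj v u).toList.countP (fun u => x u) =
      (Finset.univ.filter fun u => G.Adj v u ∧ x u = true).card by convert! hcount]
    linear_combination 1 / 2 * graphState G x * h
  · rw [← mul_pow]
    norm_num

theorem CZReach.exists_circuit [Fintype V] {k : ℕ} {G H : SimpleGraph V} (h : CZReach k G H) :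
    ∃ C : List (Gate V), czCount C ≤ k ∧ run C (graphState G) = graphState H := by
  induction h with
  | refl k G => exact ⟨[], by simp [czCount], rfl⟩
  | @lc k G H v _ ih =>
    obtain ⟨C, hC, hr⟩ := ih
    refine ⟨C ++ complementCircuit H v, ?_, ?_⟩
    · rw [czCount_append, czCount_complementCircuit]
      exact hC
    · rw [run_append, hr, run_complementCircuit]
  | @toggle k G H u v huv _ ih =>
    obtain ⟨C, hC, hr⟩ := ih
    refine ⟨C ++ [Gate.CZ u v huv], ?_, ?_⟩
    · rw [czCount_append]
      simpa [czCount] using hC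
    · rw [run_append, hr, graphState_symmDiff_edge H huv]
      rfl

theorem CZReach.stateCZ_le [Fintype V] {k : ℕ} {G : SimpleGraph V} (h : CZReach k G ⊥) :
    stateCZ G ≤ k := by
  classical
  obtain ⟨C, hC, hr⟩ := h.symm.exists_circuit
  refine le_trans (Nat.sInf_le (s := {k | ∃ C : List (Gate V), Prepares C G ∧ czCount C = k})
    ⟨(Finset.univ : Finset V).toList.map Gate.H ++ C, ⟨1, by simp, ?_⟩, rfl⟩) ?_
  · have h0 : run ((Finset.univ : Finset V).toList.map Gate.H) (zeroState V) =
        graphState (⊥ : SimpleGraph V) := by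
      rw [run_hadamards _ (Finset.nodup_toList _)]
      funext x
      rw [graphState_apply]
      simp
    rw [run_append, h0, hr, one_smul]
  · rw [czCount_append]
    have : ∀ l : List V, czCount (l.map Gate.H) = 0 := by
      intro l
      induction l with
      | nil => rfl
      | cons a l ih => simpa [czCount] using ih
    rw [this]
    omega

end Circuits

/-! ### Chords of a convex polygon with few pairwise crossings -/

section ConvexGeometric

/-- The pairs `e` and `f`, seen as chords of a convex polygon with vertices `0, 1, …`, cross. -/
def PairCross (e f : ℕ × ℕ) : Prop :=
  (e.1 < f.1 ∧ f.1 < e.2 ∧ e.2 < f.2) ∨ (f.1 < e.1 ∧ e.1 < f.2 ∧ f.2 < e.2)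

/-- `E` is a set of chords of the convex polygon with vertices `0, …, m - 1` such that at most `k`
of its elements cross pairwise. -/
structure CrossBounded (k m : ℕ) (E : Finset (ℕ × ℕ)) : Prop where
  lt : ∀ e ∈ E, e.1 < e.2 ∧ e.2 < m
  card_le : ∀ T ⊆ E, (T : Set (ℕ × ℕ)).Pairwise PairCross → T.card ≤ k

theorem PairCross.symm {e f : ℕ × ℕ} (h : PairCross e f) : PairCross f e := by
  unfold PairCross at *; omega

theorem PairCross.ne {e f : ℕ × ℕ} (h : PairCross e f) : e ≠ f := by
  rintro rfl
  unfold PairCross at h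
  omega

/-- Pairwise crossing chords share no endpoint, so choosing for each an endpoint in the open
interval is injective. -/
theorem card_le_of_endpoint_mem {T : Finset (ℕ × ℕ)} {a b : ℕ}
    (hT : (T : Set (ℕ × ℕ)).Pairwise PairCross)
    (h : ∀ e ∈ T, (a < e.1 ∧ e.1 < b) ∨ (a < e.2 ∧ e.2 < b)) : T.card ≤ b - a - 1 := by
  rw [← Nat.card_Ioo]
  refine Finset.card_le_card_of_injOn (fun e => if a < e.1 ∧ e.1 < b then e.1 else e.2) ?_ ?_
  · intro e he
    have := h e he
    simp only [Finset.coe_Ioo, Set.mem_Ioo]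
    split_ifs <;> omega
  · intro e he f hf hef
    by_contra hne
    have := hT he hf hne
    unfold PairCross at this
    simp only at hef
    split_ifs at hef <;> omega

theorem card_le_of_mem_short {T : Finset (ℕ × ℕ)} {g : ℕ × ℕ} (hg : g ∈ T)
    (hlt : g.1 < g.2) (hT : (T : Set (ℕ × ℕ)).Pairwise PairCross) : T.card ≤ g.2 - g.1 := by
  have h := card_le_of_endpoint_mem (T := T.erase g) (a := g.1) (b := g.2)
    (hT.mono (by simp)) (by
      intro e he
      rw [Finset.mem_erase] at he
      have := hT he.2 hg he.1
      unfold PairCross at this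
      omega)
  rw [Finset.card_erase_of_mem hg] at h
  omega

section Collapse

variable (E : Finset (ℕ × ℕ)) (k m : ℕ)

open Classical in
/-- Greedy increasing columns: `greedyColumn t` is the least neighbour of row `t` beyond
`greedyColumn (t - 1)`, or `m` if there is none. -/
noncomputable def greedyColumn : ℕ → ℕ
  | 0 => k + 1
  | t + 1 => if h : ∃ w, greedyColumn t < w ∧ (t + 1, w) ∈ E then Nat.find h else m

open Classical in
/-- The image of a chord under the removal of one of the rows `1, …, k`. -/
noncomputable def collapseEdge (e : ℕ × ℕ) : ℕ × ℕ :=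
  if e.1 = 0 then (0, e.2 - 1)
  else if e.1 ≤ k ∧ greedyColumn E k m (e.1 - 1) < e.2 then (e.1, e.2 - 1)
  else (e.1 - 1, e.2 - 1)

variable {E k m}

theorem greedyColumn_mem {t : ℕ} (h : greedyColumn E k m (t + 1) < m) :
    (t + 1, greedyColumn E k m (t + 1)) ∈ E ∧
      greedyColumn E k m t < greedyColumn E k m (t + 1) := by
  classical
  rw [greedyColumn] at h ⊢
  split_ifs at h ⊢ with h'
  · exact ⟨(Nat.find_spec h').2, (Nat.find_spec h').1⟩
  · omega

theorem greedyColumn_le {t w : ℕ} (h : greedyColumn E k m t < w) (hw : (t + 1, w) ∈ E) :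
    greedyColumn E k m (t + 1) ≤ w := by
  classical
  rw [greedyColumn, dif_pos ⟨w, h, hw⟩]
  exact Nat.find_min' _ ⟨h, hw⟩

theorem greedyColumn_lt {s t : ℕ} (hst : s < t) (ht : greedyColumn E k m t < m) :
    greedyColumn E k m s < greedyColumn E k m t := by
  induction t with
  | zero => omega
  | succ t ih =>
    have h := (greedyColumn_mem ht).2
    rcases Nat.lt_succ_iff_lt_or_eq.1 hst with h' | rfl
    · exact (ih h' (h.trans ht)).trans h
    · exact h

theorem CrossBounded.greedyColumn_le_top (hE : CrossBounded k m E) (hm : k + 1 ≤ m) (t : ℕ) :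
    greedyColumn E k m t ≤ m := by
  classical
  cases t with
  | zero => exact hm
  | succ t =>
    rw [greedyColumn]
    split_ifs with h
    · exact ((hE.lt _ (Nat.find_spec h).2).2).le
    · rfl

theorem CrossBounded.greedyColumn_mono (hE : CrossBounded k m E) (hm : k + 1 ≤ m) {s t : ℕ}
    (hst : s ≤ t) : greedyColumn E k m s ≤ greedyColumn E k m t := by
  by_cases h : greedyColumn E k m t < m
  · rcases hst.lt_or_eq with h' | rfl
    · exact (greedyColumn_lt h' h).le
    · rfl
  · exact (hE.greedyColumn_le_top hm s).trans (not_lt.1 h)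

/-- Otherwise the ear and the greedy chords of rows `1, …, k` would be `k + 1` pairwise crossing
chords: rows and columns both increase, and every column exceeds every row. -/
theorem CrossBounded.greedyColumn_last (hE : CrossBounded k m E) (hear : (0, k + 1) ∈ E) :
    m ≤ greedyColumn E k m k := by
  by_contra hlt
  rw [not_le] at hlt
  have hlt' : ∀ t ≤ k, greedyColumn E k m t < m := by
    intro t ht
    rcases ht.lt_or_eq with h' | rfl
    · exact (greedyColumn_lt h' hlt).trans hlt
    · exact hlt
  set f : ℕ → ℕ × ℕ := fun t => (t, greedyColumn E k m t) with hf
  have h0 : ∀ t ≤ k, k + 1 ≤ greedyColumn E k m t := by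
    intro t ht
    rcases Nat.eq_zero_or_pos t with rfl | h
    · exact le_rfl
    · exact (greedyColumn_lt h (hlt' t ht)).le
  have hcard : ((Finset.range (k + 1)).image f).card = k + 1 := by
    rw [Finset.card_image_of_injective _ fun a b h => (Prod.ext_iff.1 h).1, Finset.card_range]
  have := hE.card_le ((Finset.range (k + 1)).image f) ?_ ?_
  · omega
  · intro e he
    obtain ⟨t, ht, rfl⟩ := Finset.mem_image.1 he
    rw [Finset.mem_range] at ht
    cases t with
    | zero => exact hear
    | succ t => exact (greedyColumn_mem (hlt' _ (by omega))).1
  · intro e he e' he' hne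
    obtain ⟨s, hs, rfl⟩ := Finset.mem_image.1 he
    obtain ⟨t, ht, rfl⟩ := Finset.mem_image.1 he'
    rw [Finset.mem_range] at hs ht
    have hst : s ≠ t := fun h => hne (h ▸ rfl)
    have h1 := h0 s (by omega)
    have h2 := h0 t (by omega)
    rcases hst.lt_or_gt with h | h
    · exact Or.inl ⟨h, by simp only [hf]; omega, greedyColumn_lt h (hlt' t (by omega))⟩
    · exact Or.inr ⟨h, by simp only [hf]; omega, greedyColumn_lt h (hlt' s (by omega))⟩

open Classical in
/-- The chords after one of the rows `1, …, k` has been removed: all chords among the first `k + 1`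
vertices, and the images of the chords that leave the first `k + 2` vertices. -/
noncomputable def collapse (E : Finset (ℕ × ℕ)) (k m : ℕ) : Finset (ℕ × ℕ) :=
  ((Finset.range (k + 1) ×ˢ Finset.range (k + 1)).filter fun e => e.1 < e.2) ∪
    (E.filter fun e => k + 1 < e.2).image (collapseEdge E k m)

theorem collapseEdge_cases (e : ℕ × ℕ) :
    (e.1 = 0 ∧ collapseEdge E k m e = (0, e.2 - 1)) ∨
    (1 ≤ e.1 ∧ e.1 ≤ k ∧ greedyColumn E k m (e.1 - 1) < e.2 ∧
      collapseEdge E k m e = (e.1, e.2 - 1)) ∨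
    (1 ≤ e.1 ∧ (e.1 ≤ k → e.2 ≤ greedyColumn E k m (e.1 - 1)) ∧
      collapseEdge E k m e = (e.1 - 1, e.2 - 1)) := by
  unfold collapseEdge
  by_cases h0 : e.1 = 0
  · simp [h0]
  by_cases h1 : e.1 ≤ k ∧ greedyColumn E k m (e.1 - 1) < e.2
  · rw [if_neg h0, if_pos h1]
    exact Or.inr (Or.inl ⟨by omega, h1.1, h1.2, rfl⟩)
  · rw [if_neg h0, if_neg h1]
    exact Or.inr (Or.inr ⟨by omega, by omega, rfl⟩)

/-- Row `k` has no chord past the staircase, so the collapse sends all its outer chords to row `k -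
1`. This frees row `k` for the chords of row `k + 1`. -/
theorem CrossBounded.le_greedyColumn (hE : CrossBounded k m E) (hk : 1 ≤ k)
    (hear : (0, k + 1) ∈ E) {w : ℕ} (hw : (k, w) ∈ E) : w ≤ greedyColumn E k m (k - 1) := by
  by_contra hlt
  obtain ⟨c, rfl⟩ : ∃ c', k = c' + 1 := ⟨k - 1, by omega⟩
  have h1 := greedyColumn_le (not_le.1 hlt) hw
  have h2 := (hE.lt _ hw).2
  have h3 := hE.greedyColumn_last hear
  simp only [Nat.add_sub_cancel] at h1 h2
  omega

theorem collapseEdge_snd (e : ℕ × ℕ) : (collapseEdge E k m e).2 = e.2 - 1 := by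
  unfold collapseEdge
  split_ifs <;> rfl

/-- Among the first vertices the loss is at most `(k + 2).choose 2 - (k + 1).choose 2 = k + 1`.
Outside, rows `t` and `t + 1` are glued along the staircase and can collide only in column
`greedyColumn t`, for `1 ≤ t ≤ k - 1`. The sum is `2 * k`. -/
theorem CrossBounded.card_le_collapse (hE : CrossBounded k m E) (hk : 1 ≤ k)
    (hear : (0, k + 1) ∈ E) : E.card ≤ (collapse E k m).card + 2 * k := by
  classical
  have hin : (E.filter fun e => ¬ k + 1 < e.2).card ≤ (k + 2).choose 2 := by
    have hch := Finset.card_product_filter_lt (s := Finset.range (k + 2))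
    rw [Finset.card_range] at hch
    rw [← hch]
    refine Finset.card_le_card fun e he => ?_
    simp only [Finset.mem_filter, Finset.mem_product, Finset.mem_range] at he ⊢
    have := hE.lt e he.1
    omega
  have hsplit := Finset.card_filter_add_card_filter_not (s := E) fun e => k + 1 < e.2
  set Eo := E.filter fun e => k + 1 < e.2 with hEo
  -- These are the only outer chords whose image may coincide with that of a chord one row lower.
  set R := (Finset.Icc 1 (k - 1)).image fun h => (h + 1, greedyColumn E k m h) with hR
  have hRcard : R.card ≤ k - 1 := Finset.card_image_le.trans (by simp)
  have hinj : Set.InjOn (collapseEdge E k m) ((Eo \ R : Finset (ℕ × ℕ)) : Set (ℕ × ℕ)) := by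
    have key : ∀ e ∈ Eo, ∀ f ∈ Eo \ R, e.1 < f.1 →
        collapseEdge E k m e ≠ collapseEdge E k m f := by
      rintro ⟨a, b⟩ hab ⟨c, d⟩ hcd hac h
      rw [Finset.mem_sdiff] at hcd
      obtain ⟨hcd, hR'⟩ := hcd
      rw [hEo, Finset.mem_filter] at hab hcd
      have h1 := collapseEdge_cases (E := E) (k := k) (m := m) (a, b)
      have h2 := collapseEdge_cases (E := E) (k := k) (m := m) (c, d)
      simp only at hab hcd h1 h2 hac
      have hkc : a = k → b ≤ greedyColumn E k m (a - 1) := by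
        rintro rfl
        exact hE.le_greedyColumn hk hear hab.1
      have hbd : b = d := by
        have := congrArg Prod.snd h
        simp only [collapseEdge_snd] at this
        omega
      subst hbd
      have hac' : c = a + 1 ∧ 1 ≤ a ∧ a < k ∧ greedyColumn E k m (a - 1) < b ∧
          b ≤ greedyColumn E k m a := by
        have hfst := congrArg Prod.fst h
        rcases h2 with ⟨h2, -⟩ | ⟨h2, h3, h4, h2'⟩ | ⟨h2, h2', h2''⟩
        · omega
        · rw [h2'] at hfst
          rcases h1 with ⟨h1, h1'⟩ | ⟨h1, -, -, h1'⟩ | ⟨h1, -, h1'⟩ <;> rw [h1'] at hfst <;>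
            simp only at hfst <;> omega
        · rw [h2''] at hfst
          rcases h1 with ⟨h1, h1'⟩ | ⟨h1, h3, h4, h1'⟩ | ⟨h1, h3, h1'⟩ <;>
            rw [h1'] at hfst <;> simp only at hfst
          · have h0 : greedyColumn E k m 0 = k + 1 := rfl
            obtain rfl : c = 1 := by omega
            simp only [Nat.sub_self, h0] at h2'
            omega
          · obtain rfl : c = a + 1 := by omega
            simp only [Nat.add_sub_cancel] at h2'
            by_cases hak : a = k
            · omega
            · exact ⟨rfl, h1, by omega, h4, h2' (by omega)⟩
          · omega
      obtain ⟨rfl, ha1, hak, hlow, hhigh⟩ := hac'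
      obtain ⟨a, rfl⟩ : ∃ a', a = a' + 1 := ⟨a - 1, by omega⟩
      have := greedyColumn_le hlow hab.1
      simp only [Nat.add_sub_cancel] at hhigh this
      exact hR' (Finset.mem_image.2 ⟨a + 1, by simp; omega, by
        rw [Prod.mk.injEq]; exact ⟨rfl, by omega⟩⟩)
    intro e he f hf hef
    rcases lt_trichotomy e.1 f.1 with h | h | h
    · exact absurd hef (key e (Finset.mem_sdiff.1 he).1 f hf h)
    · have h2 : e.2 = f.2 := by
        have hb := (Finset.mem_filter.1 (Finset.mem_sdiff.1 he).1).2
        have hd := (Finset.mem_filter.1 (Finset.mem_sdiff.1 hf).1).2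
        have := congrArg Prod.snd hef
        simp only [collapseEdge_snd] at this
        omega
      exact Prod.ext h h2
    · exact absurd hef.symm (key f (Finset.mem_sdiff.1 hf).1 e he h)
  have hcard : Eo.card ≤ (Eo.image (collapseEdge E k m)).card + (k - 1) := by
    have h1 := Finset.card_image_of_injOn hinj
    have h2 := Finset.card_le_card
      (Finset.image_subset_image (f := collapseEdge E k m) (Finset.sdiff_subset (s := Eo) (t := R)))
    have h3 := Finset.le_card_sdiff R Eo
    omega
  have hunion : (collapse E k m).card = (k + 1).choose 2 + (Eo.image (collapseEdge E k m)).card := by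
    unfold collapse
    rw [Finset.card_union_of_disjoint, Finset.card_product_filter_lt, Finset.card_range]
    rw [Finset.disjoint_left]
    intro e he he'
    obtain ⟨f, hf, rfl⟩ := Finset.mem_image.1 he'
    have hd := (Finset.mem_filter.1 hf).2
    rw [Finset.mem_filter, Finset.mem_product, Finset.mem_range, Finset.mem_range] at he
    rcases collapseEdge_cases (E := E) (k := k) (m := m) f with h1 | h1 | h1 <;>
      simp only [h1] at he <;> omega
  have hch : (k + 2).choose 2 = (k + 1).choose 2 + (k + 1) := by
    rw [Nat.choose_succ_succ' (k + 1) 1, Nat.choose_one_right, add_comm]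
  omega

/-- A crossing family of more than `k` collapsed chords would lift to an equally large one in `E`.
The lift cannot merely pick preimages: where needed, it substitutes chords of the greedy staircase.
-/
theorem CrossBounded.collapse (hE : CrossBounded k m E) (hk : 1 ≤ k) (hm : k + 2 ≤ m)
    (hear : (0, k + 1) ∈ E) : CrossBounded k (m - 1) (collapse E k m) := by
  classical
  have himg : ∀ e ∈ E, k + 1 < e.2 → (collapseEdge E k m e).1 < (collapseEdge E k m e).2 ∧
      (collapseEdge E k m e).2 < m - 1 ∧ k + 1 ≤ (collapseEdge E k m e).2 := by
    intro e he hek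
    have := hE.lt e he
    rcases collapseEdge_cases (E := E) (k := k) (m := m) e with h1 | h1 | h1 <;>
      simp only [h1] <;> omega
  have hlt : ∀ e ∈ CZDistance.collapse E k m, e.1 < e.2 ∧ e.2 < m - 1 := by
    intro e he
    rcases Finset.mem_union.1 he with h | h
    · simp only [Finset.mem_filter, Finset.mem_product, Finset.mem_range] at h
      omega
    · obtain ⟨f, hf, rfl⟩ := Finset.mem_image.1 h
      rw [Finset.mem_filter] at hf
      exact ⟨(himg f hf.1 hf.2).1, (himg f hf.1 hf.2).2.1⟩
  refine ⟨hlt, fun T hTE hT => ?_⟩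
  by_contra hcard
  rw [not_le] at hcard
  -- A chord among the first `k + 1` vertices has length at most `k`, so it lies in no crossing
  -- family this large.
  have hout : ∀ t ∈ T, ∃ e ∈ E, k + 1 < e.2 ∧ collapseEdge E k m e = t := by
    intro t ht
    rcases Finset.mem_union.1 (hTE ht) with h | h
    · simp only [Finset.mem_filter, Finset.mem_product, Finset.mem_range] at h
      have := card_le_of_mem_short ht h.2 hT
      omega
    · obtain ⟨f, hf, rfl⟩ := Finset.mem_image.1 h
      rw [Finset.mem_filter] at hf
      exact ⟨f, hf.1, hf.2, rfl⟩
  set μ := greedyColumn E k m with hμ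
  -- A chord is `low` if it has a preimage in its own row, so that its row need not be raised.
  obtain ⟨low, hlow⟩ : ∃ low : ℕ × ℕ → Prop,
      ∀ t, low t ↔ (t.1, t.2 + 1) ∈ E ∧ μ (t.1 - 1) < t.2 + 1 := ⟨_, fun _ => Iff.rfl⟩
  -- `Q` holds for the rows up to the last one that contains a low chord of `T`. In these, rows are
  -- kept and non-low chords are replaced by greedy ones; above, rows are raised by one. Hence the
  -- lifted rows stay strictly increasing.
  obtain ⟨Q, hQ⟩ : ∃ Q : ℕ → Prop,
      ∀ i, Q i ↔ ∃ t ∈ T, i ≤ t.1 ∧ 1 ≤ t.1 ∧ t.1 + 1 ≤ k ∧ low t := ⟨_, fun _ => Iff.rfl⟩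
  set ψ : ℕ × ℕ → ℕ × ℕ := fun t =>
    if t.1 = 0 then (0, t.2 + 1)
    else if k ≤ t.1 then (t.1 + 1, t.2 + 1)
    else if Q t.1 then (t.1, if low t then t.2 + 1 else μ t.1)
    else (t.1 + 1, t.2 + 1) with hψ
  have hcases : ∀ t ∈ T, (t.1 = 0 ∧ (0, t.2 + 1) ∈ E) ∨ (k ≤ t.1 ∧ (t.1 + 1, t.2 + 1) ∈ E) ∨
      (1 ≤ t.1 ∧ t.1 < k ∧ (low t ∨ ((t.1 + 1, t.2 + 1) ∈ E ∧ t.2 + 1 ≤ μ t.1))) := by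
    intro t ht
    obtain ⟨e, he, hek, rfl⟩ := hout t ht
    have hsnd : (collapseEdge E k m e).2 + 1 = e.2 := by
      rw [collapseEdge_snd]; omega
    rcases collapseEdge_cases (E := E) (k := k) (m := m) e with
      ⟨h1, h2⟩ | ⟨h1, h2, h3, h4⟩ | ⟨h1, h2, h3⟩
    · refine Or.inl ⟨by rw [h2], ?_⟩
      rw [hsnd, ← h1]
      exact he
    · have h5 : (collapseEdge E k m e).1 = e.1 := by rw [h4]
      refine Or.inr (Or.inr ?_)
      rw [hlow]
      simp only [h5, hsnd]
      refine ⟨h1, lt_of_le_of_ne h2 ?_, Or.inl ⟨he, h3⟩⟩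
      rintro h6
      have h7 := hE.le_greedyColumn hk hear (w := e.2) (by rw [← h6]; exact he)
      rw [h6] at h3
      omega
    · have h5 : (collapseEdge E k m e).1 = e.1 - 1 := by rw [h3]
      have h6 : e.1 - 1 + 1 = e.1 := by omega
      simp only [h5, hsnd, h6]
      by_cases h7 : e.1 ≤ k
      · have h8 := h2 h7
        have h9 : e.1 ≠ 1 := by
          intro h9
          rw [h9] at h8
          have h0 : greedyColumn E k m 0 = k + 1 := rfl
          simp only [Nat.sub_self, h0] at h8
          omega
        exact Or.inr (Or.inr ⟨by omega, by omega, Or.inr ⟨he, h8⟩⟩)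
      · exact Or.inr (Or.inl ⟨by omega, he⟩)
  have hk2 : ∀ t ∈ T, k + 1 ≤ t.2 := by
    intro t ht
    obtain ⟨e, he, hek, rfl⟩ := hout t ht
    exact (himg e he hek).2.2
  have hcross : ∀ t ∈ T, ∀ q ∈ T, t.1 < q.1 → t.2 < q.2 := by
    intro t ht q hq h
    have := hT ht hq (fun h' => by rw [h'] at h; omega)
    unfold PairCross at this
    omega
  have hrow : ∀ t ∈ T, ∀ q ∈ T, t.1 = q.1 → t = q := by
    intro t ht q hq h
    by_contra hne
    have := hT ht hq hne
    unfold PairCross at this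
    omega
  -- A later low chord lies beyond the staircase, which shows that the substituted greedy column is
  -- a genuine one and keeps the columns increasing.
  have hQμ : ∀ t ∈ T, ¬ low t → Q t.1 →
      ∃ q ∈ T, t.1 < q.1 ∧ q.1 < k ∧ μ (q.1 - 1) < q.2 + 1 ∧ q.2 + 1 < m ∧ Q q.1 := by
    intro t ht hnl hQt
    obtain ⟨q, hq, htq, hq1, hqk, hlq⟩ := (hQ _).1 hQt
    have hlq' := (hlow q).1 hlq
    refine ⟨q, hq, lt_of_le_of_ne htq ?_, by omega, hlq'.2, (hE.lt _ hlq'.1).2,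
      (hQ _).2 ⟨q, hq, le_rfl, hq1, hqk, hlq⟩⟩
    intro h
    exact hnl (hrow t ht q hq h ▸ hlq)
  have hQlt : ∀ t ∈ T, ¬ low t → Q t.1 → μ t.1 < m := by
    intro t ht hnl hQt
    obtain ⟨q, -, h1, -, h3, h4, -⟩ := hQμ t ht hnl hQt
    have : μ t.1 ≤ μ (q.1 - 1) := hE.greedyColumn_mono (by omega) (by omega)
    omega
  have hψE : ∀ t ∈ T, ψ t ∈ E := by
    intro t ht
    rcases hcases t ht with ⟨h1, h2⟩ | ⟨h1, h2⟩ | ⟨h1, h2, h3⟩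
    · simp only [hψ, h1, if_true]
      exact h2
    · simp only [hψ, show ¬ t.1 = 0 by omega, h1, if_true, if_false]
      exact h2
    · simp only [hψ, show ¬ t.1 = 0 by omega, show ¬ k ≤ t.1 by omega, if_false]
      by_cases hl : low t
      · have : Q t.1 := (hQ _).2 ⟨t, ht, le_rfl, h1, by omega, hl⟩
        rw [if_pos this, if_pos hl]
        exact ((hlow t).1 hl).1
      · by_cases hQt : Q t.1
        · rw [if_pos hQt, if_neg hl]
          have := hQlt t ht hl hQt
          obtain ⟨a, ha⟩ : ∃ a, t.1 = a + 1 := ⟨t.1 - 1, by omega⟩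
          rw [ha] at this ⊢
          exact (greedyColumn_mem this).1
        · rw [if_neg hQt]
          exact (h3.resolve_left hl).1
  have hQmono : ∀ a c, a ≤ c → Q c → Q a := by
    intro a c hac hc
    obtain ⟨t, ht, h1, h2⟩ := (hQ c).1 hc
    exact (hQ a).2 ⟨t, ht, hac.trans h1, h2⟩
  have hψfst : ∀ t : ℕ × ℕ, (t.1 = 0 → (ψ t).1 = 0) ∧ (k ≤ t.1 → (ψ t).1 = t.1 + 1) ∧
      (1 ≤ t.1 → t.1 < k → Q t.1 → (ψ t).1 = t.1) ∧
      (1 ≤ t.1 → t.1 < k → ¬ Q t.1 → (ψ t).1 = t.1 + 1) := by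
    intro t
    simp only [hψ]
    split_ifs with h1 h2 h3 h4 <;> simp only [] <;> refine ⟨?_, ?_, ?_, ?_⟩ <;> intros <;>
      first | trivial | omega
  have hψsnd : ∀ t ∈ T,
      ((ψ t).2 = t.2 + 1 ∧ (1 ≤ t.1 → t.1 < k → Q t.1 → low t)) ∨
      (1 ≤ t.1 ∧ t.1 < k ∧ (ψ t).2 = μ t.1 ∧ Q t.1 ∧ ¬ low t ∧ t.2 + 1 ≤ μ t.1) := by
    intro t ht
    simp only [hψ]
    split_ifs with h1 h2 h3 h4
    · exact Or.inl ⟨rfl, by omega⟩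
    · exact Or.inl ⟨rfl, by omega⟩
    · exact Or.inl ⟨rfl, fun _ _ _ => h4⟩
    · refine Or.inr ⟨by omega, by omega, rfl, h3, h4, ?_⟩
      rcases hcases t ht with h5 | h5 | ⟨-, -, h5⟩
      · omega
      · omega
      · exact (h5.resolve_left h4).2
    · exact Or.inl ⟨rfl, fun _ _ h => absurd h h3⟩
  have hψT : ∀ t ∈ T, ∀ t' ∈ T, t.1 < t'.1 → PairCross (ψ t) (ψ t') := by
    intro t ht t' ht' h
    have hc := hT ht ht' (fun h' => by rw [h'] at h; omega)
    unfold PairCross at hc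
    have hk2t := hk2 t ht
    have h1 := hψfst t
    have h2 := hψfst t'
    have hge : t.2 + 1 ≤ (ψ t).2 := by
      rcases hψsnd t ht with h3 | h3 <;> omega
    have hge' : t'.2 + 1 ≤ (ψ t').2 := by
      rcases hψsnd t' ht' with h3 | h3 <;> omega
    have hfst : (ψ t).1 < (ψ t').1 := by
      by_cases hQt : Q t.1 <;> by_cases hQt' : Q t'.1
      · simp only [hQt, hQt', not_true_eq_false, false_imp_iff, true_imp_iff, imp_true_iff] at h1 h2
        omega
      · simp only [hQt, hQt', not_true_eq_false, not_false_eq_true, false_imp_iff, true_imp_iff,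
          imp_true_iff] at h1 h2
        omega
      · exact absurd (hQmono _ _ h.le hQt') hQt
      · simp only [hQt, hQt', not_false_eq_true, false_imp_iff, true_imp_iff, imp_true_iff] at h1 h2
        omega
    have hmid : (ψ t').1 < (ψ t).2 := by
      have : (ψ t').1 ≤ t'.1 + 1 := by
        by_cases hQt' : Q t'.1 <;>
          simp only [hQt', not_true_eq_false, not_false_eq_true, false_imp_iff, true_imp_iff,
            imp_true_iff] at h2 <;> omega
      omega
    have hsnd : (ψ t).2 < (ψ t').2 := by
      rcases hψsnd t ht with h3 | ⟨h3, h4, h5, h6, h7, h8⟩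
      · omega
      · obtain ⟨q, hq, hq1, hq2, hq3, hq4, hq5⟩ := hQμ t ht h7 h6
        have h9 : μ t.1 ≤ μ (q.1 - 1) := hE.greedyColumn_mono (by omega) (by omega)
        rcases lt_trichotomy q.1 t'.1 with h10 | h10 | h10
        · have := hcross q hq t' ht' h10
          omega
        · have := hrow q hq t' ht' h10
          subst this
          omega
        · rcases hcases t' ht' with h11 | h11 | ⟨h11, h12, h13⟩
          · omega
          · omega
          · rcases hψsnd t' ht' with ⟨h14, h15⟩ | ⟨-, -, h14, h15, hl, -⟩
            · have h16 : μ t.1 ≤ μ (t'.1 - 1) := hE.greedyColumn_mono (by omega) (by omega)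
              have h17 := ((hlow t').1 (h15 h11 h12 (hQmono _ _ h10.le hq5))).2
              omega
            · have h16 : μ t.1 < μ t'.1 := greedyColumn_lt h (hQlt t' ht' hl h15)
              omega
    exact Or.inl ⟨hfst, hmid, hsnd⟩
  have hψT' : ∀ t ∈ T, ∀ t' ∈ T, t ≠ t' → PairCross (ψ t) (ψ t') := by
    intro t ht t' ht' hne
    rcases lt_trichotomy t.1 t'.1 with h | h | h
    · exact hψT t ht t' ht' h
    · exact absurd (hrow t ht t' ht' h) hne
    · exact (hψT t' ht' t ht h).symm
  have := hE.card_le (T.image ψ) (Finset.image_subset_iff.2 hψE) (by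
    intro e he f hf hef
    obtain ⟨t, ht, rfl⟩ := Finset.mem_image.1 he
    obtain ⟨t', ht', rfl⟩ := Finset.mem_image.1 hf
    exact hψT' t ht t' ht' fun h => hef (h ▸ rfl))
  rw [Finset.card_image_of_injOn] at this
  · omega
  · intro t ht t' ht' h
    by_contra hne
    exact (hψT' t ht t' ht' hne).ne h

end Collapse

/-- The rotation of a chord of the convex polygon with vertices `0, …, m - 1` that takes the vertex
`i` to `0`. -/
def rotateEdge (m i : ℕ) (e : ℕ × ℕ) : ℕ × ℕ :=
  if e.2 < i then (e.1 + m - i, e.2 + m - i)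
  else if e.1 < i then (e.2 - i, e.1 + m - i)
  else (e.1 - i, e.2 - i)

theorem pairCross_rotateEdge {m i : ℕ} {e f : ℕ × ℕ} (hi : i < m) (he : e.1 < e.2 ∧ e.2 < m)
    (hf : f.1 < f.2 ∧ f.2 < m) :
    PairCross (rotateEdge m i e) (rotateEdge m i f) ↔ PairCross e f := by
  unfold PairCross rotateEdge
  split_ifs <;> simp only [] <;> omega

theorem rotateEdge_injOn {m i : ℕ} {e f : ℕ × ℕ} (hi : i < m) (he : e.1 < e.2 ∧ e.2 < m)
    (hf : f.1 < f.2 ∧ f.2 < m) (h : rotateEdge m i e = rotateEdge m i f) : e = f := by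
  unfold rotateEdge at h
  rw [Prod.ext_iff] at h ⊢
  split_ifs at h <;> simp only [] at h <;> omega

theorem CrossBounded.rotate {k m : ℕ} {E : Finset (ℕ × ℕ)} (hE : CrossBounded k m E) {i : ℕ}
    (hi : i < m) : CrossBounded k m (E.image (rotateEdge m i)) ∧
      (E.image (rotateEdge m i)).card = E.card := by
  classical
  have hinj : Set.InjOn (rotateEdge m i) (E : Set (ℕ × ℕ)) := fun e he f hf h =>
    rotateEdge_injOn hi (hE.lt e he) (hE.lt f hf) h
  refine ⟨⟨?_, ?_⟩, Finset.card_image_of_injOn hinj⟩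
  · intro e he
    obtain ⟨f, hf, rfl⟩ := Finset.mem_image.1 he
    have := hE.lt f hf
    unfold rotateEdge
    split_ifs <;> simp only [] <;> omega
  · intro T hTE hT
    obtain ⟨T, hTE', rfl⟩ := Finset.subset_image_iff.1 hTE
    have hTE'' : T ⊆ E := hTE'
    rw [Finset.card_image_of_injOn (hinj.mono hTE')]
    refine hE.card_le T hTE'' fun e he f hf hef => ?_
    have hne : rotateEdge m i e ≠ rotateEdge m i f := fun h =>
      hef (hinj (hTE'' he) (hTE'' hf) h)
    exact (pairCross_rotateEdge hi (hE.lt e (hTE'' he)) (hE.lt f (hTE'' hf))).1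
      (hT (Finset.mem_coe.2 (Finset.mem_image_of_mem _ he))
        (Finset.mem_coe.2 (Finset.mem_image_of_mem _ hf)) hne)

/-- A maximal crossing-bounded set of chords has a chord of length `k + 1`. -/
theorem CrossBounded.exists_ear {k m : ℕ} {E : Finset (ℕ × ℕ)} (hE : CrossBounded k m E)
    (hk : 1 ≤ k) (hm : k + 2 ≤ m)
    (hmax : ∀ E' : Finset (ℕ × ℕ), CrossBounded k m E' → E'.card ≤ E.card) :
    ∃ i, (i, i + (k + 1)) ∈ E := by
  classical
  have hadd : ∀ f : ℕ × ℕ, f.1 < f.2 → f.2 < m → f ∉ E →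
      ∃ T ⊆ E, (T : Set (ℕ × ℕ)).Pairwise PairCross ∧ (∀ e ∈ T, PairCross f e) ∧ k ≤ T.card := by
    intro f hf1 hf2 hfE
    by_contra! hcon
    have : CrossBounded k m (insert f E) := by
      refine ⟨?_, fun T hTE hT => ?_⟩
      · intro e he
        rcases Finset.mem_insert.1 he with rfl | he
        · exact ⟨hf1, hf2⟩
        · exact hE.lt e he
      · by_cases hfT : f ∈ T
        · have h1 := hcon (T.erase f) (by rwa [← Finset.subset_insert_iff])
            (hT.mono (by simp)) (fun e he => by
              rw [Finset.mem_erase] at he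
              exact hT hfT he.2 he.1.symm)
          rw [Finset.card_erase_of_mem hfT] at h1
          omega
        · exact hE.card_le T ((Finset.subset_insert_iff_of_notMem hfT).1 hTE) hT
    have h2 := hmax _ this
    rw [Finset.card_insert_of_notMem hfE] at h2
    omega
  -- This side of the polygon crosses nothing, so maximality forces it in; it only ensures that a
  -- chord of length at least `k + 1` exists.
  have hlong : (0, m - 1) ∈ E := by
    by_contra h
    obtain ⟨T, hTE, -, hT2, hT3⟩ := hadd (0, m - 1) (by simp only; omega) (by simp only; omega) h
    obtain ⟨e, he⟩ := Finset.card_pos.1 (by omega : 0 < T.card)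
    have h1 := hT2 e he
    have h2 := hE.lt e (hTE he)
    unfold PairCross at h1
    simp only at h1
    omega
  obtain ⟨e, he, hmin⟩ := Finset.exists_min_image (E.filter fun e => k + 1 ≤ e.2 - e.1)
    (fun e => e.2 - e.1) ⟨(0, m - 1), by
      rw [Finset.mem_filter]
      exact ⟨hlong, by simp only; omega⟩⟩
  rw [Finset.mem_filter] at he
  have helt := hE.lt e he.1
  refine ⟨e.1, ?_⟩
  by_cases hlen : e.2 - e.1 = k + 1
  · rw [← hlen, Nat.add_sub_cancel' helt.1.le]
    exact he.1
  exfalso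
  have hshort : ∀ f ∈ E, f.2 - f.1 < e.2 - e.1 → f.2 - f.1 ≤ k := by
    intro f hf h
    by_contra h'
    have := hmin f (Finset.mem_filter.2 ⟨hf, by omega⟩)
    omega
  -- The chord `e` is a shortest one of length at least `k + 1`. If it is longer than that,
  -- shortening it by one gives a missing chord, which by maximality is crossed by `k` pairwise
  -- crossing chords.
  have hfE : (e.1, e.2 - 1) ∉ E := by
    intro h
    have := hshort _ h (by simp only; omega)
    simp only at this
    omega
  obtain ⟨T, hTE, hT1, hT2, hT3⟩ := hadd (e.1, e.2 - 1) (by simp only; omega)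
    (by simp only; omega) hfE
  by_cases hall : ∀ g ∈ T, PairCross e g
  · have heT : e ∉ T := fun h => (hall e h).ne rfl
    have := hE.card_le (insert e T) (Finset.insert_subset he.1 hTE) (by
      rw [Finset.coe_insert]
      refine hT1.insert fun g hg _ => ⟨hall g hg, (hall g hg).symm⟩)
    rw [Finset.card_insert_of_notMem heT] at this
    omega
  · push Not at hall
    -- Crossing the shortened chord but not `e`, the chord `g` ends at `e.2` and has length at most
    -- `k`. The others must each have an endpoint strictly between `g.1` and `e.2 - 1`, which leaves
    -- room for at most `k - 2` of them.
    obtain ⟨g, hg, hng⟩ := hall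
    have h1 := hT2 g hg
    have hglt := hE.lt g (hTE hg)
    have hgs := hshort g (hTE hg)
    unfold PairCross at h1 hng
    simp only at h1 hng
    have h3 := card_le_of_endpoint_mem (T := T.erase g) (a := g.1) (b := e.2 - 1)
      (hT1.mono (by simp)) (by
        intro h hh
        rw [Finset.mem_erase] at hh
        have h4 := hT1 hh.2 hg hh.1
        have h5 := hT2 h hh.2
        have h6 := hE.lt h (hTE hh.2)
        unfold PairCross at h4 h5
        simp only at h5
        omega)
    rw [Finset.card_erase_of_mem hg] at h3
    omega

/-- **Capoyleas–Pach**, weak form: a set of chords of a convex `m`-gon without `k + 1` pairwise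
crossing elements has at most `2 * k * (m - 1)` elements. -/
theorem CrossBounded.card_le_two_mul {k m : ℕ} {E : Finset (ℕ × ℕ)} (hE : CrossBounded k m E) :
    E.card ≤ 2 * k * (m - 1) := by
  classical
  rcases Nat.eq_zero_or_pos k with rfl | hk
  · have : E = ∅ := by
      by_contra hne
      obtain ⟨e, he⟩ := Finset.nonempty_iff_ne_empty.2 hne
      have := hE.card_le {e} (by simpa using he) (by simp)
      simp at this
    simp [this]
  have hsub : ∀ {m : ℕ} {E : Finset (ℕ × ℕ)}, CrossBounded k m E →
      E ⊆ (Finset.range m ×ˢ Finset.range m).filter fun e => e.1 < e.2 := by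
    intro m E hE e he
    have := hE.lt e he
    simp only [Finset.mem_filter, Finset.mem_product, Finset.mem_range]
    omega
  induction m generalizing E with
  | zero =>
    have := Finset.card_le_card (hsub hE)
    simp at this
    simp [this]
  | succ m ih =>
    -- For at most `2 * k + 1` vertices the number of all pairs already meets the bound.
    by_cases hm : m ≤ 2 * k
    · have h1 := Finset.card_le_card (hsub hE)
      rw [Finset.card_product_filter_lt, Finset.card_range, Nat.choose_two_right] at h1
      have h2 : (m + 1) * (m + 1 - 1) ≤ 2 * (2 * k * (m + 1 - 1)) := by
        rw [← mul_assoc]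
        refine Nat.mul_le_mul_right _ ?_
        omega
      omega
    -- An ear is only guaranteed in a set of maximum size, so the induction step bounds such a set
    -- instead of `E`.
    · obtain ⟨E', hE', hmax⟩ := Finset.exists_max_image
        (((Finset.range (m + 1) ×ˢ Finset.range (m + 1)).filter fun e => e.1 < e.2).powerset.filter
          fun E' => CrossBounded k (m + 1) E') Finset.card
        ⟨E, by rw [Finset.mem_filter, Finset.mem_powerset]; exact ⟨hsub hE, hE⟩⟩
      rw [Finset.mem_filter] at hE'
      have hmax' : ∀ F : Finset (ℕ × ℕ), CrossBounded k (m + 1) F → F.card ≤ E'.card := by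
        intro F hF
        exact hmax F (by rw [Finset.mem_filter, Finset.mem_powerset]; exact ⟨hsub hF, hF⟩)
      obtain ⟨i, hi⟩ := hE'.2.exists_ear hk (by omega) hmax'
      have hi' := hE'.2.lt _ hi
      simp only at hi'
      obtain ⟨hrot, hcard⟩ := hE'.2.rotate (i := i) (by omega)
      have hear : (0, k + 1) ∈ E'.image (rotateEdge (m + 1) i) := by
        refine Finset.mem_image.2 ⟨_, hi, ?_⟩
        unfold rotateEdge
        simp only
        rw [if_neg (by omega), if_neg (by omega), Nat.sub_self, Nat.add_sub_cancel_left]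
      have h1 := ih (hrot.collapse hk (by omega) hear)
      have h2 := hrot.card_le_collapse hk hear
      have h3 := hmax' E hE
      have h4 : 2 * k * (m + 1 - 1) = 2 * k * (m - 1) + 2 * k := by
        obtain ⟨m', rfl⟩ : ∃ m', m = m' + 1 := ⟨m - 1, by omega⟩
        simp only [Nat.add_sub_cancel]
        ring
      omega

end ConvexGeometric

/-! ### Interlacement graphs of words and the moves on them -/

section Words

open Classical

variable {V : Type*}

/-- The number of pairs of positions of the word `l`, the first with letter `u` and the second, to
its right, with letter `w`. -/
noncomputable def pairCount (u w : V) : List V → ℕ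
  | [] => 0
  | x :: l => (if x = u then l.count w else 0) + pairCount u w l

theorem pairCount_append (u w : V) (l l' : List V) :
    pairCount u w (l ++ l') = pairCount u w l + pairCount u w l' + l.count u * l'.count w := by
  induction l with
  | nil => simp [pairCount]
  | cons x l ih =>
    simp only [List.cons_append, pairCount, ih, List.count_append, List.count_cons, beq_iff_eq]
    split_ifs <;> ring

theorem pairCount_cons (u w x : V) (l : List V) :
    pairCount u w (x :: l) = (if x = u then l.count w else 0) + pairCount u w l := rfl

theorem pairCount_nil (u w : V) : pairCount u w [] = 0 := rfl

theorem pairCount_add_swap {u w : V} (huw : u ≠ w) (l : List V) :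
    pairCount u w l + pairCount w u l = l.count u * l.count w := by
  induction l with
  | nil => simp [pairCount]
  | cons x l ih =>
    simp only [pairCount, List.count_cons, beq_iff_eq]
    by_cases h1 : x = u
    · have h2 : ¬ x = w := fun h => huw (h1.symm.trans h)
      simp only [h1, if_true, if_neg huw, add_zero]
      linarith
    · by_cases h2 : x = w
      · simp only [h2, if_true, if_neg huw.symm, add_zero]
        linarith
      · simp only [h1, h2, if_false, add_zero]
        linarith

theorem pairCount_reverse (u w : V) (l : List V) :
    pairCount u w l.reverse = pairCount w u l := by
  induction l with
  | nil => rfl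
  | cons x l ih =>
    rw [List.reverse_cons, pairCount_append, ih, pairCount_cons, pairCount_cons, pairCount_nil,
      List.count_reverse, List.count_singleton, List.count_nil]
    by_cases h : x = w
    · simp [h]; ring
    · simp [h]

theorem pairCount_eq_zero_left {u w : V} {l : List V} (h : u ∉ l) : pairCount u w l = 0 := by
  induction l with
  | nil => rfl
  | cons x l ih =>
    rw [List.mem_cons, not_or] at h
    rw [pairCount_cons, if_neg (Ne.symm h.1), ih h.2]

theorem pairCount_eq_zero_right {u w : V} {l : List V} (h : w ∉ l) : pairCount u w l = 0 := by
  induction l with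
  | nil => rfl
  | cons x l ih =>
    rw [List.mem_cons, not_or] at h
    rw [pairCount_cons, ih h.2, List.count_eq_zero_of_not_mem h.2]
    simp

/-- Every letter occurs an even number of times in the word. -/
def EvenWord (l : List V) : Prop := ∀ u, Even (l.count u)

theorem EvenWord.perm {l l' : List V} (h : EvenWord l) (hp : l.Perm l') : EvenWord l' := fun u =>
  hp.count_eq u ▸ h u

/-- The interlacement graph of a word. -/
noncomputable def wordGraph (l : List V) : SimpleGraph V :=
  SimpleGraph.fromRel fun u w => Odd (pairCount u w l)

/-- The counts for `(u, w)` and `(w, u)` add up to the product of two even numbers, so their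
parities agree. For letters that occur twice, an odd count means that they alternate. -/
theorem EvenWord.wordGraph_adj {l : List V} (h : EvenWord l) {u w : V} :
    (wordGraph l).Adj u w ↔ u ≠ w ∧ Odd (pairCount u w l) := by
  rw [wordGraph, SimpleGraph.fromRel_adj]
  refine and_congr_right fun huw => ?_
  have h1 : Even (pairCount u w l + pairCount w u l) := by
    rw [pairCount_add_swap huw]
    exact (h u).mul_right _
  rw [Nat.even_add, ← Nat.not_odd_iff_even, ← Nat.not_odd_iff_even] at h1
  tauto

theorem pairCount_swap {a b : V} (hab : a ≠ b) (u w : V) (P Q : List V) :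
    pairCount u w (P ++ a :: b :: Q) + (if u = b ∧ w = a then 1 else 0) =
      pairCount u w (P ++ b :: a :: Q) + (if u = a ∧ w = b then 1 else 0) := by
  have hc : (a :: b :: Q).count w = (b :: a :: Q).count w := (List.Perm.swap b a Q).count_eq w
  rw [pairCount_append, pairCount_append, hc]
  simp only [pairCount_cons, List.count_cons, beq_iff_eq, eq_comm (a := u), eq_comm (a := w)]
  have hba : ¬ b = a := fun h => hab h.symm
  by_cases h1 : a = u
  · subst h1
    by_cases h3 : b = w
    · subst h3
      simp [hab, hba]
      ring
    · simp [hba, h3]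
  · by_cases h2 : b = u
    · subst h2
      by_cases h3 : a = w
      · subst h3
        simp [hab, hba]
        ring
      · simp [hab, h3]
    · simp [h1, h2]

theorem czReach_swap {P Q : List V} {a b : V} (h : EvenWord (P ++ a :: b :: Q)) :
    CZReach 1 (wordGraph (P ++ a :: b :: Q)) (wordGraph (P ++ b :: a :: Q)) := by
  by_cases hab : a = b
  · subst hab
    exact .refl _ _
  have h' : EvenWord (P ++ b :: a :: Q) := h.perm ((List.Perm.swap b a Q).append_left P)
  have key : wordGraph (P ++ b :: a :: Q) =
      symmDiff (wordGraph (P ++ a :: b :: Q)) (SimpleGraph.edge a b) := by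
    ext u w
    rw [symmDiff_edge_adj hab, h.wordGraph_adj, h'.wordGraph_adj]
    have hs := pairCount_swap hab u w P Q
    by_cases h1 : u = a ∧ w = b
    · obtain ⟨rfl, rfl⟩ := h1
      simp only [hab, and_self, if_true, if_false, false_and] at hs
      simp only [ne_eq, hab, not_false_eq_true, true_and, and_self, true_or, Xor, not_true_eq_false,
        and_false, false_or, Nat.odd_iff]
      omega
    by_cases h2 : u = b ∧ w = a
    · obtain ⟨rfl, rfl⟩ := h2
      simp only [h1, and_self, if_true, if_false] at hs
      simp only [ne_eq, Ne.symm hab, not_false_eq_true, true_and, and_self, or_true, Xor,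
        not_true_eq_false, and_false, false_or, Nat.odd_iff]
      omega
    simp only [h1, h2, if_false, add_zero] at hs
    simp [Xor, h1, h2, hs]
  rw [key]
  exact .toggle a b hab (.refl 0 _)

/-- The neighbours of `v` are the letters occurring an odd number of times in `X`. Reversal
exchanges the two pair counts inside `X`, whose sum is `X.count u * X.count w`; the parity therefore
changes exactly for two neighbours of `v`. -/
theorem czReach_reverse {P X Q : List V} {v : V} (h : EvenWord (P ++ v :: (X ++ v :: Q)))
    (hP : v ∉ P) (hX : v ∉ X) (hQ : v ∉ Q) :
    CZReach 0 (wordGraph (P ++ v :: (X ++ v :: Q)))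
      (wordGraph (P ++ v :: (X.reverse ++ v :: Q))) := by
  have h' : EvenWord (P ++ v :: (X.reverse ++ v :: Q)) :=
    h.perm ((((List.reverse_perm X).symm.append_right _).cons v).append_left P)
  have hv : ∀ u, u ≠ v → pairCount v u (P ++ v :: (X ++ v :: Q)) = X.count u + 2 * Q.count u := by
    intro u hu
    simp only [pairCount_append, pairCount_cons, List.count_cons, List.count_append, beq_iff_eq,
      pairCount_eq_zero_left hP, pairCount_eq_zero_left hX, pairCount_eq_zero_left hQ,
      List.count_eq_zero_of_not_mem hP, List.count_eq_zero_of_not_mem hX, if_true, hu.symm,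
      if_false]
    ring
  have hadj : ∀ u, (wordGraph (P ++ v :: (X ++ v :: Q))).Adj v u ↔ u ≠ v ∧ Odd (X.count u) := by
    intro u
    rw [h.wordGraph_adj]
    constructor
    · rintro ⟨h1, h2⟩
      rw [hv u h1.symm] at h2
      exact ⟨h1.symm, by rw [Nat.odd_iff] at *; omega⟩
    · rintro ⟨h1, h2⟩
      rw [hv u h1]
      exact ⟨h1.symm, by rw [Nat.odd_iff] at *; omega⟩
  have key : wordGraph (P ++ v :: (X.reverse ++ v :: Q)) =
      localComplement (wordGraph (P ++ v :: (X ++ v :: Q))) v := by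
    ext u w
    rw [localComplement_adj, hadj, hadj, h.wordGraph_adj, h'.wordGraph_adj]
    by_cases huw : u = w
    · simp [huw]
    have h1 := pairCount_add_swap huw X
    have h2 : pairCount u w (P ++ v :: (X.reverse ++ v :: Q)) + pairCount u w X =
        pairCount u w (P ++ v :: (X ++ v :: Q)) + pairCount w u X := by
      simp only [pairCount_append, pairCount_cons, List.count_cons, List.count_append, beq_iff_eq,
        pairCount_reverse, List.count_reverse]
      ring
    by_cases hu : u = v
    · subst hu
      rw [pairCount_eq_zero_left hX, pairCount_eq_zero_right hX] at h2
      simp only [add_zero] at h2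
      simp [Xor, huw, h2]
    by_cases hw : w = v
    · subst hw
      rw [pairCount_eq_zero_left hX, pairCount_eq_zero_right hX] at h2
      simp only [add_zero] at h2
      simp [Xor, huw, h2]
    simp only [ne_eq, huw, hu, hw, not_false_eq_true, true_and, Xor, Nat.not_odd_iff_even]
    rw [← Nat.odd_mul, ← h1]
    simp only [Nat.odd_iff, Nat.even_iff]
    omega
  rw [key]
  exact .lc v (.refl 0 _)

theorem wordGraph_insert_pair {P Q : List V} {v : V} (h : EvenWord (P ++ Q))
    (hP : v ∉ P) (hQ : v ∉ Q) : wordGraph (P ++ v :: v :: Q) = wordGraph (P ++ Q) := by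
  have h' : EvenWord (P ++ v :: v :: Q) := by
    intro u
    have := h u
    simp only [List.count_append, List.count_cons, Nat.even_iff] at *
    omega
  ext u w
  rw [h.wordGraph_adj, h'.wordGraph_adj]
  refine and_congr_right fun huw => ?_
  by_cases hu : v = u
  · subst hu
    simp only [pairCount_append, pairCount_cons, List.count_cons, beq_iff_eq,
      pairCount_eq_zero_left hP, pairCount_eq_zero_left hQ, List.count_eq_zero_of_not_mem hP,
      if_true, huw, if_false, Nat.odd_iff]
    omega
  · by_cases hw : v = w
    · subst hw
      simp only [pairCount_append, pairCount_cons, List.count_cons, beq_iff_eq,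
        pairCount_eq_zero_right hP, pairCount_eq_zero_right hQ, List.count_eq_zero_of_not_mem hQ,
        if_true, hu, if_false, Nat.odd_iff]
      omega
    · simp [pairCount_append, pairCount_cons, hu, hw]

theorem wordGraph_reverse {l : List V} (h : EvenWord l) :
    wordGraph l.reverse = wordGraph l := by
  have h' : EvenWord l.reverse := h.perm (List.reverse_perm l).symm
  ext u w
  rw [h.wordGraph_adj, h'.wordGraph_adj]
  refine and_congr_right fun huw => ?_
  have h1 := pairCount_add_swap huw l
  have h2 : Even (l.count u * l.count w) := (h u).mul_right _
  rw [← h1, Nat.even_iff] at h2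
  rw [pairCount_reverse, Nat.odd_iff, Nat.odd_iff]
  omega

theorem EvenWord.filter_ne {l : List V} (h : EvenWord l) (b : V) :
    EvenWord (l.filter fun x => x ≠ b) := by
  intro u
  by_cases hu : u = b
  · subst hu
    simp [List.count_eq_zero_of_not_mem]
  · rw [List.count_filter (by simpa using hu)]
    exact h u

theorem pairCount_filter {p : V → Bool} {u w : V} (hu : p u = true) (hw : p w = true)
    (l : List V) : pairCount u w (l.filter p) = pairCount u w l := by
  induction l with
  | nil => rfl
  | cons x l ih =>
    by_cases hx : p x = true
    · rw [List.filter_cons_of_pos hx, pairCount_cons, pairCount_cons, ih, List.count_filter hw]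
    · rw [List.filter_cons_of_neg hx, ih, pairCount_cons, if_neg, zero_add]
      rintro rfl
      exact hx hu

theorem wordGraph_filter_ne {l : List V} (h : EvenWord l) (b : V) :
    wordGraph (l.filter fun x => x ≠ b) = isolate (wordGraph l) b := by
  ext u w
  rw [(h.filter_ne b).wordGraph_adj, isolate_adj, h.wordGraph_adj]
  by_cases hu : u = b
  · subst hu
    rw [pairCount_eq_zero_left (by simp)]
    simp
  by_cases hw : w = b
  · subst hw
    rw [pairCount_eq_zero_right (by simp)]
    simp
  rw [pairCount_filter (by simpa using hu) (by simpa using hw)]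
  simp [hu, hw]

end Words

/-! ### Absorbing letters between the two copies of `v` and emitting them -/

section Merging

variable {V : Type*} {v : V}

theorem czReach_takeRight {P X Q : List V} {c : V}
    (h : EvenWord (P ++ v :: (X ++ v :: c :: Q))) :
    CZReach 1 (wordGraph (P ++ v :: (X ++ v :: c :: Q)))
      (wordGraph (P ++ v :: ((X ++ [c]) ++ v :: Q))) := by
  have h1 := czReach_swap (P := P ++ v :: X) (a := v) (b := c) (Q := Q) (by simpa using h)
  simpa using h1

/-- Reversing the container before and after the swap is free, so a letter from the left also ends
up at its right end. -/
theorem czReach_takeLeft {P X Q : List V} {a : V}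
    (h : EvenWord (P ++ a :: v :: (X ++ v :: Q))) (hv : v ∉ P ++ a :: (X ++ Q)) :
    CZReach 1 (wordGraph (P ++ a :: v :: (X ++ v :: Q)))
      (wordGraph (P ++ v :: ((X ++ [a]) ++ v :: Q))) := by
  simp only [List.mem_append, List.mem_cons, not_or] at hv
  obtain ⟨hP, ha, hX, hQ⟩ := hv
  have h1 := czReach_reverse (P := P ++ [a]) (X := X) (Q := Q) (v := v) (by simpa using h)
    (by simp [hP, ha]) hX hQ
  have e2 : EvenWord (P ++ a :: v :: (X.reverse ++ v :: Q)) := by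
    refine h.perm ((((List.Perm.append_right _ ?_).cons _).cons _).append_left _)
    exact (List.reverse_perm X).symm
  have h2 := czReach_swap e2
  have e3 : EvenWord (P ++ v :: ((a :: X.reverse) ++ v :: Q)) :=
    e2.perm ((List.Perm.swap _ _ _).append_left _)
  have h3 := czReach_reverse e3 hP (by simp [ha, hX]) hQ
  have h4 := (h1.trans (by simpa using h2)).trans (by simpa using h3)
  simpa using h4

theorem czReach_emitFront {P X Q : List V} {e : V}
    (h : EvenWord (P ++ v :: ((e :: X) ++ v :: Q))) :
    CZReach 1 (wordGraph (P ++ v :: ((e :: X) ++ v :: Q)))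
      (wordGraph ((P ++ [e]) ++ v :: (X ++ v :: Q))) := by
  simpa using czReach_swap h

/-- This is `czReach_takeLeft` run backwards. -/
theorem czReach_emitBack {P X Q : List V} {f : V}
    (h : EvenWord (P ++ v :: ((X ++ [f]) ++ v :: Q))) (hv : v ∉ P ++ f :: (X ++ Q)) :
    CZReach 1 (wordGraph (P ++ v :: ((X ++ [f]) ++ v :: Q)))
      (wordGraph ((P ++ [f]) ++ v :: (X ++ v :: Q))) := by
  have hp : (P ++ v :: ((X ++ [f]) ++ v :: Q)).Perm (P ++ f :: v :: (X ++ v :: Q)) := by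
    refine List.Perm.append_left _ ?_
    refine List.Perm.trans ?_ (List.Perm.swap _ _ _)
    refine List.Perm.cons _ ?_
    rw [List.append_assoc, List.singleton_append]
    exact List.perm_middle
  have := (czReach_takeLeft (h.perm hp) hv).symm
  simpa using this

/-- Both `A` and `C` have their least letter next to the container. Taking the lesser of the two
each time merges them, in order, into the right part `F` of the contents, while `E` is left in
place. -/
theorem exists_absorb {r : V → V → Prop} (htot : ∀ a b, r a b ∨ r b a)
    (htr : ∀ a b c, r a b → r b c → r a c) (n : ℕ) (A C E F : List V)
    (hn : A.length + C.length = n) (hA : A.reverse.Pairwise r) (hC : C.Pairwise r)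
    (hF : F.Pairwise r) (hle : ∀ f ∈ F, ∀ x ∈ A ++ C, r f x) :
    ∃ F' : List V, F'.Perm (A ++ F ++ C) ∧ F'.Pairwise r ∧ ∀ P Q : List V,
      EvenWord (P ++ A ++ v :: ((E ++ F) ++ v :: (C ++ Q))) →
      v ∉ P ++ A ++ E ++ F ++ C ++ Q →
      CZReach n (wordGraph (P ++ A ++ v :: ((E ++ F) ++ v :: (C ++ Q))))
        (wordGraph (P ++ v :: ((E ++ F') ++ v :: Q))) := by
  induction n generalizing A C F with
  | zero =>
    obtain rfl : A = [] := List.length_eq_zero_iff.1 (by omega)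
    obtain rfl : C = [] := List.length_eq_zero_iff.1 (by omega)
    exact ⟨F, by simp, hF, fun P Q _ _ => by simpa using CZReach.refl _ _⟩
  | succ n ih =>
    have hright : ∀ c C', C = c :: C' → (∀ x ∈ A, r c x) →
        ∃ F' : List V, F'.Perm (A ++ F ++ C) ∧ F'.Pairwise r ∧ ∀ P Q : List V,
          EvenWord (P ++ A ++ v :: ((E ++ F) ++ v :: (C ++ Q))) →
          v ∉ P ++ A ++ E ++ F ++ C ++ Q →
          CZReach (n + 1) (wordGraph (P ++ A ++ v :: ((E ++ F) ++ v :: (C ++ Q))))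
            (wordGraph (P ++ v :: ((E ++ F') ++ v :: Q))) := by
      rintro c C' rfl hcA
      have hcC := List.pairwise_cons.1 hC
      obtain ⟨F', h1, h2, h3⟩ := ih A C' (F ++ [c]) (by simp at hn; omega) hA hcC.2
        (by
          rw [List.pairwise_append]
          refine ⟨hF, by simp, fun f hf x hx => ?_⟩
          rw [List.mem_singleton] at hx
          exact hx ▸ hle f hf c (by simp))
        (by
          intro f hf x hx
          rcases List.mem_append.1 hf with hf | hf
          · refine hle f hf x ?_
            simp only [List.mem_append, List.mem_cons] at hx ⊢
            tauto
          · rw [List.mem_singleton] at hf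
            subst hf
            rcases List.mem_append.1 hx with hx | hx
            · exact hcA x hx
            · exact hcC.1 x hx)
      refine ⟨F', h1.trans (by simp), h2, fun P Q h hv => ?_⟩
      have hp : (P ++ A ++ v :: ((E ++ F) ++ v :: (c :: C' ++ Q))).Perm
          (P ++ A ++ v :: ((E ++ (F ++ [c])) ++ v :: (C' ++ Q))) := by
        refine (List.Perm.cons _ ?_).append_left _
        simp only [List.append_assoc, List.cons_append, List.nil_append]
        exact ((List.Perm.swap _ _ _).append_left _).append_left _
      have h3 := h3 P Q (h.perm hp)
        (by simp only [List.mem_append, List.mem_cons, List.not_mem_nil] at hv ⊢; tauto)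
      have h4 := czReach_takeRight (P := P ++ A) (X := E ++ F) (c := c) (Q := C' ++ Q) h
      rw [List.append_assoc E F [c]] at h4
      exact (h4.trans h3).mono (by omega)
    have hleft : ∀ a A', A = A' ++ [a] → (∀ x ∈ C, r a x) →
        ∃ F' : List V, F'.Perm (A ++ F ++ C) ∧ F'.Pairwise r ∧ ∀ P Q : List V,
          EvenWord (P ++ A ++ v :: ((E ++ F) ++ v :: (C ++ Q))) →
          v ∉ P ++ A ++ E ++ F ++ C ++ Q →
          CZReach (n + 1) (wordGraph (P ++ A ++ v :: ((E ++ F) ++ v :: (C ++ Q))))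
            (wordGraph (P ++ v :: ((E ++ F') ++ v :: Q))) := by
      rintro a A' rfl haC
      rw [List.reverse_append, List.reverse_singleton, List.singleton_append,
        List.pairwise_cons] at hA
      obtain ⟨F', h1, h2, h3⟩ := ih A' C (F ++ [a]) (by simp at hn; omega) hA.2 hC
        (by
          rw [List.pairwise_append]
          refine ⟨hF, by simp, fun f hf x hx => ?_⟩
          rw [List.mem_singleton] at hx
          exact hx ▸ hle f hf a (by simp))
        (by
          intro f hf x hx
          rcases List.mem_append.1 hf with hf | hf
          · refine hle f hf x ?_
            simp only [List.mem_append, List.mem_cons] at hx ⊢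
            tauto
          · rw [List.mem_singleton] at hf
            subst hf
            rcases List.mem_append.1 hx with hx | hx
            · exact hA.1 x (List.mem_reverse.2 hx)
            · exact haC x hx)
      refine ⟨F', h1.trans ?_, h2, fun P Q h hv => ?_⟩
      · simp only [List.append_assoc, List.singleton_append]
        exact (List.perm_middle.append_left _).trans (by simp)
      have hp : (P ++ (A' ++ [a]) ++ v :: ((E ++ F) ++ v :: (C ++ Q))).Perm
          (P ++ A' ++ v :: ((E ++ (F ++ [a])) ++ v :: (C ++ Q))) := by
        simp only [List.append_assoc, List.cons_append, List.nil_append]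
        refine (List.Perm.append_left _ ?_).append_left _
        refine (List.Perm.swap _ _ _).trans (List.Perm.cons _ ?_)
        rw [← List.append_assoc E, ← List.append_assoc E]
        exact List.perm_middle.symm
      have h3 := h3 P Q (h.perm hp)
        (by simp only [List.mem_append, List.mem_cons, List.not_mem_nil] at hv ⊢; tauto)
      have h4 := czReach_takeLeft (P := P ++ A') (X := E ++ F) (a := a) (Q := C ++ Q) (v := v)
        (by simpa using h)
        (by simp only [List.mem_append, List.mem_cons, List.not_mem_nil] at hv ⊢; tauto)
      have h5 := h4.trans (by simpa using h3)
      exact (by simpa using h5 : CZReach (1 + n) _ _).mono (by omega)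
    rcases List.eq_nil_or_concat' A with rfl | ⟨A', a, rfl⟩
    · cases C with
      | nil => simp at hn
      | cons c C' => exact hright c C' rfl (by simp)
    · cases C with
      | nil => exact hleft a A' rfl (by simp)
      | cons c C' =>
        rcases htot a c with hac | hca
        · exact hleft a A' rfl fun x hx => by
            rcases List.mem_cons.1 hx with rfl | hx
            · exact hac
            · exact htr _ _ _ hac ((List.pairwise_cons.1 hC).1 x hx)
        · refine hright c C' rfl fun x hx => ?_
          rw [List.reverse_append, List.reverse_singleton, List.singleton_append,
            List.pairwise_cons] at hA
          rcases List.mem_append.1 hx with hx | hx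
          · exact htr _ _ _ hca (hA.1 x (List.mem_reverse.2 hx))
          · rw [List.mem_singleton] at hx
            exact hx ▸ hca

/-- The contents rise along `E` and fall along `F`, so the least remaining letter is at one of the
two ends. It is emitted to the left, behind the letters `Z` that are already out; the empty
container is then erased. -/
theorem exists_emit {r : V → V → Prop} (htot : ∀ a b, r a b ∨ r b a)
    (htr : ∀ a b c, r a b → r b c → r a c) (n : ℕ) (E F Z : List V)
    (hn : E.length + F.length = n) (hE : E.Pairwise r) (hF : F.reverse.Pairwise r)
    (hZ : Z.Pairwise r) (hle : ∀ z ∈ Z, ∀ x ∈ E ++ F, r z x) :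
    ∃ Z' : List V, Z'.Perm (Z ++ E ++ F) ∧ Z'.Pairwise r ∧ ∀ P Q : List V,
      EvenWord (P ++ Z ++ v :: ((E ++ F) ++ v :: Q)) → v ∉ P ++ Z ++ E ++ F ++ Q →
      CZReach n (wordGraph (P ++ Z ++ v :: ((E ++ F) ++ v :: Q)))
        (wordGraph (P ++ Z' ++ Q)) := by
  induction n generalizing E F Z with
  | zero =>
    obtain rfl : E = [] := List.length_eq_zero_iff.1 (by omega)
    obtain rfl : F = [] := List.length_eq_zero_iff.1 (by omega)
    refine ⟨Z, by simp, hZ, fun P Q h hv => ?_⟩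
    simp only [List.append_nil, List.mem_append, not_or] at hv
    have h0 : EvenWord (P ++ Z ++ Q) := by
      intro u
      have := h u
      simp only [List.count_append, List.count_cons, Nat.even_iff, List.count_nil] at *
      omega
    rw [← wordGraph_insert_pair h0 (by simp [hv]) hv.2]
    exact .refl _ _
  | succ n ih =>
    have hfront : ∀ e E', E = e :: E' → (∀ x ∈ F, r e x) →
        ∃ Z' : List V, Z'.Perm (Z ++ E ++ F) ∧ Z'.Pairwise r ∧ ∀ P Q : List V,
          EvenWord (P ++ Z ++ v :: ((E ++ F) ++ v :: Q)) → v ∉ P ++ Z ++ E ++ F ++ Q →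
          CZReach (n + 1) (wordGraph (P ++ Z ++ v :: ((E ++ F) ++ v :: Q)))
            (wordGraph (P ++ Z' ++ Q)) := by
      rintro e E' rfl heF
      have heE := List.pairwise_cons.1 hE
      obtain ⟨Z', h1, h2, h3⟩ := ih E' F (Z ++ [e]) (by simp at hn; omega) heE.2 hF
        (by
          rw [List.pairwise_append]
          refine ⟨hZ, by simp, fun f hf x hx => ?_⟩
          rw [List.mem_singleton] at hx
          exact hx ▸ hle f hf e (by simp))
        (by
          intro f hf x hx
          rcases List.mem_append.1 hf with hf | hf
          · refine hle f hf x ?_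
            simp only [List.mem_append, List.mem_cons] at hx ⊢
            tauto
          · rw [List.mem_singleton] at hf
            subst hf
            rcases List.mem_append.1 hx with hx | hx
            · exact heE.1 x hx
            · exact heF x hx)
      refine ⟨Z', h1.trans (by simp), h2, fun P Q h hv => ?_⟩
      have hp : (P ++ Z ++ v :: ((e :: E' ++ F) ++ v :: Q)).Perm
          (P ++ (Z ++ [e]) ++ v :: ((E' ++ F) ++ v :: Q)) := by
        simp only [List.append_assoc, List.cons_append, List.nil_append]
        exact ((List.Perm.swap _ _ _).append_left _).append_left _
      have h3 := h3 P Q (h.perm hp)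
        (by simp only [List.mem_append, List.mem_cons, List.not_mem_nil] at hv ⊢; tauto)
      have h4 := czReach_emitFront (P := P ++ Z) (X := E' ++ F) (e := e) (Q := Q) (v := v) h
      rw [List.append_assoc P Z [e]] at h4
      exact (h4.trans h3).mono (by omega)
    have hback : ∀ f F', F = F' ++ [f] → (∀ x ∈ E, r f x) →
        ∃ Z' : List V, Z'.Perm (Z ++ E ++ F) ∧ Z'.Pairwise r ∧ ∀ P Q : List V,
          EvenWord (P ++ Z ++ v :: ((E ++ F) ++ v :: Q)) → v ∉ P ++ Z ++ E ++ F ++ Q →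
          CZReach (n + 1) (wordGraph (P ++ Z ++ v :: ((E ++ F) ++ v :: Q)))
            (wordGraph (P ++ Z' ++ Q)) := by
      rintro f F' rfl hfE
      rw [List.reverse_append, List.reverse_singleton, List.singleton_append,
        List.pairwise_cons] at hF
      obtain ⟨Z', h1, h2, h3⟩ := ih E F' (Z ++ [f]) (by simp at hn; omega) hE hF.2
        (by
          rw [List.pairwise_append]
          refine ⟨hZ, by simp, fun z hz x hx => ?_⟩
          rw [List.mem_singleton] at hx
          exact hx ▸ hle z hz f (by simp))
        (by
          intro z hz x hx
          rcases List.mem_append.1 hz with hz | hz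
          · refine hle z hz x ?_
            simp only [List.mem_append, List.mem_cons] at hx ⊢
            tauto
          · rw [List.mem_singleton] at hz
            subst hz
            rcases List.mem_append.1 hx with hx | hx
            · exact hfE x hx
            · exact hF.1 x (List.mem_reverse.2 hx))
      refine ⟨Z', h1.trans ?_, h2, fun P Q h hv => ?_⟩
      · simp only [List.append_assoc, List.singleton_append]
        refine List.Perm.append_left _ ?_
        rw [← List.append_assoc E]
        exact (List.perm_append_singleton _ _).symm
      have hp : (P ++ Z ++ v :: ((E ++ (F' ++ [f])) ++ v :: Q)).Perm
          (P ++ (Z ++ [f]) ++ v :: ((E ++ F') ++ v :: Q)) := by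
        simp only [List.append_assoc, List.cons_append, List.nil_append]
        refine (List.Perm.append_left _ ?_).append_left _
        refine List.Perm.trans (List.Perm.cons _ ?_) (List.Perm.swap _ _ _)
        rw [← List.append_assoc E, ← List.append_assoc E]
        exact List.perm_middle
      have h3 := h3 P Q (h.perm hp)
        (by simp only [List.mem_append, List.mem_cons, List.not_mem_nil] at hv ⊢; tauto)
      have h4 := czReach_emitBack (P := P ++ Z) (X := E ++ F') (f := f) (Q := Q) (v := v)
        (by simpa using h)
        (by simp only [List.mem_append, List.mem_cons, List.not_mem_nil] at hv ⊢; tauto)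
      have h5 := h4.trans (by simpa using h3)
      exact (by simpa using h5 : CZReach (1 + n) _ _).mono (by omega)
    cases E with
    | nil =>
      rcases List.eq_nil_or_concat' F with rfl | ⟨F', f, rfl⟩
      · simp at hn
      · exact hback f F' rfl (by simp)
    | cons e E' =>
      rcases List.eq_nil_or_concat' F with rfl | ⟨F', f, rfl⟩
      · exact hfront e E' rfl (by simp)
      · have hF' := hF
        rw [List.reverse_append, List.reverse_singleton, List.singleton_append,
          List.pairwise_cons] at hF'
        rcases htot e f with hef | hfe
        · refine hfront e E' rfl fun x hx => ?_
          rcases List.mem_append.1 hx with hx | hx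
          · exact htr _ _ _ hef (hF'.1 x (List.mem_reverse.2 hx))
          · rw [List.mem_singleton] at hx
            exact hx ▸ hef
        · exact hback f F' rfl fun x hx => by
            rcases List.mem_cons.1 hx with rfl | hx
            · exact hfe
            · exact htr _ _ _ hfe ((List.pairwise_cons.1 hE).1 x hx)

end Merging

/-! ### Rearranging segments in arbitrary context -/

section Segments

variable {V : Type*} {v : V}

/-- In every word that contains the segment `A`, but not the letter `v`, the segment can be
rearranged to `A'` at cost at most `k`, using the isolated vertex `v` as an aid. -/
def SegReach (v : V) (k : ℕ) (A A' : List V) : Prop :=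
  A.Perm A' ∧ ∀ P Q : List V, EvenWord (P ++ A ++ Q) → v ∉ P ++ A ++ Q →
    CZReach k (wordGraph (P ++ A ++ Q)) (wordGraph (P ++ A' ++ Q))

theorem SegReach.refl (v : V) (k : ℕ) (A : List V) : SegReach v k A A :=
  ⟨.refl _, fun _ _ _ _ => .refl _ _⟩

theorem SegReach.mono {k l : ℕ} {A B : List V} (h : SegReach v k A B) (hkl : k ≤ l) :
    SegReach v l A B :=
  ⟨h.1, fun P Q h1 h2 => (h.2 P Q h1 h2).mono hkl⟩

theorem SegReach.perm {k : ℕ} {A B : List V} (h : SegReach v k A B) (P Q : List V) :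
    (P ++ A ++ Q).Perm (P ++ B ++ Q) :=
  (h.1.append_left P).append_right Q

theorem SegReach.trans {k l : ℕ} {A B C : List V} (h : SegReach v k A B)
    (h' : SegReach v l B C) : SegReach v (k + l) A C :=
  ⟨h.1.trans h'.1, fun P Q h1 h2 => (h.2 P Q h1 h2).trans
    (h'.2 P Q (h1.perm (h.perm P Q)) fun hm => h2 ((h.perm P Q).mem_iff.2 hm))⟩

/-- Costs add up because rearrangements hold in every context. The same letter `v` serves all
segments, as it is absent before and after each use. -/
theorem SegReach.append {k l : ℕ} {A A' B B' : List V} (h : SegReach v k A A')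
    (h' : SegReach v l B B') : SegReach v (k + l) (A ++ B) (A' ++ B') := by
  refine ⟨h.1.append h'.1, fun P Q h1 h2 => ?_⟩
  have e1 : P ++ (A ++ B) ++ Q = P ++ A ++ (B ++ Q) := by simp
  have e2 : P ++ A' ++ (B ++ Q) = (P ++ A') ++ B ++ Q := by simp
  have e3 : P ++ (A' ++ B') ++ Q = (P ++ A') ++ B' ++ Q := by simp
  rw [e1] at h1 h2
  have hp := h.perm P (B ++ Q)
  rw [e1, e3]
  have h3 := h.2 P (B ++ Q) h1 h2
  have h4 : EvenWord (P ++ A' ++ (B ++ Q)) := h1.perm hp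
  have h5 : v ∉ P ++ A' ++ (B ++ Q) := fun hm => h2 (hp.mem_iff.2 hm)
  rw [e2] at h3 h4 h5
  exact h3.trans (h'.2 _ Q h4 h5)

theorem SegReach.reverse {k : ℕ} {A B : List V} (h : SegReach v k A B) :
    SegReach v k A.reverse B.reverse := by
  refine ⟨(List.reverse_perm A).trans (h.1.trans (List.reverse_perm B).symm), fun P Q h1 h2 => ?_⟩
  have e : ∀ A : List V, P ++ A.reverse ++ Q = (Q.reverse ++ A ++ P.reverse).reverse := by simp
  rw [e] at h1 h2
  rw [List.mem_reverse] at h2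
  have h3 : EvenWord (Q.reverse ++ A ++ P.reverse) := h1.perm (List.reverse_perm _)
  rw [e, e, wordGraph_reverse h3, wordGraph_reverse (h3.perm (h.perm _ _))]
  exact h.2 _ _ h3 h2

theorem SegReach.flatMap {ι : Type*} {c : ι → ℕ} {f g : ι → List V} {L : List ι}
    (h : ∀ i ∈ L, SegReach v (c i) (f i) (g i)) :
    SegReach v (L.map c).sum (L.flatMap f) (L.flatMap g) := by
  induction L with
  | nil => exact .refl _ _ _
  | cons i L ih =>
    simp only [List.map_cons, List.sum_cons, List.flatMap_cons]
    exact (h i (by simp)).append (ih fun j hj => h j (by simp [hj]))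

theorem SegReach.swap (v a b : V) (l : List V) : SegReach v 1 (a :: b :: l) (b :: a :: l) := by
  refine ⟨List.Perm.swap _ _ _, fun P Q h1 _ => ?_⟩
  simp only [List.append_assoc, List.cons_append] at h1 ⊢
  exact czReach_swap h1

theorem SegReach.cons {k : ℕ} {A B : List V} (h : SegReach v k A B) (a : V) :
    SegReach v k (a :: A) (a :: B) :=
  ((SegReach.refl v 0 [a]).append h).mono (by omega)

/-- The container starts between `B` and `C` and absorbs them in increasing order. Then `A` and `D`,
whose greatest letters are now adjacent to it, are absorbed behind in decreasing order, and
everything is emitted in increasing order. Each letter is moved in once and out once. -/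
theorem exists_merge_four {r : V → V → Prop} (htot : ∀ a b, r a b ∨ r b a)
    (htr : ∀ a b c, r a b → r b c → r a c) {A B C D : List V} (hA : A.Pairwise r)
    (hB : B.reverse.Pairwise r) (hC : C.Pairwise r) (hD : D.reverse.Pairwise r) :
    ∃ Z : List V, Z.Pairwise r ∧
      SegReach v (2 * (A ++ B ++ C ++ D).length) (A ++ B ++ C ++ D) Z := by
  obtain ⟨F₁, hp1, hs1, h1⟩ := exists_absorb (v := v) htot htr _ B C [] [] rfl hB hC (by simp)
    (by simp)
  obtain ⟨F₂, hp2, hs2, h2⟩ := exists_absorb (v := v) (r := flip r) (fun a b => htot b a)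
    (fun a b c h h' => htr c b a h' h) _ A D F₁ [] rfl (List.pairwise_reverse.2 hA)
    (List.pairwise_reverse.1 hD) (by simp) (by simp)
  obtain ⟨Z, hp3, hs3, h3⟩ := exists_emit (v := v) htot htr _ F₁ F₂ [] rfl hs1
    (List.pairwise_reverse.2 hs2) (by simp) (by simp)
  simp only [List.append_nil, List.nil_append] at h1 h2 h3 hp1 hp2 hp3
  have hp4 : (A ++ F₁ ++ D).Perm (A ++ B ++ C ++ D) := by
    rw [List.append_assoc A B C]
    exact (hp1.append_left A).append_right D
  have hp5 : (F₁ ++ F₂).Perm (A ++ B ++ C ++ D) :=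
    (hp2.append_left F₁).trans (List.perm_append_comm_assoc _ _ _ |>.trans (by simpa using hp4))
  have hpZ : Z.Perm (A ++ B ++ C ++ D) := hp3.trans hp5
  refine ⟨Z, hs3, hpZ.symm, fun P Q h hv => ?_⟩
  have hpair : ∀ l l' : List V, EvenWord (l ++ l') → EvenWord (l ++ v :: v :: l') := by
    intro l l' h u
    have := h u
    simp only [List.count_append, List.count_cons, Nat.even_iff] at *
    omega
  have hv' := hv
  simp only [List.mem_append, not_or] at hv'
  obtain ⟨⟨hvP, ⟨⟨hvA, hvB⟩, hvC⟩, hvD⟩, hvQ⟩ := hv'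
  have hvF1 : v ∉ F₁ := by simp [hp1.mem_iff, hvB, hvC]
  have hvF2 : v ∉ F₂ := by simp [hp2.mem_iff, hvA, hvD]
  have e0 : P ++ (A ++ B ++ C ++ D) ++ Q = (P ++ A ++ B) ++ (C ++ (D ++ Q)) := by simp
  rw [e0] at h
  have w0 := wordGraph_insert_pair (v := v) h (by simp [*]) (by simp [*])
  have k1 := h1 (P ++ A) (D ++ Q) (hpair _ _ h) (by simp [*])
  have w2 : EvenWord (P ++ A ++ v :: (F₁ ++ v :: (D ++ Q))) := by
    refine (hpair _ _ h).perm ?_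
    simp only [List.append_assoc]
    refine (List.Perm.append_left _ ?_).append_left _
    refine List.perm_middle.trans (List.Perm.cons _ ?_)
    refine List.Perm.trans ?_ List.perm_middle.symm
    refine List.perm_middle.trans (List.Perm.cons _ ?_)
    rw [← List.append_assoc]
    exact hp1.symm.append_right _
  have k2 := h2 P Q w2 (by simp [*])
  have w3 : EvenWord (P ++ v :: ((F₁ ++ F₂) ++ v :: Q)) := by
    refine w2.perm ?_
    simp only [List.append_assoc]
    refine List.Perm.append_left _ ?_
    refine List.perm_middle.trans (List.Perm.cons _ ?_)
    have : (A ++ (F₁ ++ (v :: (D ++ Q)))).Perm (v :: ((A ++ F₁ ++ D) ++ Q)) := by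
      simpa using (List.perm_middle (l₁ := A ++ F₁) (l₂ := D ++ Q) (a := v))
    refine this.trans (List.Perm.trans (List.Perm.cons _ ?_) (by
      simpa using (List.perm_middle (l₁ := F₁ ++ F₂) (l₂ := Q) (a := v)).symm))
    simpa using (hp4.trans hp5.symm).append_right Q
  have k3 := h3 P Q w3 (by simp [*])
  rw [e0, ← w0]
  refine ((k1.trans k2).trans k3).mono ?_
  have l1 := hp1.length_eq
  have l2 := hp2.length_eq
  simp only [List.length_append] at *
  omega

/-- The mirror image: reversing a whole word does not change its graph. -/
theorem exists_merge_four_reverse {r : V → V → Prop} (htot : ∀ a b, r a b ∨ r b a)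
    (htr : ∀ a b c, r a b → r b c → r a c) {A B C D : List V} (hA : A.Pairwise r)
    (hB : B.reverse.Pairwise r) (hC : C.Pairwise r) (hD : D.reverse.Pairwise r) :
    ∃ Z : List V, Z.reverse.Pairwise r ∧
      SegReach v (2 * (A ++ B ++ C ++ D).length) (A ++ B ++ C ++ D) Z := by
  obtain ⟨Z, hZ, h⟩ := exists_merge_four (v := v) htot htr (A := D.reverse) (B := C.reverse)
    (C := B.reverse) (D := A.reverse) hD (by simpa using hC) hB (by simpa using hA)
  exact ⟨Z.reverse, by simpa using hZ, (by simpa using h.reverse : SegReach v _ _ _).mono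
    (by simp; omega)⟩

open Classical in
/-- The number of pairs of positions of the list that are out of order. -/
noncomputable def invCount (r : V → V → Prop) : List V → ℕ
  | [] => 0
  | x :: l => l.countP (fun y => ¬ r x y) + invCount r l

open Classical in
theorem invCount_add_flip_le {r : V → V → Prop} (htot : ∀ a b, r a b ∨ r b a) (l : List V) :
    invCount r l + invCount (flip r) l ≤ l.length.choose 2 := by
  induction l with
  | nil => simp [invCount]
  | cons x l ih =>
    have key : ∀ l : List V, l.countP (fun y => ¬ r x y) + l.countP (fun y => ¬ flip r x y) ≤
        l.length := by
      intro l
      induction l with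
      | nil => simp
      | cons y l ih =>
        simp only [List.countP_cons, List.length_cons, flip, decide_eq_true_eq] at ih ⊢
        by_cases h1 : r x y <;> by_cases h2 : r y x <;>
          simp only [h1, h2, not_true_eq_false, not_false_eq_true, if_true, if_false,
            decide_true, decide_false, Bool.false_eq_true]
        · omega
        · omega
        · omega
        · exact absurd (htot x y) (by simp [h1, h2])
    have h1 := key l
    have h2 : (l.length + 1).choose 2 = l.length + l.length.choose 2 := by
      rw [Nat.choose_succ_succ' l.length 1, Nat.choose_one_right]
    simp only [invCount, List.length_cons, h2]
    omega

open Classical in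
theorem exists_insertion {r : V → V → Prop} (htot : ∀ a b, r a b ∨ r b a)
    (htr : ∀ a b c, r a b → r b c → r a c) (x : V) {l : List V} (hl : l.Pairwise r) :
    ∃ Z : List V, Z.Pairwise r ∧ SegReach v (l.countP fun y => ¬ r x y) (x :: l) Z := by
  induction l with
  | nil => exact ⟨[x], by simp, .refl _ _ _⟩
  | cons y l ih =>
    rw [List.pairwise_cons] at hl
    by_cases hxy : r x y
    · refine ⟨x :: y :: l, ?_, .refl _ _ _⟩
      simp only [List.pairwise_cons, List.mem_cons, forall_eq_or_imp]
      exact ⟨⟨hxy, fun z hz => htr _ _ _ hxy (hl.1 z hz)⟩, hl⟩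
    · obtain ⟨Z, hZ, h⟩ := ih hl.2
      refine ⟨y :: Z, ?_, ?_⟩
      · rw [List.pairwise_cons]
        refine ⟨fun z hz => ?_, hZ⟩
        rw [← h.1.mem_iff, List.mem_cons] at hz
        rcases hz with rfl | hz
        · exact (htot z y).resolve_left hxy
        · exact hl.1 z hz
      · refine ((SegReach.swap v x y l).trans (h.cons y)).mono ?_
        simp [hxy]
        omega

theorem exists_insertion_sort {r : V → V → Prop} (htot : ∀ a b, r a b ∨ r b a)
    (htr : ∀ a b c, r a b → r b c → r a c) (l : List V) :
    ∃ Z : List V, Z.Pairwise r ∧ SegReach v (invCount r l) l Z := by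
  classical
  induction l with
  | nil => exact ⟨[], by simp, .refl _ _ _⟩
  | cons x l ih =>
    obtain ⟨Z, hZ, h⟩ := ih
    obtain ⟨Z', hZ', h'⟩ := exists_insertion (v := v) htot htr x hZ
    refine ⟨Z', hZ', ((h.cons x).trans h').mono ?_⟩
    rw [← h.1.countP_eq, invCount]
    omega

end Segments

/-! ### Words divided into sorted blocks, and the removal of twins -/

section Blocks

open Classical

variable {V : Type*}

/-- The concatenation of the first `m` blocks. -/
def blockWord (m : ℕ) (W : ℕ → List V) : List V := (List.range m).flatMap W

/-- The blocks contain the letters of `S` only, each twice: once in block `α₁ v` and once in block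
`α₂ v`. -/
def BlockCount (α₁ α₂ : V → ℕ) (S : Finset V) (W : ℕ → List V) : Prop :=
  ∀ I v, (W I).count v =
    if v ∈ S then (if α₁ v = I then 1 else 0) + (if α₂ v = I then 1 else 0) else 0

theorem blockWord_succ (m : ℕ) (W : ℕ → List V) :
    blockWord (m + 1) W = blockWord m W ++ W m := by
  simp [blockWord, List.range_succ]

theorem blockWord_four_mul (m : ℕ) (W : ℕ → List V) :
    blockWord (4 * m) W =
      blockWord m fun J => W (4 * J) ++ W (4 * J + 1) ++ W (4 * J + 2) ++ W (4 * J + 3) := by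
  induction m with
  | zero => rfl
  | succ m ih =>
    rw [blockWord_succ, ← ih, show 4 * (m + 1) = 4 * m + 1 + 1 + 1 + 1 by ring]
    simp only [blockWord_succ, List.append_assoc]

theorem filter_blockWord (m : ℕ) (W : ℕ → List V) (p : V → Bool) :
    (blockWord m W).filter p = blockWord m fun J => (W J).filter p := by
  simp [blockWord, List.filter_flatMap]

theorem SegReach.blockWord {v : V} {m : ℕ} {c : ℕ → ℕ} {W Z : ℕ → List V}
    (h : ∀ J, SegReach v (c J) (W J) (Z J)) :
    SegReach v (((List.range m).map c).sum) (blockWord m W) (blockWord m Z) :=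
  SegReach.flatMap fun i _ => h i

theorem SegReach.czReach {v : V} {k : ℕ} {A B : List V} (h : SegReach v k A B)
    (hA : EvenWord A) (hv : v ∉ A) : CZReach k (wordGraph A) (wordGraph B) := by
  simpa using h.2 [] [] (by simpa using hA) (by simpa using hv)

section BlockCount

variable {α₁ α₂ : V → ℕ} {S : Finset V} {W : ℕ → List V}

theorem BlockCount.mem_iff (h : BlockCount α₁ α₂ S W) {I : ℕ} {v : V} :
    v ∈ W I ↔ v ∈ S ∧ (α₁ v = I ∨ α₂ v = I) := by
  rw [← List.count_pos_iff, h I v]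
  split_ifs <;> simp_all

theorem BlockCount.count_blockWord (h : BlockCount α₁ α₂ S W) (m : ℕ) (v : V) :
    (blockWord m W).count v =
      if v ∈ S then (if α₁ v < m then 1 else 0) + (if α₂ v < m then 1 else 0) else 0 := by
  induction m with
  | zero => simp [blockWord]
  | succ m ih =>
    rw [blockWord_succ, List.count_append, ih, h m v]
    split_ifs <;> omega

theorem BlockCount.evenWord (h : BlockCount α₁ α₂ S W) {m : ℕ}
    (hm : ∀ v ∈ S, α₁ v < m ∧ α₂ v < m) : EvenWord (blockWord m W) := by
  intro v
  rw [h.count_blockWord]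
  by_cases hv : v ∈ S
  · simp [hv, hm v hv]
  · simp [hv]

theorem BlockCount.length_blockWord (h : BlockCount α₁ α₂ S W) {m : ℕ}
    (hm : ∀ v ∈ S, α₁ v < m ∧ α₂ v < m) : (blockWord m W).length = 2 * S.card := by
  have h1 : ∀ v ∈ S, (blockWord m W).count v = 2 := fun v hv => by
    rw [h.count_blockWord]
    simp [hv, hm v hv]
  have h2 : (blockWord m W).toFinset = S := by
    ext v
    rw [List.mem_toFinset, ← List.count_pos_iff, h.count_blockWord]
    by_cases hv : v ∈ S
    · simp [hv, hm v hv]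
    · simp [hv]
  rw [← List.sum_toFinset_count_eq_length, h2, Finset.sum_congr rfl h1]
  simp [mul_comm]

theorem BlockCount.notMem_blockWord (h : BlockCount α₁ α₂ S W) {v : V} (hv : v ∉ S) (m : ℕ) :
    v ∉ blockWord m W := by
  rw [← List.count_eq_zero, h.count_blockWord, if_neg hv]

theorem BlockCount.filter (h : BlockCount α₁ α₂ S W) {T : Finset V} {p : V → Bool}
    (hp : ∀ v, v ∈ T ↔ v ∈ S ∧ p v = true) :
    BlockCount α₁ α₂ T fun J => (W J).filter p := by
  intro I v
  by_cases hv : p v = true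
  · rw [List.count_filter hv, h I v]
    simp [hp, hv]
  · rw [List.count_eq_zero_of_not_mem (by simp [hv]), if_neg (by simp [hp, hv])]

theorem BlockCount.regroup (h : BlockCount α₁ α₂ S W) {Z : ℕ → List V}
    (hZ : ∀ J, (W (4 * J) ++ W (4 * J + 1) ++ W (4 * J + 2) ++ W (4 * J + 3)).Perm (Z J)) :
    BlockCount (fun v => α₁ v / 4) (fun v => α₂ v / 4) S Z := by
  intro J v
  rw [← (hZ J).count_eq]
  simp only [List.count_append, h _ v]
  by_cases hv : v ∈ S
  · simp only [hv, if_true]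
    have : ∀ x : ℕ, (if x / 4 = J then 1 else 0) = (if x = 4 * J then 1 else 0) +
        (if x = 4 * J + 1 then 1 else 0) + (if x = 4 * J + 2 then 1 else 0) +
        (if x = 4 * J + 3 then 1 else 0) := by
      intro x
      split_ifs <;> omega
    rw [this, this]
    ring
  · simp [hv]

end BlockCount

section Sorted

variable {κ : Type*} [LinearOrder κ] {key : V → κ}

/-- The list is sorted by `key`, in increasing order if `d` is true, else in decreasing order. -/
def SortedDir (key : V → κ) (d : Bool) (l : List V) : Prop :=
  if d = true then l.Pairwise (fun u w => key u ≤ key w)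
  else l.reverse.Pairwise fun u w => key u ≤ key w

theorem SortedDir.filter {d : Bool} {l : List V} (h : SortedDir key d l) (p : V → Bool) :
    SortedDir key d (l.filter p) := by
  unfold SortedDir at *
  split_ifs at * with hd
  · exact List.Pairwise.filter p h
  · rw [← List.filter_reverse]
    exact List.Pairwise.filter p h

theorem SortedDir.imp {κ' : Type*} [LinearOrder κ'] {key' : V → κ'} {d : Bool} {l : List V}
    (h : SortedDir key d l) (hl : ∀ u ∈ l, ∀ w ∈ l, key u ≤ key w → key' u ≤ key' w) :
    SortedDir key' d l := by
  unfold SortedDir at *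
  split_ifs at * with hd
  · exact h.imp_of_mem fun hu hw => hl _ hu _ hw
  · exact h.imp_of_mem fun hu hw => hl _ (List.mem_reverse.1 hu) _ (List.mem_reverse.1 hw)

theorem pairCount_eq_zero_of_sorted {l : List V} (h : l.Pairwise fun u w => key u ≤ key w)
    {a c : V} (hac : key a < key c) : pairCount c a l = 0 := by
  induction l with
  | nil => rfl
  | cons x l ih =>
    rw [List.pairwise_cons] at h
    rw [pairCount_cons, ih h.2, add_zero]
    split_ifs with hx
    · subst hx
      exact List.count_eq_zero_of_not_mem fun ha => (h.1 a ha).not_gt hac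
    · rfl

/-- In a sorted list, letters whose keys are on the same side of the key of `c` stand on the same
side of all copies of `c`. -/
theorem pairCount_congr_of_sorted {l : List V} (h : l.Pairwise fun u w => key u ≤ key w)
    {a b c : V} (hcount : l.count a = l.count b)
    (hlt : (key a < key c ∧ key b < key c) ∨ (key c < key a ∧ key c < key b)) :
    pairCount a c l = pairCount b c l ∧ pairCount c a l = pairCount c b l := by
  have hne : ∀ x, key x ≠ key c → x ≠ c := fun x hx h => hx (h ▸ rfl)
  rcases hlt with ⟨h1, h2⟩ | ⟨h1, h2⟩
  · have e1 := pairCount_add_swap (hne a h1.ne) l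
    have e2 := pairCount_add_swap (hne b h2.ne) l
    rw [pairCount_eq_zero_of_sorted h h1] at e1 ⊢
    rw [pairCount_eq_zero_of_sorted h h2] at e2 ⊢
    rw [hcount] at e1
    exact ⟨by linarith, rfl⟩
  · have e1 := pairCount_add_swap (hne a h1.ne') l
    have e2 := pairCount_add_swap (hne b h2.ne') l
    rw [pairCount_eq_zero_of_sorted h h1] at e1 ⊢
    rw [pairCount_eq_zero_of_sorted h h2] at e2 ⊢
    rw [hcount] at e1
    exact ⟨rfl, by linarith⟩

theorem SortedDir.pairCount_congr {d : Bool} {l : List V} (h : SortedDir key d l)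
    {a b c : V} (hcount : l.count a = l.count b)
    (hlt : (key a < key c ∧ key b < key c) ∨ (key c < key a ∧ key c < key b)) :
    pairCount a c l = pairCount b c l := by
  unfold SortedDir at h
  split_ifs at h with hd
  · exact (pairCount_congr_of_sorted h hcount hlt).1
  · have := (pairCount_congr_of_sorted h (by simpa using hcount) hlt).2
    rwa [pairCount_reverse, pairCount_reverse] at this

/-- All copies of `a` lie on the same side of those of `c`. Hence a chord with both ends in one
sorted block interlaces nothing. -/
theorem SortedDir.even_pairCount {d : Bool} {l : List V} (h : SortedDir key d l)
    {a c : V} (hcount : Even (l.count a)) (hne : key a ≠ key c) : Even (pairCount a c l) := by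
  have hac : a ≠ c := fun h => hne (h ▸ rfl)
  have e := pairCount_add_swap hac l
  have key2 : pairCount a c l = 0 ∨ pairCount c a l = 0 := by
    unfold SortedDir at h
    split_ifs at h with hd
    · rcases hne.lt_or_gt with h1 | h1
      · exact .inr (pairCount_eq_zero_of_sorted h h1)
      · exact .inl (pairCount_eq_zero_of_sorted h h1)
    · rw [← pairCount_reverse a c, ← pairCount_reverse c a]
      rcases hne.lt_or_gt with h1 | h1
      · exact .inl (pairCount_eq_zero_of_sorted h h1)
      · exact .inr (pairCount_eq_zero_of_sorted h h1)
  rcases key2 with h1 | h1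
  · simp [h1]
  · rw [h1, add_zero] at e
    rw [e]
    exact hcount.mul_right _

theorem exists_merge_four_sortedDir {v : V} {d : Bool} {A B C D : List V}
    (hA : SortedDir key d A) (hB : SortedDir key (!d) B) (hC : SortedDir key d C)
    (hD : SortedDir key (!d) D) (d' : Bool) :
    ∃ Z : List V, SortedDir key d' Z ∧
      SegReach v (2 * (A ++ B ++ C ++ D).length) (A ++ B ++ C ++ D) Z := by
  have htot : ∀ a b, key a ≤ key b ∨ key b ≤ key a := fun a b => le_total _ _
  have htr : ∀ a b c, key a ≤ key b → key b ≤ key c → key a ≤ key c := fun a b c => le_trans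
  have htot' : ∀ a b, key b ≤ key a ∨ key a ≤ key b := fun a b => le_total _ _
  have htr' : ∀ a b c, key b ≤ key a → key c ≤ key b → key c ≤ key a :=
    fun a b c h h' => h'.trans h
  have hflip : ∀ l : List V, l.reverse.Pairwise (fun u w => key u ≤ key w) ↔
      l.Pairwise (fun u w => key w ≤ key u) := fun l => List.pairwise_reverse
  have hflip' : ∀ l : List V, l.reverse.Pairwise (fun u w => key w ≤ key u) ↔
      l.Pairwise (fun u w => key u ≤ key w) := fun l => List.pairwise_reverse
  cases d
  · simp only [SortedDir, Bool.not_false, if_true, if_false, Bool.false_eq_true] at hA hB hC hD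
    rw [hflip] at hA hC
    rw [← hflip'] at hB hD
    cases d'
    · obtain ⟨Z, h1, h2⟩ := exists_merge_four (v := v) htot' htr' hA hB hC hD
      exact ⟨Z, by simpa [SortedDir, List.pairwise_reverse] using h1, h2⟩
    · obtain ⟨Z, h1, h2⟩ := exists_merge_four_reverse (v := v) htot' htr' hA hB hC hD
      exact ⟨Z, by simpa [SortedDir, List.pairwise_reverse] using h1, h2⟩
  · simp only [SortedDir, Bool.not_true, if_true, if_false, Bool.false_eq_true] at hA hB hC hD
    cases d'
    · obtain ⟨Z, h1, h2⟩ := exists_merge_four_reverse (v := v) htot htr hA hB hC hD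
      exact ⟨Z, by simpa [SortedDir] using h1, h2⟩
    · obtain ⟨Z, h1, h2⟩ := exists_merge_four (v := v) htot htr hA hB hC hD
      exact ⟨Z, by simpa [SortedDir] using h1, h2⟩

end Sorted

theorem pairCount_blockWord_congr {m : ℕ} {W : ℕ → List V} {a b c : V}
    (h : ∀ J, (W J).count a = (W J).count b ∧ pairCount a c (W J) = pairCount b c (W J)) :
    pairCount a c (blockWord m W) = pairCount b c (blockWord m W) := by
  have hcount : (blockWord m W).count a = (blockWord m W).count b := by
    induction m with
    | zero => rfl
    | succ m ih => rw [blockWord_succ, List.count_append, List.count_append, ih, (h m).1]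
  induction m with
  | zero => rfl
  | succ m ih =>
    have h1 : (blockWord m W).count a = (blockWord m W).count b := by
      rw [blockWord_succ, List.count_append, List.count_append, (h m).1] at hcount
      omega
    rw [blockWord_succ, pairCount_append, pairCount_append, ih h1, (h m).2, h1]

theorem even_pairCount_blockWord {m : ℕ} {W : ℕ → List V} {a c : V}
    (h : ∀ J, Even ((W J).count a) ∧ Even (pairCount a c (W J))) :
    Even (pairCount a c (blockWord m W)) := by
  have : Even (pairCount a c (blockWord m W)) ∧ Even ((blockWord m W).count a) := by
    induction m with
    | zero => simp [blockWord, pairCount]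
    | succ m ih =>
      rw [blockWord_succ, pairCount_append, List.count_append]
      exact ⟨(ih.1.add (h m).2).add (ih.2.mul_right _), ih.2.add (h m).1⟩
  exact this.1

/-- `S'` holds the least chord of each class of chords joining the same two blocks. The other chords
are removed in increasing order of `key`: the next one, `b`, is then a twin of its representative,
as no remaining chord of a shared block has its key between theirs. -/
theorem czReach_filter_blockWord {κ : Type*} [LinearOrder κ] {key : V → κ} {β₁ β₂ : V → ℕ}
    {S S' : Finset V} {m : ℕ} (hm : ∀ v ∈ S, β₁ v < m ∧ β₂ v < m)
    (hle : ∀ v ∈ S, β₁ v ≤ β₂ v)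
    (hinj : ∀ u ∈ S, ∀ w ∈ S, key u = key w → u = w)
    (hkey : ∀ u ∈ S, ∀ w ∈ S, β₁ u + β₂ u < β₁ w + β₂ w → key u < key w)
    (huniq : ∀ u ∈ S', ∀ w ∈ S', β₁ u = β₁ w → β₂ u = β₂ w → u = w)
    (hrep : ∀ b ∈ S, b ∉ S' → β₁ b ≠ β₂ b → ∃ a ∈ S', β₁ a = β₁ b ∧ β₂ a = β₂ b ∧
      ∀ c ∈ S, β₁ c = β₁ b → β₂ c = β₂ b → key a ≤ key c)
    (dir : ℕ → Bool) {T : Finset V} (hT' : S' ⊆ T) (hT : T ⊆ S) {W : ℕ → List V}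
    (hW : BlockCount β₁ β₂ T W) (hs : ∀ J, SortedDir key (dir J) (W J)) :
    CZReach (T.card - S'.card) (wordGraph (blockWord m W))
      (wordGraph (blockWord m fun J => (W J).filter (· ∈ S'))) := by
  induction hn : T.card - S'.card generalizing T W with
  | zero =>
    obtain rfl : S' = T := Finset.eq_of_subset_of_card_le hT' (by omega)
    have : (fun J => (W J).filter (· ∈ S')) = W := by
      funext J
      rw [List.filter_eq_self]
      intro x hx
      simpa using (hW.mem_iff.1 hx).1
    rw [this]
    exact .refl _ _
  | succ n ih =>
    have hne : (T \ S').Nonempty := by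
      rw [Finset.sdiff_nonempty]
      intro hsub
      have := Finset.card_le_card hsub
      omega
    obtain ⟨b, hb, hbmin⟩ := Finset.exists_min_image (T \ S') key hne
    rw [Finset.mem_sdiff] at hb
    have heven : EvenWord (blockWord m W) := hW.evenWord fun v hv => hm v (hT hv)
    have hkne : ∀ u ∈ T, ∀ w ∈ T, u ≠ w → key u ≠ key w := fun u hu w hw huw h =>
      huw (hinj u (hT hu) w (hT hw) h)
    have step : CZReach 1 (wordGraph (blockWord m W)) (isolate (wordGraph (blockWord m W)) b) := by
      -- A chord inside one block is already isolated and needs no representative.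
      by_cases hbb : β₁ b = β₂ b
      · have hnadj : ∀ c, ¬ (wordGraph (blockWord m W)).Adj b c := by
          intro c hc
          rw [heven.wordGraph_adj, ← Nat.not_even_iff_odd] at hc
          refine hc.2 (even_pairCount_blockWord fun J => ?_)
          have h1 : Even ((W J).count b) := by
            rw [hW J b, if_pos hb.1, hbb]
            split_ifs <;> decide
          refine ⟨h1, ?_⟩
          by_cases hcT : c ∈ T
          · exact (hs J).even_pairCount h1 (hkne b hb.1 c hcT hc.1)
          · rw [pairCount_eq_zero_right fun h => hcT (hW.mem_iff.1 h).1]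
            exact Even.zero
        have : isolate (wordGraph (blockWord m W)) b = wordGraph (blockWord m W) := by
          ext x y
          rw [isolate_adj]
          refine ⟨fun h => h.1, fun h => ⟨h, ?_, ?_⟩⟩
          · rintro rfl
            exact hnadj _ h
          · rintro rfl
            exact hnadj _ h.symm
        rw [this]
        exact .refl _ _
      · obtain ⟨a, ha, ha1, ha2, hamin⟩ := hrep b (hT hb.1) hb.2 hbb
        have hab : a ≠ b := fun h => hb.2 (h ▸ ha)
        refine czReach_isolate_of_twins hab fun c hca hcb => ?_
        rw [heven.wordGraph_adj, heven.wordGraph_adj]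
        suffices h : pairCount a c (blockWord m W) = pairCount b c (blockWord m W) by
          rw [h]
          simp [hca.symm, hcb.symm]
        refine pairCount_blockWord_congr fun J => ?_
        have hcount : (W J).count a = (W J).count b := by
          rw [hW J a, hW J b, if_pos (hT' ha), if_pos hb.1, ha1, ha2]
        refine ⟨hcount, ?_⟩
        by_cases hcJ : c ∈ W J
        swap
        · rw [pairCount_eq_zero_right hcJ, pairCount_eq_zero_right hcJ]
        by_cases haJ : a ∈ W J
        swap
        · have hbJ : b ∉ W J := by
            rwa [← List.count_eq_zero, ← hcount, List.count_eq_zero]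
          rw [pairCount_eq_zero_left haJ, pairCount_eq_zero_left hbJ]
        refine (hs J).pairCount_congr hcount ?_
        obtain ⟨hcT, hcJ⟩ := hW.mem_iff.1 hcJ
        obtain ⟨haT, haJ⟩ := hW.mem_iff.1 haJ
        have hlec := hle c (hT hcT)
        have hlea := hle a (hT haT)
        -- Chords that share a block and have the same sum of endpoints join the same two blocks. So
        -- in the middle case `c` belongs to the class of `a` and `b`, and both precede it by the
        -- choices of `a` and `b`.
        rcases lt_trichotomy (β₁ c + β₂ c) (β₁ a + β₂ a) with h | h | h
        · exact .inr ⟨hkey c (hT hcT) a (hT haT) h,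
            hkey c (hT hcT) b (hT hb.1) (by rwa [← ha1, ← ha2])⟩
        · have h1 : β₁ c = β₁ a ∧ β₂ c = β₂ a := by omega
          refine .inl ⟨lt_of_le_of_ne
            (hamin c (hT hcT) (h1.1.trans ha1) (h1.2.trans ha2)) (hkne a haT c hcT hca.symm),
            lt_of_le_of_ne (hbmin c ?_) (hkne b hb.1 c hcT hcb.symm)⟩
          rw [Finset.mem_sdiff]
          exact ⟨hcT, fun hc => hca (huniq c hc a ha h1.1 h1.2)⟩
        · exact .inl ⟨hkey a (hT haT) c (hT hcT) h,
            hkey b (hT hb.1) c (hT hcT) (by rwa [← ha1, ← ha2])⟩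
    rw [← wordGraph_filter_ne heven b, filter_blockWord] at step
    have hcard := Finset.card_erase_of_mem hb.1
    have h2 := ih (T := T.erase b) (W := fun J => (W J).filter fun x => x ≠ b)
      (fun x hx => Finset.mem_erase.2 ⟨fun h => hb.2 (h ▸ hx), hT' hx⟩)
      ((Finset.erase_subset _ _).trans hT)
      (hW.filter fun x => by simp [and_comm]) (fun J => (hs J).filter _) (by omega)
    have h3 : (fun J => ((W J).filter fun x => x ≠ b).filter (· ∈ S')) =
        fun J => (W J).filter (· ∈ S') := by
      funext J
      rw [List.filter_filter]
      refine List.filter_congr fun x _ => ?_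
      by_cases hx : x ∈ S'
      · have : x ≠ b := fun h => hb.2 (h ▸ hx)
        simp [hx, this]
      · simp [hx]
    rw [h3] at h2
    exact (step.trans h2).mono (by omega)

end Blocks

/-! ### From one block length to the next -/

section Stages

open Classical

variable {V : Type*}

/-- Chords are compared by the sum of the coarse endpoints, then by the fine endpoints. -/
def lexKey (α₁ α₂ : V → ℕ) (v : V) : ℕ ×ₗ ℕ ×ₗ ℕ :=
  toLex (α₁ v / 4 + α₂ v / 4, toLex (α₁ v, α₂ v))

theorem lexKey_le {α₁ α₂ : V → ℕ} {u w : V} :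
    lexKey α₁ α₂ u ≤ lexKey α₁ α₂ w ↔
      α₁ u / 4 + α₂ u / 4 < α₁ w / 4 + α₂ w / 4 ∨
        (α₁ u / 4 + α₂ u / 4 = α₁ w / 4 + α₂ w / 4 ∧
          (α₁ u < α₁ w ∨ (α₁ u = α₁ w ∧ α₂ u ≤ α₂ w))) := by
  simp [lexKey, Prod.Lex.toLex_le_toLex]

theorem exists_collapse {α₁ α₂ : V → ℕ} {S : Finset V} {Z : ℕ → List V} {m : ℕ} {dir : ℕ → Bool}
    (hle : ∀ v ∈ S, α₁ v ≤ α₂ v)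
    (hinj : ∀ u ∈ S, ∀ w ∈ S, α₁ u = α₁ w → α₂ u = α₂ w → u = w)
    (hm : ∀ v ∈ S, α₁ v / 4 < m ∧ α₂ v / 4 < m)
    (hZ : BlockCount (fun v => α₁ v / 4) (fun v => α₂ v / 4) S Z)
    (hs : ∀ J, SortedDir (lexKey α₁ α₂) (dir J) (Z J)) :
    ∃ S' ⊆ S, ∃ W : ℕ → List V,
      BlockCount (fun v => α₁ v / 4) (fun v => α₂ v / 4) S' W ∧
      (∀ v ∈ S', α₁ v / 4 ≠ α₂ v / 4) ∧
      (∀ u ∈ S', ∀ w ∈ S', α₁ u / 4 = α₁ w / 4 → α₂ u / 4 = α₂ w / 4 → u = w) ∧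
      (∀ J, SortedDir (fun v => α₁ v / 4 + α₂ v / 4) (dir J) (W J)) ∧
      CZReach (S.card - S'.card) (wordGraph (blockWord m Z)) (wordGraph (blockWord m W)) := by
  have hkinj : ∀ u ∈ S, ∀ w ∈ S, lexKey α₁ α₂ u = lexKey α₁ α₂ w → u = w := by
    intro u hu w hw h
    have h1 := lexKey_le.1 h.le
    have h2 := lexKey_le.1 h.ge
    exact hinj u hu w hw (by omega) (by omega)
  -- One representative, the least, of every class of chords between two distinct coarse blocks.
  set S' := S.filter fun v => α₁ v / 4 ≠ α₂ v / 4 ∧ ∀ w ∈ S, α₁ w / 4 = α₁ v / 4 →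
    α₂ w / 4 = α₂ v / 4 → lexKey α₁ α₂ v ≤ lexKey α₁ α₂ w with hS'
  have hsub : S' ⊆ S := Finset.filter_subset _ _
  have huniq : ∀ u ∈ S', ∀ w ∈ S', α₁ u / 4 = α₁ w / 4 → α₂ u / 4 = α₂ w / 4 → u = w := by
    intro u hu w hw h1 h2
    rw [hS', Finset.mem_filter] at hu hw
    exact hkinj u hu.1 w hw.1
      (le_antisymm (hu.2.2 w hw.1 h1.symm h2.symm) (hw.2.2 u hu.1 h1 h2))
  refine ⟨S', hsub, fun J => (Z J).filter (· ∈ S'), hZ.filter fun v => ?_, ?_, huniq, ?_, ?_⟩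
  · simpa using fun hv => hsub hv
  · intro v hv
    rw [hS', Finset.mem_filter] at hv
    exact hv.2.1
  · intro J
    refine ((hs J).imp fun u _ w _ h => ?_).filter _
    have := lexKey_le.1 h
    omega
  · refine czReach_filter_blockWord hm ?_ hkinj ?_ huniq ?_ dir hsub le_rfl hZ hs
    · exact fun v hv => Nat.div_le_div_right (hle v hv)
    · intro u _ w _ h
      rw [← not_le, lexKey_le]
      omega
    · intro b hb _ hne
      obtain ⟨a, ha, hmin⟩ := Finset.exists_min_image
        (S.filter fun c => α₁ c / 4 = α₁ b / 4 ∧ α₂ c / 4 = α₂ b / 4) (lexKey α₁ α₂)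
        ⟨b, by simp [hb]⟩
      rw [Finset.mem_filter] at ha
      refine ⟨a, ?_, ha.2.1, ha.2.2, fun c hc h1 h2 => hmin c (by simp [hc, h1, h2])⟩
      rw [hS', Finset.mem_filter]
      refine ⟨ha.1, by rwa [ha.2.1, ha.2.2], fun c hc h1 h2 => hmin c ?_⟩
      simp [hc, h1, h2, ha.2.1, ha.2.2]

/-- The word that the algorithm has reached when the circle is divided into blocks of length
`4 ^ j`. -/
structure Stage (a b : V → ℕ) (j : ℕ) (S : Finset V) (W : ℕ → List V) : Prop where
  count : BlockCount (fun v => a v / 4 ^ j) (fun v => b v / 4 ^ j) S W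
  ne : ∀ v ∈ S, a v / 4 ^ j ≠ b v / 4 ^ j
  inj : ∀ u ∈ S, ∀ w ∈ S, a u / 4 ^ j = a w / 4 ^ j → b u / 4 ^ j = b w / 4 ^ j → u = w
  sorted : ∃ δ : Bool, ∀ I, SortedDir (fun v => a v / 4 ^ j + b v / 4 ^ j) (xor δ I.bodd) (W I)

variable {a b : V → ℕ} {S : Finset V} {W : ℕ → List V} {v₀ : V}

/-- The blocks hold `2 * S.card` letters altogether and merging costs 2 per letter, hence `4 *
S.card`; the remaining term pays for deleted twins. -/
theorem Stage.exists_next {j m : ℕ} (h : Stage a b j S W) (hab : ∀ v, a v ≤ b v)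
    (hm : ∀ v, b v < 4 ^ (j + 1) * m) (hv₀ : v₀ ∉ S) :
    ∃ S' ⊆ S, ∃ W' : ℕ → List V, Stage a b (j + 1) S' W' ∧
      CZReach (4 * S.card + (S.card - S'.card)) (wordGraph (blockWord (4 * m) W))
        (wordGraph (blockWord m W')) := by
  obtain ⟨δ, hδ⟩ := h.sorted
  have hdiv : ∀ x, x / 4 ^ j / 4 = x / 4 ^ (j + 1) := fun x => by
    rw [Nat.div_div_eq_div_mul, pow_succ]
  have hbm : ∀ v, b v / 4 ^ j / 4 < m := fun v => by
    rw [hdiv]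
    exact Nat.div_lt_of_lt_mul (hm v)
  have hle : ∀ v, a v / 4 ^ j ≤ b v / 4 ^ j := fun v => Nat.div_le_div_right (hab v)
  have ham : ∀ v, a v / 4 ^ j / 4 < m := fun v => (Nat.div_le_div_right (hle v)).trans_lt (hbm v)
  have hlex : ∀ I, SortedDir (lexKey (fun v => a v / 4 ^ j) fun v => b v / 4 ^ j)
      (xor δ I.bodd) (W I) := by
    -- All chords in block `I` have `I` as an endpoint, so comparing sums amounts to comparing the
    -- other endpoints. This order is compatible with the key of the next level, and no re-sorting
    -- is needed before the merge.
    refine fun I => (hδ I).imp fun u hu w hw huw => ?_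
    rw [lexKey_le]
    have h1 := (h.count.mem_iff.1 hu).2
    have h2 := (h.count.mem_iff.1 hw).2
    have h3 := hle u
    have h4 := hle w
    beta_reduce at h1 h2 huw
    generalize a u / 4 ^ j = x at *
    generalize b u / 4 ^ j = y at *
    generalize a w / 4 ^ j = z at *
    generalize b w / 4 ^ j = t at *
    omega
  have hmerge : ∀ J, ∃ Z : List V, SortedDir (lexKey (fun v => a v / 4 ^ j) fun v => b v / 4 ^ j)
      (xor δ J.bodd) Z ∧
      SegReach v₀ (2 * (W (4 * J) ++ W (4 * J + 1) ++ W (4 * J + 2) ++ W (4 * J + 3)).length)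
        (W (4 * J) ++ W (4 * J + 1) ++ W (4 * J + 2) ++ W (4 * J + 3)) Z := by
    intro J
    have e0 := hlex (4 * J)
    have e1 := hlex (4 * J + 1)
    have e2 := hlex (4 * J + 2)
    have e3 := hlex (4 * J + 3)
    have b4 : Nat.bodd 4 = false := rfl
    have b3 : Nat.bodd 3 = true := rfl
    -- Directions alternate with the parity of the block number, so any four merged blocks start
    -- with direction `δ` and alternate. The output direction is free and is chosen to alternate
    -- again.
    simp only [Nat.bodd_add, Nat.bodd_mul, b4, b3, Nat.bodd_one, Nat.bodd_two, Bool.false_and,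
      Bool.xor_false, Bool.xor_true, Bool.not_false] at e0 e1 e2 e3
    exact exists_merge_four_sortedDir e0 e1 e2 e3 _
  choose Z hZs hZ using hmerge
  have hcount := h.count.regroup (Z := Z) fun J => (hZ J).1
  obtain ⟨S', hsub, W', h1, h2, h3, h4, h5⟩ := exists_collapse (m := m)
    (dir := fun J => xor δ J.bodd) (fun v _ => hle v) h.inj (fun v _ => ⟨ham v, hbm v⟩) hcount hZs
  simp only [hdiv] at h1 h2 h3 h4
  refine ⟨S', hsub, W', ⟨h1, h2, h3, δ, h4⟩, ?_⟩
  have hbound : ∀ v ∈ S, a v / 4 ^ j < 4 * m ∧ b v / 4 ^ j < 4 * m := by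
    intro v _
    have := ham v
    have := hbm v
    omega
  refine CZReach.trans ?_ h5
  have hlen := h.count.length_blockWord hbound
  have h6 := (SegReach.blockWord (m := m) hZ).czReach
    (by rw [← blockWord_four_mul]; exact h.count.evenWord hbound)
    (by rw [← blockWord_four_mul]; exact h.count.notMem_blockWord hv₀ _)
  rw [← blockWord_four_mul] at h6
  refine h6.mono ?_
  rw [blockWord_four_mul, blockWord, List.length_flatMap] at hlen
  rw [List.sum_map_mul_left, hlen]
  omega

theorem exists_sort_sortedDir {κ : Type*} [LinearOrder κ] (key : V → κ) (d : Bool) (l : List V) :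
    ∃ Z : List V, SortedDir key d Z ∧
      SegReach v₀ (if d = true then invCount (fun u w => key u ≤ key w) l
        else invCount (flip fun u w => key u ≤ key w) l) l Z := by
  cases d
  · obtain ⟨Z, h1, h2⟩ := exists_insertion_sort (v := v₀) (r := flip fun u w => key u ≤ key w)
      (fun a b => le_total _ _) (fun a b c h h' => le_trans (α := κ) h' h) l
    refine ⟨Z, ?_, by simpa using h2⟩
    simp only [SortedDir, Bool.false_eq_true, if_false, List.pairwise_reverse]
    exact h1
  · obtain ⟨Z, h1, h2⟩ := exists_insertion_sort (v := v₀) (r := fun u w => key u ≤ key w)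
      (fun a b => le_total _ _) (fun a b c h h' => h.trans h') l
    exact ⟨Z, by simpa [SortedDir] using h1, by simpa using h2⟩

/-- Blocks of at most four letters are sorted by adjacent swaps. Sorting a block in either direction
costs at most `s.choose 2 ≤ 3 * s / 2` in total for `s ≤ 4` letters, so the better of the two
alternating patterns costs at most `3 / 2` per chord. -/
theorem exists_first_stage {m : ℕ} (hcount : BlockCount a b S W) (hlen : ∀ I, (W I).length ≤ 1)
    (hab : ∀ v, a v ≤ b v) (hinj : ∀ u w, a u = a w → u = w)
    (hm : ∀ v, b v < 4 * m) (hv₀ : v₀ ∉ S) :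
    ∃ S' ⊆ S, ∃ W' : ℕ → List V, ∃ c : ℕ, 2 * c ≤ 3 * S.card ∧ Stage a b 1 S' W' ∧
      CZReach (c + (S.card - S'.card)) (wordGraph (blockWord (4 * m) W))
        (wordGraph (blockWord m W')) := by
  set U : ℕ → List V := fun J =>
    W (4 * J) ++ W (4 * J + 1) ++ W (4 * J + 2) ++ W (4 * J + 3) with hU
  set r : V → V → Prop := fun u w => lexKey a b u ≤ lexKey a b w with hr
  set c : Bool → ℕ := fun δ => ((List.range m).map fun J =>
    if xor δ J.bodd = true then invCount r (U J) else invCount (flip r) (U J)).sum with hc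
  have hbm : ∀ v ∈ S, a v < 4 * m ∧ b v < 4 * m := fun v _ => ⟨(hab v).trans_lt (hm v), hm v⟩
  have hword : blockWord (4 * m) W = blockWord m U := blockWord_four_mul m W
  have htotal : ((List.range m).map fun J => (U J).length).sum = 2 * S.card := by
    rw [← hcount.length_blockWord hbm, hword, blockWord, List.length_flatMap]
  have hcc : 2 * (c true + c false) ≤ 3 * (2 * S.card) := by
    rw [← htotal, hc, ← List.sum_map_add, ← List.sum_map_mul_left, ← List.sum_map_mul_left]
    refine List.sum_le_sum fun J _ => ?_
    have h1 := invCount_add_flip_le (r := r) (fun u w => le_total _ _) (U J)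
    have h2 : (U J).length ≤ 4 := by
      have e0 := hlen (4 * J)
      have e1 := hlen (4 * J + 1)
      have e2 := hlen (4 * J + 2)
      have e3 := hlen (4 * J + 3)
      simp only [hU, List.length_append]
      omega
    have h3 : 2 * (U J).length.choose 2 ≤ 3 * (U J).length := by
      generalize (U J).length = s at h2
      interval_cases s <;> decide
    cases J.bodd <;> simp <;> omega
  -- The two patterns give opposite directions in every block, so one of them is at most average.
  obtain ⟨δ, hδ⟩ : ∃ δ, 2 * c δ ≤ 3 * S.card := by
    by_contra hcon
    push Not at hcon
    have h1 := hcon true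
    have h2 := hcon false
    omega
  have hsort := fun J : ℕ => exists_sort_sortedDir (v₀ := v₀) (lexKey a b) (xor δ J.bodd) (U J)
  choose Z hZs hZ using hsort
  obtain ⟨S', hsub, W', h1, h2, h3, h4, h5⟩ := exists_collapse (m := m)
    (dir := fun J => xor δ J.bodd) (fun v _ => hab v) (fun u _ w _ h _ => hinj u w h)
    (fun v hv => by have := hbm v hv; omega)
    (hcount.regroup (Z := Z) fun J => (hZ J).1) hZs
  refine ⟨S', hsub, W', c δ, hδ, ⟨by simpa using h1, by simpa using h2, by simpa using h3, δ,
    by simpa using h4⟩, CZReach.trans ?_ h5⟩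
  have h6 := (SegReach.blockWord (m := m) hZ).czReach
    (by rw [← hword]; exact hcount.evenWord hbm)
    (by rw [← hword]; exact hcount.notMem_blockWord hv₀ _)
  rwa [← hword] at h6

end Stages

/-! ### Chord models, the clique bound at each stage, and the total cost -/

section ChordModel

open Classical

variable {V : Type*}

/-- The `2n` endpoints of the chords are numbered along the circle, the chord of `v` having the
numbers `a v < b v`, and vertices are adjacent if and only if their chords interlace. -/
structure ChordModel (G : SimpleGraph V) (N : ℕ) (a b : V → ℕ) : Prop where
  lt : ∀ v, a v < b v
  lt_bound : ∀ v, b v < N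
  left_inj : ∀ u w, a u = a w → u = w
  right_inj : ∀ u w, b u = b w → u = w
  ne : ∀ u w, a u ≠ b w
  adj : ∀ u w, u ≠ w → (G.Adj u w ↔
    (a u < a w ∧ a w < b u ∧ b u < b w) ∨ (a w < a u ∧ a u < b w ∧ b w < b u))

variable {G : SimpleGraph V} {N : ℕ} {a b : V → ℕ} {S : Finset V} {W : ℕ → List V}

theorem pairCount_blockWord_of_length_le_one (hW : BlockCount a b S W)
    (hlen : ∀ I, (W I).length ≤ 1) {u w : V} (hu : u ∈ S) (hw : w ∈ S) (m : ℕ) :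
    pairCount u w (blockWord m W) =
      (if a w < m then (if a u < a w then 1 else 0) + (if b u < a w then 1 else 0) else 0) +
      (if b w < m then (if a u < b w then 1 else 0) + (if b u < b w then 1 else 0) else 0) := by
  have hzero : ∀ I, pairCount u w (W I) = 0 := by
    intro I
    have h := hlen I
    cases hI : W I with
    | nil => rfl
    | cons x l =>
      rw [hI, List.length_cons] at h
      obtain rfl : l = [] := List.length_eq_zero_iff.1 (by omega)
      simp [pairCount]
  induction m with
  | zero => simp [blockWord, pairCount]
  | succ m ih =>
    rw [blockWord_succ, pairCount_append, ih, hzero, hW.count_blockWord, hW m w, if_pos hu,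
      if_pos hw]
    by_cases h1 : a w = m <;> by_cases h2 : b w = m
    · simp [h1, h2]
      ring
    · have h3 : b w < m + 1 ↔ b w < m := by omega
      simp only [h1, h2, h3, lt_irrefl, Nat.lt_succ_self, if_true, if_false]
      ring
    · have h3 : a w < m + 1 ↔ a w < m := by omega
      simp only [h1, h2, h3, lt_irrefl, Nat.lt_succ_self, if_true, if_false]
      ring
    · have h3 : a w < m + 1 ↔ a w < m := by omega
      have h4 : b w < m + 1 ↔ b w < m := by omega
      simp [h1, h2, h3, h4]

theorem ChordModel.wordGraph_blockWord [Fintype V] (h : ChordModel G N a b)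
    (hW : BlockCount a b Finset.univ W) (hlen : ∀ I, (W I).length ≤ 1) {m : ℕ} (hm : N ≤ m) :
    wordGraph (blockWord m W) = G := by
  have hbm : ∀ v, b v < m := fun v => (h.lt_bound v).trans_le hm
  have ham : ∀ v, a v < m := fun v => (h.lt v).trans (hbm v)
  ext u w
  rw [(hW.evenWord fun v _ => ⟨ham v, hbm v⟩).wordGraph_adj]
  by_cases huw : u = w
  · simp [huw]
  rw [pairCount_blockWord_of_length_le_one hW hlen (Finset.mem_univ u) (Finset.mem_univ w),
    if_pos (ham w), if_pos (hbm w), h.adj u w huw]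
  have h1 := h.lt u
  have h2 := h.lt w
  have h3 := h.ne u w
  have h4 := h.ne w u
  have h5 : a u ≠ a w := fun e => huw (h.left_inj u w e)
  have h6 : b u ≠ b w := fun e => huw (h.right_inj u w e)
  simp only [ne_eq, huw, not_false_eq_true, true_and, Nat.odd_iff]
  split_ifs <;> simp <;> omega

theorem ChordModel.exists_blocks [Fintype V] (h : ChordModel G N a b) :
    ∃ W : ℕ → List V, BlockCount a b Finset.univ W ∧ ∀ I, (W I).length ≤ 1 := by
  refine ⟨fun I => (Finset.univ.filter fun v => a v = I ∨ b v = I).toList, ?_, ?_⟩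
  · intro I v
    rw [(Finset.nodup_toList _).count]
    have := (h.lt v).ne
    simp only [Finset.mem_toList, Finset.mem_filter, Finset.mem_univ, true_and, if_true]
    split_ifs <;> first | rfl | omega
  · intro I
    rw [Finset.length_toList, Finset.card_le_one]
    intro u hu w hw
    simp only [Finset.mem_filter, Finset.mem_univ, true_and] at hu hw
    have h1 := h.ne u w
    have h2 := h.ne w u
    have h3 := h.left_inj u w
    have h4 := h.right_inj u w
    rcases hu with hu | hu <;> rcases hw with hw | hw
    · exact h3 (by omega)
    · omega
    · omega
    · exact h4 (by omega)

/-- Chords that cross strictly at block level also cross in the original model, so a crossing family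
is a clique of `G` itself, however much the graph of the current word has changed. The polygon has
`(N - 1) / 4 ^ j + 1` vertices, to which Capoyleas–Pach applies. -/
theorem Stage.card_mul_le [Finite V] {ω j : ℕ} (hs : Stage a b j S W) (h : ChordModel G N a b)
    (hω : G.cliqueNum ≤ ω) : S.card * 4 ^ j ≤ 2 * ω * N := by
  set f : V → ℕ × ℕ := fun v => (a v / 4 ^ j, b v / 4 ^ j) with hf
  have hle : ∀ v, a v / 4 ^ j ≤ b v / 4 ^ j := fun v => Nat.div_le_div_right (h.lt v).le
  have hdiv : ∀ x y, x / 4 ^ j < y / 4 ^ j → x < y := fun x y hxy => by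
    by_contra hc
    exact absurd (Nat.div_le_div_right (c := 4 ^ j) (not_lt.1 hc)) (not_le.2 hxy)
  have hfinj : Set.InjOn f S := fun u hu w hw huw => by
    rw [hf, Prod.mk.injEq] at huw
    exact hs.inj u hu w hw huw.1 huw.2
  have hcb : CrossBounded ω ((N - 1) / 4 ^ j + 1) (S.image f) := by
    refine ⟨fun e he => ?_, fun T hT hcross => ?_⟩
    · obtain ⟨v, hv, rfl⟩ := Finset.mem_image.1 he
      have h1 := h.lt_bound v
      exact ⟨lt_of_le_of_ne (hle v) (hs.ne v hv),
        Nat.lt_succ_of_le (Nat.div_le_div_right (by omega))⟩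
    · set R := S.filter fun v => f v ∈ T with hR
      have hTR : T = R.image f := by
        ext e
        rw [Finset.mem_image]
        constructor
        · intro he
          obtain ⟨v, hv, rfl⟩ := Finset.mem_image.1 (hT he)
          exact ⟨v, Finset.mem_filter.2 ⟨hv, he⟩, rfl⟩
        · rintro ⟨v, hv, rfl⟩
          exact (Finset.mem_filter.1 hv).2
      have hcard : T.card = R.card := by
        rw [hTR, Finset.card_image_of_injOn]
        exact hfinj.mono fun v hv => (Finset.mem_filter.1 hv).1
      rw [hcard]
      refine le_trans (SimpleGraph.IsClique.card_le_cliqueNum (tc := ?_)) hω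
      intro u hu w hw huw
      rw [Finset.mem_coe, hR, Finset.mem_filter] at hu hw
      have hne : f u ≠ f w := fun e => huw (hfinj hu.1 hw.1 e)
      rw [h.adj u w huw]
      rcases hcross hu.2 hw.2 hne with ⟨h1, h2, h3⟩ | ⟨h1, h2, h3⟩
      · exact .inl ⟨hdiv _ _ h1, hdiv _ _ h2, hdiv _ _ h3⟩
      · exact .inr ⟨hdiv _ _ h1, hdiv _ _ h2, hdiv _ _ h3⟩
  have h1 := hcb.card_le_two_mul
  rw [Finset.card_image_of_injOn hfinj, Nat.add_sub_cancel] at h1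
  calc S.card * 4 ^ j ≤ 2 * ω * ((N - 1) / 4 ^ j) * 4 ^ j := Nat.mul_le_mul_right _ h1
    _ = 2 * ω * ((N - 1) / 4 ^ j * 4 ^ j) := by ring
    _ ≤ 2 * ω * N := Nat.mul_le_mul_left _ ((Nat.div_mul_le_self _ _).trans (Nat.sub_le _ _))

/-- The term `2 * S.card` is a potential that prepays the deletion of the surviving chords.
Initially, isolating `v₀`, the first sort and the prepaid deletions contribute `2 + 3 + 2 = 7` per
vertex to the doubled cost. -/
theorem ChordModel.exists_stage [Fintype V] [Nonempty V] {ω s : ℕ}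
    (h : ChordModel G (2 * Fintype.card V) a b) (hω : G.cliqueNum ≤ ω)
    (hs : 2 * Fintype.card V ≤ 4 ^ (s + 1)) (k : ℕ) (hk : k ≤ s) :
    ∃ (S : Finset V) (W : ℕ → List V) (v₀ : V) (c : ℕ), v₀ ∉ S ∧ Stage a b (k + 1) S W ∧
      CZReach c G (wordGraph (blockWord (4 ^ (s - k)) W)) ∧
      2 * c + 2 * S.card ≤ 7 * Fintype.card V + 8 * ∑ i ∈ Finset.range k,
        min (Fintype.card V) (ω * Fintype.card V / 4 ^ i) := by
  have hab : ∀ v, a v ≤ b v := fun v => (h.lt v).le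
  induction k with
  | zero =>
    obtain ⟨W, hW, hlen⟩ := h.exists_blocks
    obtain ⟨v₀⟩ := ‹Nonempty V›
    have hb : ∀ v, b v < 4 * 4 ^ s := fun v => by
      have := h.lt_bound v
      rw [pow_succ] at hs
      omega
    have hG : wordGraph (blockWord (4 * 4 ^ s) W) = G :=
      h.wordGraph_blockWord hW hlen (by rwa [pow_succ'] at hs)
    have hev : EvenWord (blockWord (4 * 4 ^ s) W) :=
      hW.evenWord fun v _ => ⟨(h.lt v).trans (hb v), hb v⟩
    -- The vertex `v₀` is sacrificed so that its letter can serve as the container in all merges.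
    have h0 := czReach_isolate G v₀
    nth_rewrite 2 [← hG] at h0
    rw [← wordGraph_filter_ne hev, filter_blockWord] at h0
    have hW' : BlockCount a b (Finset.univ.erase v₀) fun J => (W J).filter fun x => x ≠ v₀ :=
      hW.filter fun x => by simp
    obtain ⟨S', hsub, W', c, hc, hst, hr⟩ := exists_first_stage hW'
      (fun I => (List.length_filter_le _ _).trans (hlen I)) hab h.left_inj hb
      (Finset.notMem_erase v₀ _)
    refine ⟨S', W', v₀, _, fun hm => Finset.notMem_erase v₀ _ (hsub hm), hst, h0.trans hr, ?_⟩
    have h1 := Finset.card_le_card hsub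
    rw [Finset.card_erase_of_mem (Finset.mem_univ _), Finset.card_univ] at *
    simp only [Finset.range_zero, Finset.sum_empty]
    omega
  | succ k ih =>
    obtain ⟨S, W, v₀, c, hv₀, hst, hr, hc⟩ := ih (by omega)
    have e : 4 ^ (s - k) = 4 * 4 ^ (s - (k + 1)) := by
      rw [← pow_succ']
      congr 1
      omega
    obtain ⟨S', hsub, W', hst', hr'⟩ := hst.exists_next (m := 4 ^ (s - (k + 1))) hab (fun v => by
      rw [← pow_add, show k + 1 + 1 + (s - (k + 1)) = s + 1 by omega]
      exact (h.lt_bound v).trans_le hs) hv₀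
    rw [e] at hr
    refine ⟨S', W', v₀, _, fun hm => hv₀ (hsub hm), hst', hr.trans hr', ?_⟩
    have h1 := Finset.card_le_card hsub
    have h2 : S.card ≤ min (Fintype.card V) (ω * Fintype.card V / 4 ^ k) := by
      refine le_min (Finset.card_le_univ S) ?_
      rw [Nat.le_div_iff_mul_le (by positivity)]
      have h3 := hst.card_mul_le h hω
      rw [pow_succ] at h3
      linarith
    rw [Finset.sum_range_succ]
    omega

/-- At the last level a single block contains all endpoints, so no chord between distinct blocks is
left and the word is empty. -/
theorem ChordModel.exists_czReach [Fintype V] [Nonempty V] {ω s : ℕ}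
    (h : ChordModel G (2 * Fintype.card V) a b) (hω : G.cliqueNum ≤ ω)
    (hs : 2 * Fintype.card V ≤ 4 ^ (s + 1)) :
    ∃ c, CZReach c G ⊥ ∧ 2 * c ≤ 7 * Fintype.card V + 8 * ∑ i ∈ Finset.range s,
        min (Fintype.card V) (ω * Fintype.card V / 4 ^ i) := by
  obtain ⟨S, W, v₀, c, -, hst, hr, hc⟩ := h.exists_stage hω hs s le_rfl
  have hS : ∀ v, v ∉ S := by
    intro v hv
    have h1 := h.lt_bound v
    have h2 := h.lt v
    exact hst.ne v hv (by rw [Nat.div_eq_of_lt (by omega), Nat.div_eq_of_lt (by omega)])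
  refine ⟨c, ?_, by omega⟩
  have : wordGraph (blockWord (4 ^ (s - s)) W) = ⊥ := by
    ext u w
    rw [(hst.count.evenWord fun v hv => absurd hv (hS v)).wordGraph_adj,
      pairCount_eq_zero_left (hst.count.notMem_blockWord (hS u) _)]
    simp
  rwa [this] at hr

end ChordModel

/-! ### Estimating the sum over the levels -/

section Numerics

/-- The first `s` terms are at most `n` each, and the others are dominated by a geometric series
with ratio `1 / 4`. The number `t` of levels drops out. -/
theorem sum_min_div_four_pow_le (n ω s t : ℕ) :
    ((∑ i ∈ Finset.range t, min n (ω * n / 4 ^ i) : ℕ) : ℝ) ≤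
      n * (s + 4 / 3 * (ω / 4 ^ s)) := by
  have h1 : ∀ d : ℕ, ((∑ i ∈ Finset.range (s + d), min n (ω * n / 4 ^ i) : ℕ) : ℝ) ≤
      n * s + 4 / 3 * (n * ω) * (1 / 4 ^ s - 1 / 4 ^ (s + d)) := by
    intro d
    induction d with
    | zero =>
      have h : ∑ i ∈ Finset.range s, min n (ω * n / 4 ^ i) ≤ s * n := by
        simpa using Finset.sum_le_card_nsmul (Finset.range s) _ n fun i _ =>
          min_le_left n (ω * n / 4 ^ i)
      have h' : ((∑ i ∈ Finset.range s, min n (ω * n / 4 ^ i) : ℕ) : ℝ) ≤ s * n := by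
        exact_mod_cast h
      simp only [add_zero, sub_self, mul_zero]
      linarith
    | succ d ih =>
      rw [← add_assoc, Finset.sum_range_succ, Nat.cast_add]
      have h : ((min n (ω * n / 4 ^ (s + d)) : ℕ) : ℝ) ≤ n * ω * (1 / 4 ^ (s + d)) := by
        refine (Nat.cast_le.2 (min_le_right _ _)).trans (Nat.cast_div_le.trans (le_of_eq ?_))
        push_cast
        ring
      have e : (1 : ℝ) / 4 ^ (s + d + 1) = 1 / 4 ^ (s + d) / 4 := by
        rw [pow_succ]
        field_simp
      rw [e]
      nlinarith
  have h2 : ∑ i ∈ Finset.range t, min n (ω * n / 4 ^ i) ≤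
      ∑ i ∈ Finset.range (s + t), min n (ω * n / 4 ^ i) :=
    Finset.sum_le_sum_of_subset (Finset.range_mono (by omega))
  have h3 : (0 : ℝ) ≤ 4 / 3 * (n * ω) * (1 / 4 ^ (s + t)) := by positivity
  have h4 := (Nat.cast_le (α := ℝ)).2 h2
  have h5 : (n : ℝ) * (s + 4 / 3 * (ω / 4 ^ s)) = n * s + 4 / 3 * (n * ω) * (1 / 4 ^ s) := by
    ring
  have h6 := h1 t
  linarith

theorem exists_add_div_four_pow_le {ω : ℕ} (hω : 2 ≤ ω) :
    ∃ s : ℕ, (s : ℝ) + 4 / 3 * (ω / 4 ^ s) ≤ Real.logb 2 ω + 7 / 8 := by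
  have hlog : ∀ t : ℕ, 2 ^ t ≤ ω → (t : ℝ) ≤ Real.logb 2 ω := by
    intro t ht
    rw [Real.le_logb_iff_rpow_le (by norm_num) (by positivity), Real.rpow_natCast]
    exact_mod_cast ht
  by_cases h4 : ω < 4
  -- For `ω = 2` and `ω = 3` the left side is `5 / 3` and `2`; for `ω = 3` the bound `log₂ 3 ≥ 3 /
  -- 2` suffices.
  · refine ⟨1, ?_⟩
    interval_cases ω
    · have := hlog 1 (by norm_num)
      norm_num at this ⊢
    · have h : (3 / 2 : ℝ) ≤ Real.logb 2 3 := by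
        have h9 : (3 : ℝ) ≤ Real.logb 2 (3 ^ 2 : ℝ) := by
          rw [Real.le_logb_iff_rpow_le (by norm_num) (by norm_num)]
          norm_num
        rw [Real.logb_pow] at h9
        push_cast at h9
        linarith
      push_cast
      norm_num
      linarith
  · set t := Nat.log 2 ω with ht
    have h1 : 2 ^ t ≤ ω := Nat.pow_log_le_self 2 (by omega)
    have h2 : ω < 2 ^ (t + 1) := Nat.lt_pow_succ_log_self (by norm_num) ω
    have h3 := hlog t h1
    have ht2 : 2 ≤ t := by
      by_contra hc
      have : 2 ^ (t + 1) ≤ 2 ^ 2 := Nat.pow_le_pow_right (by norm_num) (by omega)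
      omega
    -- This is about `log₄ ω`, half of the logarithm allowed; the surplus absorbs the additive
    -- constants once `t ≥ 2`.
    refine ⟨t / 2 + 1, ?_⟩
    obtain ⟨k, hk | hk⟩ := Nat.even_or_odd' t
    · have hk1 : (1 : ℝ) ≤ k := by exact_mod_cast (by omega : 1 ≤ k)
      have h5 : (ω : ℝ) / 4 ^ (k + 1) ≤ 1 / 2 := by
        rw [div_le_iff₀ (by positivity)]
        have : (ω : ℝ) ≤ 2 ^ (2 * k + 1) := by
          rw [hk] at h2
          exact_mod_cast h2.le
        calc (ω : ℝ) ≤ 2 ^ (2 * k + 1) := this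
          _ = 1 / 2 * 4 ^ (k + 1) := by
            rw [pow_succ, pow_mul, pow_succ]
            norm_num
            ring
      rw [show t / 2 + 1 = k + 1 by omega]
      rw [hk] at h3
      push_cast at h3 ⊢
      linarith
    · have hk1 : (1 : ℝ) ≤ k := by exact_mod_cast (by omega : 1 ≤ k)
      have h5 : (ω : ℝ) / 4 ^ (k + 1) ≤ 1 := by
        rw [div_le_iff₀ (by positivity), one_mul]
        have : (ω : ℝ) ≤ 2 ^ (2 * (k + 1)) := by
          rw [hk] at h2
          exact_mod_cast h2.le
        calc (ω : ℝ) ≤ 2 ^ (2 * (k + 1)) := this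
          _ = 4 ^ (k + 1) := by
            rw [pow_mul]
            norm_num
      rw [show t / 2 + 1 = k + 1 by omega]
      rw [hk] at h3
      push_cast at h3 ⊢
      linarith

end Numerics

theorem ChordModel.exists_czReach_le {V : Type*} [Fintype V] [Nonempty V] {G : SimpleGraph V}
    {a b : V → ℕ} {ω : ℕ} (h : ChordModel G (2 * Fintype.card V) a b) (hω : G.cliqueNum ≤ ω)
    (hω2 : 2 ≤ ω) :
    ∃ c, CZReach c G ⊥ ∧
      (c : ℝ) ≤ 4 * Fintype.card V * Real.logb 2 ω + 7 * Fintype.card V := by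
  -- A crude number of levels is enough, since the bound on the sum does not depend on it.
  have hs : 2 * Fintype.card V ≤ 4 ^ (Fintype.card V + 1) := by
    have := (Nat.lt_pow_self (n := Fintype.card V) (a := 4) (by norm_num))
    rw [pow_succ]
    omega
  obtain ⟨c, hc, hle⟩ := h.exists_czReach hω hs
  refine ⟨c, hc, ?_⟩
  obtain ⟨s, hs'⟩ := exists_add_div_four_pow_le hω2
  have h1 := sum_min_div_four_pow_le (Fintype.card V) ω s (Fintype.card V)
  have h2 := h1.trans (mul_le_mul_of_nonneg_left hs' (Nat.cast_nonneg _))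
  have h3 := (Nat.cast_le (α := ℝ)).2 hle
  rw [Nat.cast_add, Nat.cast_mul, Nat.cast_mul, Nat.cast_mul 8] at h3
  generalize ((∑ i ∈ Finset.range (Fintype.card V),
    min (Fintype.card V) (ω * Fintype.card V / 4 ^ i) : ℕ) : ℝ) = x at *
  push_cast at h3
  linarith

/-! ### From chords of the circle to chord models -/

section Geometry

/-- Twice the signed area of the triangle formed by the points of the unit circle with arguments
`a` and `b` and the point `z`. -/
noncomputable def signedArea (a b : ℝ) (z : ℂ) : ℝ :=
  (Real.cos b - Real.cos a) * (z.im - Real.sin a) - (Real.sin b - Real.sin a) *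
    (z.re - Real.cos a)

theorem coe_circle_exp (t : ℝ) : ((Circle.exp t : Circle) : ℂ) = ⟨Real.cos t, Real.sin t⟩ := by
  apply Complex.ext <;>
    simp [Circle.coe_exp, Complex.exp_ofReal_mul_I_re, Complex.exp_ofReal_mul_I_im]

/-- In this product form the sign follows from the order of the angles, since the half differences
lie in an interval where the sine has constant sign. -/
theorem signedArea_exp (a b c : ℝ) :
    signedArea a b (Circle.exp c) =
      4 * Real.sin ((b - a) / 2) * Real.sin ((c - b) / 2) * Real.sin ((c - a) / 2) := by
  have h1 : signedArea a b (Circle.exp c) =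
      Real.sin (b - a) + Real.sin (c - b) - Real.sin (c - a) := by
    simp only [signedArea, coe_circle_exp, Real.sin_sub]
    ring
  have h2 : ∀ x y, Real.sin (2 * x) + Real.sin (2 * y) - Real.sin (2 * x + 2 * y) =
      4 * Real.sin x * Real.sin y * Real.sin (y + x) := by
    intro x y
    rw [Real.sin_add (2 * x), Real.sin_add y, Real.cos_two_mul, Real.cos_two_mul,
      Real.sin_two_mul, Real.sin_two_mul, Real.cos_sq', Real.cos_sq']
    ring
  have h3 := h2 ((b - a) / 2) ((c - b) / 2)
  rw [show 2 * ((b - a) / 2) = b - a by ring, show 2 * ((c - b) / 2) = c - b by ring,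
    show b - a + (c - b) = c - a by ring,
    show (c - b) / 2 + (b - a) / 2 = (c - a) / 2 by ring] at h3
  rw [h1, h3]

theorem signedArea_exp_pos {a b c : ℝ} (hab : a < b) (hbc : b < c) (hca : c < a + 2 * Real.pi) :
    0 < signedArea a b (Circle.exp c) := by
  rw [signedArea_exp]
  have h1 : 0 < Real.sin ((b - a) / 2) := Real.sin_pos_of_pos_of_lt_pi (by linarith) (by linarith)
  have h2 : 0 < Real.sin ((c - b) / 2) := Real.sin_pos_of_pos_of_lt_pi (by linarith) (by linarith)
  have h3 : 0 < Real.sin ((c - a) / 2) := Real.sin_pos_of_pos_of_lt_pi (by linarith) (by linarith)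
  positivity

theorem signedArea_exp_neg {a b c : ℝ} (hac : a < c) (hcb : c < b) (hba : b < a + 2 * Real.pi) :
    signedArea a b (Circle.exp c) < 0 := by
  have h := signedArea_exp_pos hac hcb hba
  have e : signedArea a b (Circle.exp c) = - signedArea a c (Circle.exp b) := by
    simp only [signedArea, coe_circle_exp]
    ring
  linarith

theorem signedArea_combo (a b : ℝ) (w z : ℂ) {s t : ℝ} (hst : s + t = 1) :
    signedArea a b (s • w + t • z) = s * signedArea a b w + t * signedArea a b z := by
  have hs : s = 1 - t := by linarith
  subst hs
  simp [signedArea]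
  ring

theorem signedArea_eq_zero {a b : ℝ} {z : ℂ}
    (hz : z ∈ segment ℝ (Circle.exp a : ℂ) (Circle.exp b)) : signedArea a b z = 0 := by
  obtain ⟨s, t, -, -, hst, rfl⟩ := hz
  rw [signedArea_combo a b _ _ hst]
  simp only [signedArea, coe_circle_exp]
  ring

/-- The signed area is affine in the point and vanishes on the first chord; it cannot vanish on a
segment whose two ends lie strictly on the same side. -/
theorem disjoint_of_signedArea {a b c d : ℝ}
    (h : (0 < signedArea a b (Circle.exp c) ∧ 0 < signedArea a b (Circle.exp d)) ∨
      (signedArea a b (Circle.exp c) < 0 ∧ signedArea a b (Circle.exp d) < 0)) :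
    ¬ (segment ℝ (Circle.exp a : ℂ) (Circle.exp b) ∩
      segment ℝ (Circle.exp c : ℂ) (Circle.exp d)).Nonempty := by
  rintro ⟨z, hz1, s, t, hs, ht, hst, rfl⟩
  have h0 := signedArea_eq_zero hz1
  rw [signedArea_combo a b _ _ hst] at h0
  rcases h with ⟨h1, h2⟩ | ⟨h1, h2⟩
  · rcases hs.eq_or_lt with rfl | hs
    · rw [zero_add] at hst
      subst hst
      linarith
    · have := mul_pos hs h1
      have := mul_nonneg ht h2.le
      linarith
  · rcases hs.eq_or_lt with rfl | hs
    · rw [zero_add] at hst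
      subst hst
      linarith
    · have := mul_neg_of_pos_of_neg hs h1
      have := mul_nonpos_of_nonneg_of_nonpos ht h2.le
      linarith

/-- The crossing point is explicit: an endpoint of one chord is weighted by the area of the triangle
spanned by its opposite endpoint and the other chord. Both pairs of weights add up to the area of
the quadrilateral. -/
theorem segment_inter_nonempty {a b c d : ℝ} (hac : a < c) (hcb : c < b) (hbd : b < d)
    (hda : d < a + 2 * Real.pi) :
    (segment ℝ (Circle.exp a : ℂ) (Circle.exp b) ∩
      segment ℝ (Circle.exp c : ℂ) (Circle.exp d)).Nonempty := by
  have h1 := signedArea_exp_pos hcb hbd (by linarith)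
  have h2 := signedArea_exp_pos (hac.trans hcb) hbd (by linarith)
  have h3 := signedArea_exp_pos hac (hcb.trans hbd) (by linarith)
  have h4 := signedArea_exp_pos hac hcb (by linarith)
  set x := signedArea c b (Circle.exp d) with hx
  set y := signedArea a b (Circle.exp d) with hy
  set z := signedArea a c (Circle.exp d) with hz
  set w := signedArea a c (Circle.exp b) with hw
  have hsum : x + z = y + w := by
    simp only [hx, hy, hz, hw, signedArea, coe_circle_exp]
    ring
  have hpos : 0 < x + z := by linarith
  refine ⟨(x / (x + z)) • (Circle.exp a : ℂ) + (z / (x + z)) • (Circle.exp b : ℂ),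
    ⟨x / (x + z), z / (x + z), by positivity, by positivity, by field_simp, rfl⟩,
    ⟨y / (x + z), w / (x + z), by positivity, by positivity, by rw [hsum]; field_simp, ?_⟩⟩
  have hre : y * Real.cos c + w * Real.cos d = x * Real.cos a + z * Real.cos b := by
    simp only [hx, hy, hz, hw, signedArea, coe_circle_exp]
    ring
  have him : y * Real.sin c + w * Real.sin d = x * Real.sin a + z * Real.sin b := by
    simp only [hx, hy, hz, hw, signedArea, coe_circle_exp]
    ring
  apply Complex.ext
  · simp only [coe_circle_exp, Complex.add_re, Complex.smul_re, smul_eq_mul]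
    field_simp
    exact hre
  · simp only [coe_circle_exp, Complex.add_im, Complex.smul_im, smul_eq_mul]
    field_simp
    exact him

/-- Two chords of the unit circle intersect if and only if their endpoints alternate weakly. -/
theorem segment_inter_nonempty_iff {a b c d : ℝ} (hab : a < b) (hcd : c < d)
    (ha : -Real.pi < a) (hb : b ≤ Real.pi) (hc : -Real.pi < c) (hd : d ≤ Real.pi) :
    (segment ℝ (Circle.exp a : ℂ) (Circle.exp b) ∩
      segment ℝ (Circle.exp c : ℂ) (Circle.exp d)).Nonempty ↔
      (a ≤ c ∧ c ≤ b ∧ b ≤ d) ∨ (c ≤ a ∧ a ≤ d ∧ d ≤ b) := by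
  constructor
  · intro h
    by_contra hcon
    have hcases : b < c ∨ d < a ∨ (a < c ∧ d < b) ∨ (c < a ∧ b < d) := by
      by_contra hcc
      push Not at hcc
      obtain ⟨h1, h2, h3, h4⟩ := hcc
      refine hcon ?_
      rcases lt_trichotomy a c with h5 | h5 | h5
      · exact .inl ⟨h5.le, h1, h3 h5⟩
      · rcases le_total b d with h6 | h6
        · exact .inl ⟨h5.le, h1, h6⟩
        · exact .inr ⟨h5.ge, h2, h6⟩
      · exact .inr ⟨h5.le, h2, h4 h5⟩
    rcases hcases with h1 | h1 | ⟨h1, h2⟩ | ⟨h1, h2⟩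
    · exact disjoint_of_signedArea (.inl ⟨signedArea_exp_pos hab h1 (by linarith),
        signedArea_exp_pos hab (h1.trans hcd) (by linarith)⟩) h
    · rw [Set.inter_comm] at h
      exact disjoint_of_signedArea (.inl ⟨signedArea_exp_pos hcd h1 (by linarith),
        signedArea_exp_pos hcd (h1.trans hab) (by linarith)⟩) h
    · exact disjoint_of_signedArea (.inr ⟨signedArea_exp_neg h1 (by linarith) (by linarith),
        signedArea_exp_neg (h1.trans hcd) h2 (by linarith)⟩) h
    · rw [Set.inter_comm] at h
      exact disjoint_of_signedArea (.inr ⟨signedArea_exp_neg h1 (by linarith) (by linarith),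
        signedArea_exp_neg (h1.trans hab) h2 (by linarith)⟩) h
  · have key : ∀ {a b c d : ℝ}, -Real.pi < a → d ≤ Real.pi → a ≤ c → c ≤ b → b ≤ d →
        (segment ℝ (Circle.exp a : ℂ) (Circle.exp b) ∩
          segment ℝ (Circle.exp c : ℂ) (Circle.exp d)).Nonempty := by
      intro a b c d ha hd h1 h2 h3
      rcases h1.eq_or_lt with rfl | h1
      · exact ⟨_, left_mem_segment _ _ _, left_mem_segment _ _ _⟩
      rcases h2.eq_or_lt with rfl | h2
      · exact ⟨_, right_mem_segment _ _ _, left_mem_segment _ _ _⟩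
      rcases h3.eq_or_lt with rfl | h3
      · exact ⟨_, right_mem_segment _ _ _, right_mem_segment _ _ _⟩
      exact segment_inter_nonempty h1 h2 h3 (by linarith)
    rintro (⟨h1, h2, h3⟩ | ⟨h1, h2, h3⟩)
    · exact key ha hd h1 h2 h3
    · rw [Set.inter_comm]
      exact key hc hb h1 h2 h3

theorem IsCircleGraph.exists_angles {V : Type*} {G : SimpleGraph V} (hG : IsCircleGraph G) :
    ∃ l h : V → ℝ, (∀ v, l v < h v) ∧ ∀ u v, u ≠ v → (G.Adj u v ↔
      (l u ≤ l v ∧ l v ≤ h u ∧ h u ≤ h v) ∨ (l v ≤ l u ∧ l u ≤ h v ∧ h v ≤ h u)) := by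
  obtain ⟨p, q, hpq, hadj⟩ := hG
  have hlt : ∀ v, min (Complex.arg (p v)) (Complex.arg (q v)) <
      max (Complex.arg (p v)) (Complex.arg (q v)) := fun v =>
    min_lt_max.2 fun e => hpq v (Circle.injective_arg e)
  have hseg : ∀ v, segment ℝ (p v : ℂ) (q v : ℂ) =
      segment ℝ (Circle.exp (min (Complex.arg (p v)) (Complex.arg (q v))) : ℂ)
        (Circle.exp (max (Complex.arg (p v)) (Complex.arg (q v)))) := by
    intro v
    rcases le_total (Complex.arg (p v)) (Complex.arg (q v)) with h | h
    · rw [min_eq_left h, max_eq_right h, Circle.exp_arg, Circle.exp_arg]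
    · rw [min_eq_right h, max_eq_left h, Circle.exp_arg, Circle.exp_arg, segment_symm]
  refine ⟨_, _, hlt, fun u v huv => ?_⟩
  rw [hadj u v huv, hseg u, hseg v]
  exact segment_inter_nonempty_iff (hlt u) (hlt v)
    (lt_min (Complex.neg_pi_lt_arg _) (Complex.neg_pi_lt_arg _))
    (max_le (Complex.arg_le_pi _) (Complex.arg_le_pi _))
    (lt_min (Complex.neg_pi_lt_arg _) (Complex.neg_pi_lt_arg _))
    (max_le (Complex.arg_le_pi _) (Complex.arg_le_pi _))

/-- The endpoints of the chords, `(v, false)` being the first and `(v, true)` the second endpoint of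
the chord of `v`, are ordered by their angles; ties are broken such that chords with a common
endpoint interlace. -/
noncomputable def endKey {V : Type*} [Fintype V] (l h : V → ℝ) (e : V × Bool) :
    ℝ ×ₗ Bool ×ₗ ℝ ×ₗ Fin (Fintype.card V) :=
  toLex (if e.2 then h e.1 else l e.1, toLex (e.2, toLex (if e.2 then l e.1 else h e.1,
    Fintype.equivFin V e.1)))

theorem exists_chordModel_of_angles {V : Type*} [Fintype V] {G : SimpleGraph V} {l h : V → ℝ}
    (hlt : ∀ v, l v < h v) (hadj : ∀ u v, u ≠ v → (G.Adj u v ↔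
      (l u ≤ l v ∧ l v ≤ h u ∧ h u ≤ h v) ∨ (l v ≤ l u ∧ l u ≤ h v ∧ h v ≤ h u))) :
    ∃ a b : V → ℕ, ChordModel G (2 * Fintype.card V) a b := by
  classical
  set K := endKey l h with hK
  have hKinj : ∀ e f, K e = K f → e = f := by
    intro e f hef
    simp only [hK, endKey, EmbeddingLike.apply_eq_iff_eq, Prod.mk.injEq] at hef
    exact Prod.ext hef.2.2.2 hef.2.1
  set rank : V × Bool → ℕ := fun e => (Finset.univ.filter fun f => K f < K e).card with hrank
  have hmono : ∀ {e f}, K e < K f → rank e < rank f := by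
    intro e f hef
    refine Finset.card_lt_card (Finset.ssubset_iff_of_subset ?_ |>.2 ⟨e, ?_, ?_⟩)
    · intro x hx
      simp only [Finset.mem_filter, Finset.mem_univ, true_and] at hx ⊢
      exact hx.trans hef
    · simpa using hef
    · simp
  have hiff : ∀ e f, rank e < rank f ↔ K e < K f := by
    refine fun e f => ⟨fun hr => ?_, hmono⟩
    by_contra hc
    rcases (not_lt.1 hc).eq_or_lt with h1 | h1
    · rw [hKinj _ _ h1] at hr
      exact lt_irrefl _ hr
    · exact lt_asymm hr (hmono h1)
  have hinj : ∀ e f, rank e = rank f → e = f := by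
    intro e f hr
    by_contra hne
    rcases lt_or_gt_of_ne (fun h => hne (hKinj e f h)) with h1 | h1
    · exact (hmono h1).ne hr
    · exact (hmono h1).ne' hr
  have hbound : ∀ e, rank e < 2 * Fintype.card V := by
    intro e
    have h1 : rank e < (Finset.univ : Finset (V × Bool)).card :=
      Finset.card_lt_card (Finset.filter_ssubset.2 ⟨e, by simp⟩)
    rw [Finset.card_univ, Fintype.card_prod, Fintype.card_bool] at h1
    omega
  have hff : ∀ u w, K (u, false) < K (w, false) ↔ l u < l w ∨ (l u = l w ∧ (h u < h w ∨
      (h u = h w ∧ Fintype.equivFin V u < Fintype.equivFin V w))) := by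
    simp [hK, endKey, Prod.Lex.toLex_lt_toLex]
  have htt : ∀ u w, K (u, true) < K (w, true) ↔ h u < h w ∨ (h u = h w ∧ (l u < l w ∨
      (l u = l w ∧ Fintype.equivFin V u < Fintype.equivFin V w))) := by
    simp [hK, endKey, Prod.Lex.toLex_lt_toLex]
  -- The weak inequality shows the tie-break at work: at equal angles first endpoints precede second
  -- ones, so chords that merely touch there become interlaced.
  have hft : ∀ u w, K (u, false) < K (w, true) ↔ l u ≤ h w := by
    simp [hK, endKey, Prod.Lex.toLex_lt_toLex, le_iff_lt_or_eq]
  refine ⟨fun v => rank (v, false), fun v => rank (v, true), ?_, fun v => hbound _, ?_, ?_, ?_, ?_⟩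
  · exact fun v => (hiff _ _).2 ((hft v v).2 (hlt v).le)
  · exact fun u w huw => congrArg Prod.fst (hinj _ _ huw)
  · exact fun u w huw => congrArg Prod.fst (hinj _ _ huw)
  · exact fun u w huw => by simpa using congrArg Prod.snd (hinj _ _ huw)
  · intro u w huw
    simp only [hiff, hff, htt, hft, hadj u w huw]
    have hu := hlt u
    have hw := hlt w
    have hne : Fintype.equivFin V u ≠ Fintype.equivFin V w := fun e =>
      huw ((Fintype.equivFin V).injective e)
    rcases lt_or_gt_of_ne hne with h3 | h3 <;> grind

theorem IsCircleGraph.exists_chordModel {V : Type*} [Fintype V] {G : SimpleGraph V}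
    (hG : IsCircleGraph G) : ∃ a b : V → ℕ, ChordModel G (2 * Fintype.card V) a b := by
  obtain ⟨l, h, hlt, hadj⟩ := hG.exists_angles
  exact exists_chordModel_of_angles hlt hadj

end Geometry

theorem IsCircleGraph.exists_czReach_le {V : Type*} [Fintype V] {G : SimpleGraph V} {ω : ℕ}
    (hG : IsCircleGraph G) (hω : G.cliqueNum ≤ ω) :
    ∃ c, CZReach c G ⊥ ∧
      (c : ℝ) ≤ 4 * Fintype.card V * Real.logb 2 ω + 7 * Fintype.card V := by
  by_cases hω2 : 2 ≤ ω
  · cases isEmpty_or_nonempty V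
    · refine ⟨0, ?_, by simp⟩
      rw [Subsingleton.elim G ⊥]
      exact .refl _ _
    · obtain ⟨a, b, h⟩ := hG.exists_chordModel
      exact h.exists_czReach_le hω hω2
  -- With `ω ≤ 1` there are no edges, and the logarithm is 0, also for `ω = 0` by convention.
  · classical
    have hbot : G = ⊥ := by
      ext u w
      simp only [SimpleGraph.bot_adj, iff_false]
      intro huw
      have h1 : ({u, w} : Finset V).card ≤ G.cliqueNum :=
        SimpleGraph.IsClique.card_le_cliqueNum (tc := by simpa using fun _ => huw)
      rw [Finset.card_pair huw.ne] at h1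
      omega
    have hlog : Real.logb 2 ω = 0 := by
      have : ω = 0 ∨ ω = 1 := by omega
      rcases this with rfl | rfl <;> simp
    refine ⟨0, ?_, ?_⟩
    · rw [hbot]
      exact .refl _ _
    · rw [hlog]
      push_cast
      positivity

end CZDistance

theorem mainTheorem2 {V : Type*} [Fintype V] (G : SimpleGraph V) (ω : ℕ)
    (hG : CZDistance.IsCircleGraph G) (hω : G.cliqueNum ≤ ω) :
    (CZDistance.stateCZ G : ℝ) ≤
        4 * (Fintype.card V : ℝ) * Real.logb 2 (ω : ℝ) + 7 * (Fintype.card V : ℝ) ∧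
      (CZDistance.cz G : ℝ) ≤
        4 * (Fintype.card V : ℝ) * Real.logb 2 (ω : ℝ) + 7 * (Fintype.card V : ℝ) := by
  obtain ⟨c, hc, hle⟩ := hG.exists_czReach_le hω
  exact ⟨(Nat.cast_le.2 hc.stateCZ_le).trans hle, (Nat.cast_le.2 hc.cz_le).trans hle⟩
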